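/- **Setting.** All von Neumann algebras contain the identity of their Hilbert space; $\vee$ denotes the generated von Neumann algebra, $\bar\otimes$ the von Neumann algebra tensor product; "normal" means ultraweakly continuous; W*-isomorphisms are normal $*$-isomorphisms. On a Hilbert space $\mathcal H$ let $\mathcal B$ be a von Neumann algebra and, for $t\in[0,\infty)$, let $\mathcal B_{t]}\subseteq\mathcal B$ be increasing (past), $\mathcal B_{[t}\subseteq\mathcal B$ decreasing (present and future), and $\mathcal A_t\subseteq\mathcal B_{[t}$ decreasing (noise) von Neumann subalgebras with $\mathcal B_{t]}\subseteq\mathcal A_t'$. Put $\mathcal A_s^t=\mathcal A_s\cap\mathcal B_{t]}$ for $s<t$. For von Neumann algebras on the same space we call $\mathcal P$ the W*-product of $\mathcal M$ and $\mathcal N$, written $\mathcal M\bar\otimes\mathcal N\sim\mathcal P$, if there is a W*-isomorphism $\mathcal M\bar\otimes\mathcal N\to\mathcal P$ with $a\otimes b\mapsto ab$. Assume $\mathcal B_{s]}\bar\otimes\mathcal A_s^t\sim\mathcal B_{t]}$ for all $s<t$. Let $(\Omega,\mathfrak A)$ be a measurable (trajectory) space, $\mathfrak A_{t]}$ increasing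 and $\mathfrak A_t$ decreasing sub-$\sigma$-algebras of $\mathfrak A$ (histories up to $t$, events after $t$), $\mathfrak A_s^t=\mathfrak A_s\cap\mathfrak A_{t]}$. Sets in $\mathfrak A_s^t$ are understood as cylinder sets in $\Omega$, so that the product $\Delta\times\Delta'$ of $\Delta\in\mathfrak A_s^t$ and $\Delta'\in\mathfrak A_t^u$, $s<t<u$, is the set $\Delta\cap\Delta'\in\mathfrak A_s^u$. Let $E$ be a $\sigma$-homomorphism (spectral measure) from $\mathfrak A$ to the orthoprojectors of $\mathcal H$ with $E(\mathfrak A_{t]})\subseteq\mathcal B_{t]}\cap(\mathcal B_{[t})'$ and $E(\mathfrak A_t)\subseteq\mathcal B_{[t}$, and let $\mathcal M_{t]}$, $\mathcal M_t$ be the von Neumann algebras generated by $E(\mathfrak A_{t]})$, $E(\mathfrak A_t)$, and $\mathcal M_s^t=\mathcal M_s\cap\mathcal M_{t]}$. The quantum object is given by von Neumann algebras $\mathfrak b_t\subseteq\mathcal B_{t]}\cap\mathcal B_{[t}$ and W*-isomorphisms $\pi_t:\mathfrak b(t)\to\mathfrak b_t$, where $\mathfrak b(t)$ is a von Neumann algebra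 on some Hilbert space. It is assumed to be dynamical: $\mathcal M_s^t\vee\mathfrak b_t\subseteq\mathfrak b_s\vee\mathcal A_s^t$ for all $s<t$. A *transitional measure* from $s$ to $t$, $s<t$, is $$\Upsilon_s^t(\Delta,q)=E^s(\Delta)\,\gamma_s^t(q)\in\mathfrak b(s)\bar\otimes\mathcal A_s^t,\qquad \Delta\in\mathfrak A_s^t,\ q\in\mathfrak b(t),$$ with $E^s(\Delta)=\pi^s(E(\Delta))$ and $\gamma_s^t=\pi^s\circ\pi_t$ a $*$-homomorphism, where $\pi^s$ is the inverse of a W*-isomorphism $\mathfrak b(s)\bar\otimes\mathcal A_s^t\to\mathfrak b_s\vee\mathcal A_s^t$ extending $\pi_s$ by $q\otimes a\mapsto\pi_s(q)a$. Let $\varpi$ be a normal state on $\mathcal B$ and $\varrho_t$ a normal state on $\mathcal A_t$ for every $t$, such that $\varpi$ is a product state for every $t$: $$\langle\varpi|ba\rangle=\langle\varpi|b\rangle\langle\varrho_t|a\rangle,\qquad b\in\mathcal B_{t]},\ a\in\mathcal A_t^u,\ t<u .$$ For an algebra $\mathcal P$ that is $\mathcal M\bar\otimes\mathcal N$, or a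 W*-product $\mathcal M\bar\otimes\mathcal N\sim\mathcal P$, with $\mathcal N\subseteq\mathcal A_s$, let $\varrho_s^\star:\mathcal P\to\mathcal M$ be the linear map such that, for every normal state $\omega$ on $\mathcal M$, $x\mapsto\langle\omega|\varrho_s^\star[x]\rangle$ is a normal state on $\mathcal P$ equal to the product state $\omega\otimes\varrho_s$, i.e. with the value $\langle\omega|a\rangle\langle\varrho_s|b\rangle$ on the product of $a\in\mathcal M$ and $b\in\mathcal N$. **Corollary.** Under these assumptions: 1. The object is Markovian in the state $\varpi$: for $s<t$ there is a normal completely positive conditional expectation of $\mathcal B_{t]}$ onto $\mathcal B_{s]}$ which preserves $\varpi$ and maps $\mathfrak b_s\vee\mathcal A_s^t$ into $\mathfrak b_s$. 2. For every $s$ and all von Neumann algebras $\mathcal N\subseteq\mathcal A_s$ and $\mathcal P$ on $\mathcal H$ with $\mathcal B_{s]}\bar\otimes\mathcal N\sim\mathcal P$ (in particular $\mathcal P=\mathcal B_{t]}$ for $t>s$, and $\mathcal P=\mathcal B$ if $\mathcal B_{s]}\bar\otimes\mathcal A_s\sim\mathcal B$) the map $\varrho_s^\star:\mathcal P\to\mathcal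 B_{s]}$ exists, is unique, and is a normal completely positive conditional expectation onto $\mathcal B_{s]}$. The map $\varrho_s^\star:\mathfrak b(s)\bar\otimes\mathcal A_s^t\to\mathfrak b(s)$ exists and is unique for all $s<t$, and transitional measures $\Upsilon_s^t$ exist for all $s<t$. 3. The reduced transitional measures $\mathcal T_s^t(\Delta,q)=\varrho_s^\star[\Upsilon_s^t(\Delta,q)]$, $s<t$, $\Delta\in\mathfrak A_s^t$, are normal completely positive maps $\mathfrak b(t)\to\mathfrak b(s)$ in $q$, weakly countably additive in $\Delta$, and $\mathcal T_s^t(\Omega,1)=1$. They satisfy the operational Chapman–Kolmogorov (hemigroup) equation: for $s<t<u$, $\Delta\in\mathfrak A_s^t$, $\Delta'\in\mathfrak A_t^u$ the product $\Delta\times\Delta'$ is in $\mathfrak A_s^u$ and $$\mathcal T_s^t\bigl(\Delta,\mathcal T_t^u(\Delta',q)\bigr)=\mathcal T_s^u(\Delta\times\Delta',q),\qquad q\in\mathfrak b(u).$$ 4. They describe the object operationally: for $s<t$, $\Delta\in\mathfrak A_s^t$, $q\in\mathfrak b(t)$ one has $\pi_s(\mathcal T_s^t(\Delta,q))=\varrho_s^\star[E(\Delta)\pi_t(q)]$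 with $\varrho_s^\star:\mathcal P\to\mathcal B_{s]}$ for every $\mathcal P$ as in 2 with $\mathcal A_s^t\subseteq\mathcal N$, and $\langle\varpi|b\,E(\Delta)\pi_t(q)\rangle=\langle\varpi|b\,\pi_s(\mathcal T_s^t(\Delta,q))\rangle$ for all $b\in\mathcal B_{s]}$. -/

import Mathlib

open scoped NNReal TensorProduct MeasureTheory

/-! ### Operations on von Neumann algebras -/

section VonNeumann

variable {H : Type*} [NormedAddCommGroup H] [InnerProductSpace ℂ H] [CompleteSpace H]

/-- The von Neumann algebra generated by a set of bounded operators: the double commutant of the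
set together with the adjoints of its elements. -/
noncomputable def vnGenerated (S : Set (H →L[ℂ] H)) : VonNeumannAlgebra H where
  toStarSubalgebra :=
    StarSubalgebra.centralizer ℂ (StarSubalgebra.centralizer ℂ S : Set (H →L[ℂ] H))
  centralizer_centralizer' := by
    change Set.centralizer (Set.centralizer
      ((StarSubalgebra.centralizer ℂ (StarSubalgebra.centralizer ℂ S : Set (H →L[ℂ] H))) :
        Set (H →L[ℂ] H))) = _
    rw [StarSubalgebra.coe_centralizer, Set.centralizer_centralizer_centralizer]
    exact (StarSubalgebra.coe_centralizer (R := ℂ) _).symm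

/-- The generated algebra contains its generators. -/
theorem subset_vnGenerated (S : Set (H →L[ℂ] H)) : S ⊆ (vnGenerated S : Set (H →L[ℂ] H)) := by
  intro a ha
  change a ∈ StarSubalgebra.centralizer ℂ (StarSubalgebra.centralizer ℂ S : Set (H →L[ℂ] H))
  rw [StarSubalgebra.mem_centralizer_iff]
  intro g hg
  have hg' : g ∈ StarSubalgebra.centralizer ℂ S := hg
  have hs : star g ∈ StarSubalgebra.centralizer ℂ S := star_mem hg'
  rw [StarSubalgebra.mem_centralizer_iff] at hg' hs
  exact ⟨((hg' a ha).1).symm, ((hs a ha).1).symm⟩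

/-- The intersection of two von Neumann algebras. -/
noncomputable def vnInf (M N : VonNeumannAlgebra H) : VonNeumannAlgebra H where
  toStarSubalgebra := M.toStarSubalgebra ⊓ N.toStarSubalgebra
  centralizer_centralizer' := by
    change Set.centralizer (Set.centralizer ((M : Set (H →L[ℂ] H)) ∩ (N : Set (H →L[ℂ] H)))) =
      (M : Set (H →L[ℂ] H)) ∩ (N : Set (H →L[ℂ] H))
    refine Set.Subset.antisymm (fun x hx => ⟨?_, ?_⟩) Set.subset_centralizer_centralizer
    · rw [← M.centralizer_centralizer]
      exact Set.centralizer_subset (Set.centralizer_subset Set.inter_subset_left) hx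
    · rw [← N.centralizer_centralizer]
      exact Set.centralizer_subset (Set.centralizer_subset Set.inter_subset_right) hx

/-- The von Neumann algebra `M ∨ N` generated by `M` and `N`. -/
noncomputable def vnJoin (M N : VonNeumannAlgebra H) : VonNeumannAlgebra H :=
  vnGenerated ((M : Set (H →L[ℂ] H)) ∪ (N : Set (H →L[ℂ] H)))

end VonNeumann

/-! ### Hilbert space tensor products and tensor products of von Neumann algebras -/

section Tensor

/-- The Hilbert space tensor product. -/
abbrev HilbertTensor (K H : Type*) [NormedAddCommGroup K] [InnerProductSpace ℂ K]
    [NormedAddCommGroup H] [InnerProductSpace ℂ H] : Type _ :=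
  UniformSpace.Completion (K ⊗[ℂ] H)

variable {K H : Type*} [NormedAddCommGroup K] [InnerProductSpace ℂ K] [CompleteSpace K]
  [NormedAddCommGroup H] [InnerProductSpace ℂ H] [CompleteSpace H]

open TensorProduct in
theorem inner_tensor_map_adjoint (a : K →L[ℂ] K) (b : H →L[ℂ] H) (x y : K ⊗[ℂ] H) :
    inner ℂ (map (a : K →ₗ[ℂ] K) (b : H →ₗ[ℂ] H) x) y =
      inner ℂ x (map ((star a : K →L[ℂ] K) : K →ₗ[ℂ] K) ((star b : H →L[ℂ] H) : H →ₗ[ℂ] H) y) := by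
  induction x using TensorProduct.induction_on with
  | zero => simp
  | add x₁ x₂ h₁ h₂ => simp only [map_add, inner_add_left, h₁, h₂]
  | tmul k l =>
    induction y using TensorProduct.induction_on with
    | zero => simp
    | add y₁ y₂ h₁ h₂ => simp only [map_add, inner_add_right, h₁, h₂]
    | tmul k' l' =>
      simp [ContinuousLinearMap.star_eq_adjoint, ContinuousLinearMap.adjoint_inner_right]

open TensorProduct in
theorem norm_tensor_map_left_le (a : K →L[ℂ] K) (x : K ⊗[ℂ] H) :
    ‖map (a : K →ₗ[ℂ] K) ((1 : H →L[ℂ] H) : H →ₗ[ℂ] H) x‖ ≤ ‖a‖ * ‖x‖ := by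
  have h0 : 0 ≤ algebraMap ℝ (K →L[ℂ] K) (‖a‖ ^ 2) - star a * a :=
    sub_nonneg.2 (CStarAlgebra.star_mul_le_algebraMap_norm_sq (a := a))
  obtain ⟨c, hc⟩ := CStarAlgebra.nonneg_iff_eq_star_mul_self.1 h0
  have key (d : K →L[ℂ] K) : ((‖map (d : K →ₗ[ℂ] K) ((1 : H →L[ℂ] H) : H →ₗ[ℂ] H) x‖ ^ 2 : ℝ) : ℂ) =
      inner ℂ x (map ((star d * d : K →L[ℂ] K) : K →ₗ[ℂ] K) ((1 : H →L[ℂ] H) : H →ₗ[ℂ] H) x) := by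
    have h := inner_self_eq_norm_sq_to_K (𝕜 := ℂ)
      (map (d : K →ₗ[ℂ] K) ((1 : H →L[ℂ] H) : H →ₗ[ℂ] H) x)
    rw [inner_tensor_map_adjoint, star_one, ← LinearMap.comp_apply, ← TensorProduct.map_comp] at h
    push_cast
    exact h.symm
  have h1 := key a
  have h2 := key c
  rw [← hc] at h2
  have h3 : map ((algebraMap ℝ (K →L[ℂ] K) (‖a‖ ^ 2) - star a * a : K →L[ℂ] K) : K →ₗ[ℂ] K)
        ((1 : H →L[ℂ] H) : H →ₗ[ℂ] H) x =
      ((‖a‖ ^ 2 : ℝ) : ℂ) • x -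
        map ((star a * a : K →L[ℂ] K) : K →ₗ[ℂ] K) ((1 : H →L[ℂ] H) : H →ₗ[ℂ] H) x := by
    clear key h1 h2 hc h0
    induction x using TensorProduct.induction_on with
    | zero => simp
    | add x₁ x₂ g₁ g₂ => rw [_root_.map_add, g₁, g₂, _root_.map_add, smul_add]; abel
    | tmul k l =>
      simp only [TensorProduct.map_tmul, Algebra.algebraMap_eq_smul_one,
        ContinuousLinearMap.coe_coe, sub_apply, TensorProduct.sub_tmul,
        smul_apply, one_apply_eq_self, TensorProduct.smul_tmul']
      rw [Complex.coe_smul]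
  have h5 : inner ℂ x (((‖a‖ ^ 2 : ℝ) : ℂ) • x) = ((‖a‖ ^ 2 : ℝ) : ℂ) * inner ℂ x x :=
    inner_smul_right x x _
  have h6 : inner ℂ x x = ((‖x‖ ^ 2 : ℝ) : ℂ) := by
    have h := inner_self_eq_norm_sq_to_K (𝕜 := ℂ) x
    push_cast
    exact h
  rw [h3, inner_sub_right, h5, ← h1, h6] at h2
  have h4 : ‖map (c : K →ₗ[ℂ] K) ((1 : H →L[ℂ] H) : H →ₗ[ℂ] H) x‖ ^ 2 =
      ‖a‖ ^ 2 * ‖x‖ ^ 2 - ‖map (a : K →ₗ[ℂ] K) ((1 : H →L[ℂ] H) : H →ₗ[ℂ] H) x‖ ^ 2 := by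
    exact_mod_cast h2
  refine abs_le_of_sq_le_sq' ?_ (by positivity) |>.2
  nlinarith [sq_nonneg ‖map (c : K →ₗ[ℂ] K) ((1 : H →L[ℂ] H) : H →ₗ[ℂ] H) x‖]

open TensorProduct in
theorem norm_tensor_map_le (a : K →L[ℂ] K) (b : H →L[ℂ] H) (x : K ⊗[ℂ] H) :
    ‖map (a : K →ₗ[ℂ] K) (b : H →ₗ[ℂ] H) x‖ ≤ ‖a‖ * ‖b‖ * ‖x‖ := by
  have h1 : map (a : K →ₗ[ℂ] K) (b : H →ₗ[ℂ] H) x =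
      map (a : K →ₗ[ℂ] K) ((1 : H →L[ℂ] H) : H →ₗ[ℂ] H)
        (map ((1 : K →L[ℂ] K) : K →ₗ[ℂ] K) (b : H →ₗ[ℂ] H) x) := by
    rw [← LinearMap.comp_apply, ← TensorProduct.map_comp]
    rfl
  have h2 : TensorProduct.comm ℂ K H (map ((1 : K →L[ℂ] K) : K →ₗ[ℂ] K) (b : H →ₗ[ℂ] H) x) =
      map (b : H →ₗ[ℂ] H) ((1 : K →L[ℂ] K) : K →ₗ[ℂ] K) (TensorProduct.comm ℂ K H x) := by
    rw [TensorProduct.map_comm]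
  have h3 := norm_tensor_map_left_le b (TensorProduct.comm ℂ K H x)
  rw [← h2, TensorProduct.norm_comm, TensorProduct.norm_comm] at h3
  rw [h1, mul_assoc]
  exact (norm_tensor_map_left_le a _).trans (mul_le_mul_of_nonneg_left h3 (norm_nonneg a))

/-- The operator `a ⊗ b` on the Hilbert space tensor product. -/
noncomputable def tensorOp (a : K →L[ℂ] K) (b : H →L[ℂ] H) :
    HilbertTensor K H →L[ℂ] HilbertTensor K H :=
  ((TensorProduct.map (a : K →ₗ[ℂ] K) (b : H →ₗ[ℂ] H)).mkContinuous (‖a‖ * ‖b‖)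
    (norm_tensor_map_le a b)).completion

theorem tensorOp_tmul (a : K →L[ℂ] K) (b : H →L[ℂ] H) (k : K) (l : H) :
    tensorOp a b ((k ⊗ₜ[ℂ] l : K ⊗[ℂ] H) : HilbertTensor K H) =
      ((a k ⊗ₜ[ℂ] b l : K ⊗[ℂ] H) : HilbertTensor K H) := by
  simp [tensorOp]

/-- The von Neumann algebra tensor product `M ⊗̄ N`, generated by the operators `a ⊗ b` with
`a ∈ M`, `b ∈ N`. -/
noncomputable def vnTensor (M : VonNeumannAlgebra K) (N : VonNeumannAlgebra H) :
    VonNeumannAlgebra (HilbertTensor K H) :=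
  vnGenerated {x | ∃ a ∈ M, ∃ b ∈ N, x = tensorOp a b}

end Tensor

/-! ### Normal functionals, normal maps, complete positivity -/

section Normal

variable {H K L : Type*} [NormedAddCommGroup H] [InnerProductSpace ℂ H] [CompleteSpace H]
  [NormedAddCommGroup K] [InnerProductSpace ℂ K] [CompleteSpace K]
  [NormedAddCommGroup L] [InnerProductSpace ℂ L] [CompleteSpace L]

/-- A linear functional on `M` is normal (ultraweakly continuous) if it has the form
`x ↦ ∑ ⟨ξₙ, x ηₙ⟩` with square-summable `ξ` and `η`. -/
def IsNormalFunctional (M : VonNeumannAlgebra H) (φ : M.toStarSubalgebra →ₗ[ℂ] ℂ) : Prop :=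
  ∃ ξ η : ℕ → H, Summable (fun n => ‖ξ n‖ ^ 2) ∧ Summable (fun n => ‖η n‖ ^ 2) ∧
    ∀ x : M.toStarSubalgebra, HasSum (fun n => inner ℂ (ξ n) ((x : H →L[ℂ] H) (η n))) (φ x)

open scoped ComplexOrder in
/-- Normal states: normal functionals that are positive and take the value one at the identity. -/
def IsNormalState (M : VonNeumannAlgebra H) (φ : M.toStarSubalgebra →ₗ[ℂ] ℂ) : Prop :=
  IsNormalFunctional M φ ∧ (∀ x, 0 ≤ φ (star x * x)) ∧ φ 1 = 1

/-- A linear map of von Neumann algebras is normal (continuous for the ultraweak topologies) if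
it pulls normal functionals back to normal functionals. -/
def IsNormalMap (M : VonNeumannAlgebra H) (N : VonNeumannAlgebra K)
    (Φ : M.toStarSubalgebra →ₗ[ℂ] N.toStarSubalgebra) : Prop :=
  ∀ φ : N.toStarSubalgebra →ₗ[ℂ] ℂ, IsNormalFunctional N φ → IsNormalFunctional M (φ ∘ₗ Φ)

open scoped ComplexOrder in
/-- Complete positivity: `∑ᵢₖ ⟨ξᵢ, Φ(xᵢ* xₖ) ξₖ⟩ ≥ 0` for all finite families. -/
def IsCompletelyPositive (M : VonNeumannAlgebra H) (N : VonNeumannAlgebra K)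
    (Φ : M.toStarSubalgebra →ₗ[ℂ] N.toStarSubalgebra) : Prop :=
  ∀ (n : ℕ) (x : Fin n → M.toStarSubalgebra) (ξ : Fin n → K),
    0 ≤ ∑ i, ∑ k, inner ℂ (ξ i) ((Φ (star (x i) * x k) : K →L[ℂ] K) (ξ k))

/-- A W*-isomorphism: a *-isomorphism that is normal in both directions. -/
def IsWStarIso (M : VonNeumannAlgebra H) (N : VonNeumannAlgebra K)
    (Θ : M.toStarSubalgebra ≃⋆ₐ[ℂ] N.toStarSubalgebra) : Prop :=
  (∀ φ : N.toStarSubalgebra →ₗ[ℂ] ℂ, IsNormalFunctional N φ →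
    ∃ ψ : M.toStarSubalgebra →ₗ[ℂ] ℂ, IsNormalFunctional M ψ ∧ ∀ x, ψ x = φ (Θ x)) ∧
  (∀ ψ : M.toStarSubalgebra →ₗ[ℂ] ℂ, IsNormalFunctional M ψ →
    ∃ φ : N.toStarSubalgebra →ₗ[ℂ] ℂ, IsNormalFunctional N φ ∧ ∀ y, φ y = ψ (Θ.symm y))

/-- `P` is the W*-product of its subalgebras `M` and `N`: there is a W*-isomorphism of `M ⊗̄ N`
onto `P` with `a ⊗ b ↦ a b`. -/
def IsWStarProduct (M N P : VonNeumannAlgebra H) : Prop :=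
  ∃ Θ : (vnTensor M N).toStarSubalgebra ≃⋆ₐ[ℂ] P.toStarSubalgebra,
    IsWStarIso (vnTensor M N) P Θ ∧
    ∀ a ∈ M, ∀ b ∈ N, ∀ x : (vnTensor M N).toStarSubalgebra,
      (x : HilbertTensor H H →L[ℂ] HilbertTensor H H) = tensorOp a b →
        (Θ x : H →L[ℂ] H) = a * b

/-- `ε` is a conditional expectation of `P` onto its subalgebra `M`: a normal completely positive
projection with the module property. -/
def IsCondExpectation (P M : VonNeumannAlgebra H)
    (ε : P.toStarSubalgebra →ₗ[ℂ] M.toStarSubalgebra) : Prop :=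
  M ≤ P ∧ IsNormalMap P M ε ∧ IsCompletelyPositive P M ε ∧
  (∀ x : P.toStarSubalgebra, (x : H →L[ℂ] H) ∈ M → (ε x : H →L[ℂ] H) = x) ∧
  ∀ a b x : P.toStarSubalgebra, (a : H →L[ℂ] H) ∈ M → (b : H →L[ℂ] H) ∈ M →
    (ε (a * x * b) : H →L[ℂ] H) = a * (ε x : H →L[ℂ] H) * b

/-- Let `ϱ` be a functional on `A`, `N ⊆ A`, and let `P` be a product of `M` and `N` in which the
product of `a ∈ M` and `b ∈ N` is `μ a b`. The map `ε : P → M` is the conditional expectation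
`ϱ⋆` with respect to `ϱ` if `⟨ω, ε x⟩ = ⟨ω ⊗ ϱ, x⟩` for every normal state `ω` of `M`, that is,
`ω ∘ ε` is the normal product state `ω ⊗ ϱ` on `P`. -/
def IsNoiseExpectation (M : VonNeumannAlgebra K) (A : VonNeumannAlgebra H)
    (ϱ : A.toStarSubalgebra →ₗ[ℂ] ℂ) (N : VonNeumannAlgebra H) (P : VonNeumannAlgebra L)
    (μ : (K →L[ℂ] K) → (H →L[ℂ] H) → (L →L[ℂ] L))
    (ε : P.toStarSubalgebra →ₗ[ℂ] M.toStarSubalgebra) : Prop :=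
  ∀ ω : M.toStarSubalgebra →ₗ[ℂ] ℂ, IsNormalState M ω →
    IsNormalState P (ω ∘ₗ ε) ∧
    ∀ (a : M.toStarSubalgebra) (b : A.toStarSubalgebra), (b : H →L[ℂ] H) ∈ N →
      ∀ x : P.toStarSubalgebra, (x : L →L[ℂ] L) = μ a b → ω (ε x) = ω a * ϱ b

end Normal

/-! ### Events and transfer measures -/

section Measures

variable {Ω H K : Type*} [NormedAddCommGroup H] [InnerProductSpace ℂ H] [CompleteSpace H]
  [NormedAddCommGroup K] [InnerProductSpace ℂ K] [CompleteSpace K]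

/-- A `σ`-homomorphism from the measurable sets to orthoprojectors (a spectral measure). -/
structure IsSpectralMeasure [MeasurableSpace Ω] (E : Set Ω → H →L[ℂ] H) : Prop where
  proj : ∀ Δ, MeasurableSet Δ → IsStarProjection (E Δ)
  univ : E Set.univ = 1
  inter : ∀ Δ Δ', MeasurableSet Δ → MeasurableSet Δ' → E (Δ ∩ Δ') = E Δ * E Δ'
  iUnion : ∀ Δ : ℕ → Set Ω, (∀ n, MeasurableSet (Δ n)) → Pairwise (Function.onFun Disjoint Δ) →
    ∀ ξ : H, HasSum (fun n => E (Δ n) ξ) (E (⋃ n, Δ n) ξ)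

/-- A transfer measure on `𝔄` with values in the maps from `M` to `N`: its values are normal
completely positive maps, it is weakly countably additive, and it is normalized. -/
structure IsTransferMeasure (𝔄 : MeasurableSpace Ω) (M : VonNeumannAlgebra H)
    (N : VonNeumannAlgebra K)
    (T : Set Ω → (M.toStarSubalgebra →ₗ[ℂ] N.toStarSubalgebra)) : Prop where
  normal : ∀ Δ, MeasurableSet[𝔄] Δ → IsNormalMap M N (T Δ)
  completelyPositive : ∀ Δ, MeasurableSet[𝔄] Δ → IsCompletelyPositive M N (T Δ)
  iUnion : ∀ φ : N.toStarSubalgebra →ₗ[ℂ] ℂ, IsNormalFunctional N φ → ∀ x : M.toStarSubalgebra,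
    ∀ Δ : ℕ → Set Ω, (∀ n, MeasurableSet[𝔄] (Δ n)) → Pairwise (Function.onFun Disjoint Δ) →
      HasSum (fun n => φ (T (Δ n) x)) (φ (T (⋃ n, Δ n) x))
  univ : T Set.univ 1 = 1

end Measures

/-! ### Dynamical quantum stochastic objects under observation -/

/-- A dynamical quantum open object with observable trajectories in `Ω`, on the Hilbert space `H`.
A measurable set of trajectories over a time segment is identified with the cylinder set in `Ω`
above it; thus the product of two such sets over adjacent segments is the intersection of the
cylinders. -/
structure QSObject (H Ω : Type*) [NormedAddCommGroup H] [InnerProductSpace ℂ H] [CompleteSpace H]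
    [MeasurableSpace Ω] (h : ℝ≥0 → Type*) [∀ t, NormedAddCommGroup (h t)]
    [∀ t, InnerProductSpace ℂ (h t)] [∀ t, CompleteSpace (h t)] where
  /-- `ℬ`, all quantum properties -/
  total : VonNeumannAlgebra H
  /-- `ℬ_{t]}`, the past up to `t` -/
  past : ℝ≥0 → VonNeumannAlgebra H
  /-- `ℬ_{[t}`, the present and future of `t` -/
  presentFuture : ℝ≥0 → VonNeumannAlgebra H
  /-- `𝒜_t`, the future noise -/
  noise : ℝ≥0 → VonNeumannAlgebra H
  past_mono : Monotone past
  past_le : ∀ t, past t ≤ total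
  presentFuture_anti : Antitone presentFuture
  presentFuture_le : ∀ t, presentFuture t ≤ total
  noise_anti : Antitone noise
  noise_le : ∀ t, noise t ≤ presentFuture t
  past_commute_noise : ∀ t, past t ≤ (noise t).commutant
  /-- `ℬ_{s]} ⊗̄ 𝒜_s^t ∼ ℬ_{t]}`, where `𝒜_s^t = 𝒜_s ∩ ℬ_{t]}` -/
  product : ∀ s t, s < t → IsWStarProduct (past s) (vnInf (noise s) (past t)) (past t)
  /-- `𝔄_{t]}`, the histories up to `t` -/
  history : ℝ≥0 → MeasurableSpace Ω
  /-- `𝔄_t`, the events after `t` -/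
  future : ℝ≥0 → MeasurableSpace Ω
  history_mono : Monotone history
  history_le : ∀ t, history t ≤ ‹MeasurableSpace Ω›
  future_anti : Antitone future
  future_le : ∀ t, future t ≤ ‹MeasurableSpace Ω›
  /-- the representation `E` of the events by orthoprojectors -/
  event : Set Ω → H →L[ℂ] H
  event_spectral : IsSpectralMeasure event
  event_mem_past : ∀ t Δ, MeasurableSet[history t] Δ → event Δ ∈ past t
  event_mem_presentFuture : ∀ t Δ, MeasurableSet[future t] Δ → event Δ ∈ presentFuture t
  /-- causality: past events are compatible with the present and future -/
  causal : ∀ t Δ, MeasurableSet[history t] Δ → event Δ ∈ (presentFuture t).commutant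
  /-- `𝔟_t ⊆ ℬ_{t]} ∩ ℬ_{[t}`, the boundary algebra -/
  boundary : ℝ≥0 → VonNeumannAlgebra H
  boundary_le_past : ∀ t, boundary t ≤ past t
  boundary_le_presentFuture : ∀ t, boundary t ≤ presentFuture t
  /-- `𝔟(t)`, the algebra of the object at time `t`, represented by `π_t` as `𝔟_t` -/
  object : ∀ t, VonNeumannAlgebra (h t)
  /-- `π_t`, with inverse `π^t` -/
  rep : ∀ t, (object t).toStarSubalgebra ≃⋆ₐ[ℂ] (boundary t).toStarSubalgebra
  rep_normal : ∀ t, IsWStarIso (object t) (boundary t) (rep t)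
  /-- the object is dynamical: `ℳ_s^t ∨ 𝔟_t ⊆ 𝔟_s ∨ 𝒜_s^t`, where `ℳ_s^t = ℳ_s ∩ ℳ_{t]}` for the
  algebras `ℳ_s`, `ℳ_{t]}` generated by the future events and by the histories -/
  dynamical : ∀ s t, s < t →
    vnJoin (vnInf (vnGenerated {e | ∃ Δ, MeasurableSet[future s] Δ ∧ e = event Δ})
        (vnGenerated {e | ∃ Δ, MeasurableSet[history t] Δ ∧ e = event Δ})) (boundary t) ≤
      vnJoin (boundary s) (vnInf (noise s) (past t))

namespace QSObject

variable {H Ω : Type*} [NormedAddCommGroup H] [InnerProductSpace ℂ H] [CompleteSpace H]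
  [MeasurableSpace Ω] {h : ℝ≥0 → Type*} [∀ t, NormedAddCommGroup (h t)]
  [∀ t, InnerProductSpace ℂ (h t)] [∀ t, CompleteSpace (h t)] (S : QSObject H Ω h)

/-- `𝒜_s^t = 𝒜_s ∩ ℬ_{t]}` -/
noncomputable def noiseSeg (s t : ℝ≥0) : VonNeumannAlgebra H := vnInf (S.noise s) (S.past t)

/-- `𝔄_s^t = 𝔄_s ∩ 𝔄_{t]}`, the events in the time segment from `s` to `t` -/
abbrev eventSeg (s t : ℝ≥0) : MeasurableSpace Ω := S.future s ⊓ S.history t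

/-- `𝔟(s) ⊗̄ 𝒜_s^t` -/
noncomputable def objectNoise (s t : ℝ≥0) : VonNeumannAlgebra (HilbertTensor (h s) H) :=
  vnTensor (S.object s) (S.noiseSeg s t)

/-- `p` is the extension of `π_s` to `𝔟(s) ⊗̄ 𝒜_s^t`: a W*-isomorphism onto `𝔟_s ∨ 𝒜_s^t` with
`p (q ⊗ a) = π_s(q) a`. -/
def IsExtendedRep (s t : ℝ≥0)
    (p : (S.objectNoise s t).toStarSubalgebra ≃⋆ₐ[ℂ]
      (vnJoin (S.boundary s) (S.noiseSeg s t)).toStarSubalgebra) : Prop :=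
  IsWStarIso (S.objectNoise s t) (vnJoin (S.boundary s) (S.noiseSeg s t)) p ∧
  ∀ (q : (S.object s).toStarSubalgebra), ∀ a ∈ S.noiseSeg s t,
    ∀ x : (S.objectNoise s t).toStarSubalgebra,
      (x : HilbertTensor (h s) H →L[ℂ] HilbertTensor (h s) H) = tensorOp (q : h s →L[ℂ] h s) a →
        (p x : H →L[ℂ] H) = (S.rep s q : H →L[ℂ] H) * a

/-- `Υ` is the transitional measure from `s` to `t`: `Υ(Δ, q) = E^s(Δ) γ(q)` for `Δ ∈ 𝔄_s^t` and
`q ∈ 𝔟(t)`, where `E^s(Δ) = π^s(E(Δ))` and the Heisenberg flow is `γ = π^s ∘ π_t`, with `π^s` the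
inverse of the extended `π_s`. -/
def IsTransitionalMeasure (s t : ℝ≥0)
    (Υ : Set Ω → ((S.object t).toStarSubalgebra →ₗ[ℂ] (S.objectNoise s t).toStarSubalgebra)) :
    Prop :=
  ∃ p, S.IsExtendedRep s t p ∧
    ∃ (Es : Set Ω → (S.objectNoise s t).toStarSubalgebra)
      (γ : (S.object t).toStarSubalgebra →⋆ₐ[ℂ] (S.objectNoise s t).toStarSubalgebra),
      (∀ Δ, MeasurableSet[S.eventSeg s t] Δ → (p (Es Δ) : H →L[ℂ] H) = S.event Δ) ∧
      (∀ q, (p (γ q) : H →L[ℂ] H) = S.rep t q) ∧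
      ∀ Δ, MeasurableSet[S.eventSeg s t] Δ → ∀ q, Υ Δ q = Es Δ * γ q

/-- `ϖ` is a product state `ϖ_{t]} ⊗ ϱ_t` for every `t`: `⟨ϖ, b a⟩ = ⟨ϖ, b⟩ ⟨ϱ_t, a⟩` for
`b ∈ ℬ_{t]}` and `a ∈ 𝒜_t^u`. -/
def IsProductState (ϖ : S.total.toStarSubalgebra →ₗ[ℂ] ℂ)
    (ϱ : ∀ t, (S.noise t).toStarSubalgebra →ₗ[ℂ] ℂ) : Prop :=
  ∀ t u, t < u → ∀ (b a : S.total.toStarSubalgebra) (a' : (S.noise t).toStarSubalgebra),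
    (b : H →L[ℂ] H) ∈ S.past t → (a : H →L[ℂ] H) = a' → (a : H →L[ℂ] H) ∈ S.past u →
      ϖ (b * a) = ϖ b * ϱ t a'

/-- The Markov property in the state `ϖ`: for `s < t` there is a conditional expectation of
`ℬ_{t]}` onto the past `ℬ_{s]}` that preserves `ϖ` and maps the algebra `𝔟_s ∨ 𝒜_s^t` of the
present and future into the present algebra `𝔟_s`. -/
def IsMarkovian (ϖ : S.total.toStarSubalgebra →ₗ[ℂ] ℂ) : Prop :=
  ∀ s t, s < t → ∃ ε : (S.past t).toStarSubalgebra →ₗ[ℂ] (S.past s).toStarSubalgebra,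
    IsCondExpectation (S.past t) (S.past s) ε ∧
    (∀ (x : (S.past t).toStarSubalgebra) (y z : S.total.toStarSubalgebra),
      (y : H →L[ℂ] H) = x → (z : H →L[ℂ] H) = ε x → ϖ z = ϖ y) ∧
    ∀ x : (S.past t).toStarSubalgebra,
      (x : H →L[ℂ] H) ∈ vnJoin (S.boundary s) (S.noiseSeg s t) → (ε x : H →L[ℂ] H) ∈ S.boundary s

end QSObject

/-! The map `ϱ_s⋆` is the slice map `a ⊗ b ↦ ϱ_s(b) a`. A positive normal functional is a vector
functional `b ↦ ⟨ζ, b ζ⟩` of the countable amplification, so the slice is the compression of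
amplified operators by `k ↦ (k ⊗ ζₙ)ₙ`. Normality, complete positivity and the module property are
visible in this form, which is then transported along the W*-product (`exists_noiseExpectation`).
Uniqueness, and every later identity between normal maps, needs checking only on products `a b`,
because normal functionals are determined there (`IsNormalFunctional.eq_of_forall_tensorElem`,
`IsWStarProduct.normal_ext`).

The transitional measures need `π_s` extended to `𝔟(s) ⊗̄ 𝒜_s^t`: the isomorphism `π_s` has to be
tensored with the identity, and the W*-product of the past and the noise has to be restricted to the
boundary algebra. Both are instances of `exists_wStarIso`: representations `σ`, `τ` of one
`*`-algebra that dominate each other generate isomorphic von Neumann algebras. Domination of a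
vector `u` means `‖τ(a) u‖ ≤ C ‖σ(a) ζ‖` with `ζ` in the amplified space. It gives intertwiners `X`
from the amplification of `σ` to `τ`; since every `X* Y` commutes with the amplification of the
double commutant of `σ`, the rule `X ζ ↦ X (x ζ)` carries an operator `x` over to the space of `τ`.
Dominated vectors form a closed subspace, so elementary tensors suffice.

The dynamics rests on three facts about the expectations `ε` of one past onto an earlier one. The
product formula for `ϖ`, with the past factor equal to one, makes the noise states multiplicative
over adjacent segments (`noise_mul`), and this yields the tower property `ε_s^t ε_t^u = ε_s^u`
(`condExpectation_comp`). The same formula shows that `ε` preserves `ϖ`. Finally `π_s` intertwines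
the slice on `𝔟(s) ⊗̄ 𝒜_s^t` with `ε` (`rep_objectExpectation`), so that `π_s(T_s^t(Δ, q)) = ε(E(Δ)
π_t(q))`.

Chapman–Kolmogorov then follows: in `ε_s^u(E(Δ) E(Δ') π_u(q))` insert the tower property, pull
`E(Δ)` out of `ε_t^u` by the module property, and use that `π_s` is injective. Complete positivity
of `T` comes from causality, by which `E(Δ)` commutes with `𝔟_t`, and weak additivity from the
countable additivity of a spectral measure in normal functionals
(`IsSpectralMeasure.hasSum_inner_amp`). -/

/-! ### Countable amplification -/

/-- The Hilbert space of square-summable sequences in `K`. -/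
abbrev Ell2 (K : Type*) [NormedAddCommGroup K] : Type _ := lp (fun _ : ℕ => K) 2

section Amplification

variable {K L : Type*} [NormedAddCommGroup K] [NormedAddCommGroup L]

theorem memℓp_two_iff {f : ℕ → K} : Memℓp f 2 ↔ Summable fun n => ‖f n‖ ^ 2 := by
  rw [memℓp_gen_iff (by norm_num)]
  norm_num

theorem Ell2.hasSum_norm_sq (ζ : Ell2 K) : HasSum (fun n => ‖ζ n‖ ^ 2) (‖ζ‖ ^ 2) := by
  simpa using lp.hasSum_norm (p := 2) (by norm_num) ζ

theorem Ell2.summable_norm_sq (ζ : Ell2 K) : Summable fun n => ‖ζ n‖ ^ 2 :=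
  ζ.hasSum_norm_sq.summable

theorem Ell2.norm_le_of_hasSum {ζ : Ell2 K} {g : ℕ → ℝ} {C : ℝ} (hC : 0 ≤ C)
    (hg : HasSum g (C ^ 2)) (h : ∀ n, ‖ζ n‖ ^ 2 ≤ g n) : ‖ζ‖ ≤ C :=
  abs_le_of_sq_le_sq' (hasSum_le h ζ.hasSum_norm_sq hg) hC |>.2

variable [InnerProductSpace ℂ K] [InnerProductSpace ℂ L]

/-- The coordinatewise action of an operator on square-summable sequences. -/
noncomputable def ampMap (a : K →L[ℂ] L) : Ell2 K →L[ℂ] Ell2 L :=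
  LinearMap.mkContinuous
    { toFun := fun ζ => ⟨fun n => a (ζ n), memℓp_two_iff.2 <| by
        refine Summable.of_nonneg_of_le (fun n => by positivity) (fun n => ?_)
          (ζ.summable_norm_sq.mul_left (‖a‖ ^ 2))
        rw [← mul_pow]
        gcongr
        exact a.le_opNorm _⟩
      map_add' := fun ζ η => by ext n; exact map_add a _ _
      map_smul' := fun c ζ => by ext n; exact map_smul a _ _ } ‖a‖ fun ζ => by
    refine Ell2.norm_le_of_hasSum (by positivity)
      (by rw [mul_pow]; exact ζ.hasSum_norm_sq.mul_left (‖a‖ ^ 2)) fun n => ?_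
    rw [← mul_pow]
    gcongr
    exact a.le_opNorm _

@[simp]
theorem ampMap_apply (a : K →L[ℂ] L) (ζ : Ell2 K) (n : ℕ) : ampMap a ζ n = a (ζ n) := rfl

/-- Square-summable double sequences as sequences. -/
noncomputable def flat (z : Ell2 (Ell2 K)) : Ell2 K :=
  ⟨fun k => z k.unpair.1 k.unpair.2, memℓp_two_iff.2 <| by
    have : Summable fun p : ℕ × ℕ => ‖z p.1 p.2‖ ^ 2 := by
      refine (summable_prod_of_nonneg fun _ => by positivity).2
        ⟨fun n => (z n).summable_norm_sq, ?_⟩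
      simp_rw [fun n => (z n).hasSum_norm_sq.tsum_eq]
      exact z.summable_norm_sq
    exact (Nat.pairEquiv.symm.summable_iff (f := fun p : ℕ × ℕ => ‖z p.1 p.2‖ ^ 2)).2 this⟩

theorem inner_flat (z w : Ell2 (Ell2 K)) : inner ℂ (flat z) (flat w) = inner ℂ z w := by
  have h := (lp.hasSum_inner (𝕜 := ℂ) (flat z) (flat w))
  have h1 : HasSum (fun p : ℕ × ℕ => inner ℂ (z p.1 p.2) (w p.1 p.2))
      (inner ℂ (flat z) (flat w)) :=
    (Nat.pairEquiv.symm.hasSum_iff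
      (f := fun p : ℕ × ℕ => inner ℂ (z p.1 p.2) (w p.1 p.2))).1 h
  exact (h1.prod_fiberwise fun n => lp.hasSum_inner (z n) (w n)).unique (lp.hasSum_inner z w)

theorem norm_flat (z : Ell2 (Ell2 K)) : ‖flat z‖ = ‖z‖ := by
  rw [@norm_eq_sqrt_re_inner ℂ, @norm_eq_sqrt_re_inner ℂ, inner_flat]

/-- The sequence with the single entry `k` at `n`. -/
noncomputable abbrev Ell2.single (n : ℕ) : K →L[ℂ] Ell2 K :=
  lp.singleContinuousLinearMap ℂ (fun _ : ℕ => K) 2 n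

theorem ampMap_single (a : K →L[ℂ] L) (n : ℕ) (k : K) :
    ampMap a (Ell2.single n k) = Ell2.single n (a k) := by
  ext m
  rcases eq_or_ne m n with rfl | h
  · simp
  · simp [h]

/-- A sequence with square-summable norms of its terms. -/
def Ell2.mk (f : ℕ → K) (hf : Summable fun n => ‖f n‖ ^ 2) : Ell2 K := ⟨f, memℓp_two_iff.2 hf⟩

variable [CompleteSpace K]

variable (K) in
/-- The countable amplification of operators. -/
noncomputable def amp : (K →L[ℂ] K) →⋆ₐ[ℂ] (Ell2 K →L[ℂ] Ell2 K) where
  toFun := ampMap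
  map_one' := by ext; rfl
  map_mul' _ _ := by ext; rfl
  map_zero' := by ext; rfl
  map_add' _ _ := by ext; rfl
  commutes' _ := by ext; rfl
  map_star' a := by
    rw [ContinuousLinearMap.star_eq_adjoint, ContinuousLinearMap.star_eq_adjoint,
      ContinuousLinearMap.eq_adjoint_iff]
    intro ζ η
    refine (lp.hasSum_inner (𝕜 := ℂ) _ _).unique ?_
    convert lp.hasSum_inner (𝕜 := ℂ) ζ (ampMap a η) using 2 with n
    simp [ContinuousLinearMap.adjoint_inner_left]

@[simp]
theorem amp_apply (a : K →L[ℂ] K) (ζ : Ell2 K) (n : ℕ) : amp K a ζ n = a (ζ n) := rfl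

theorem amp_flat (a : K →L[ℂ] K) (z : Ell2 (Ell2 K)) :
    amp K a (flat z) = flat (amp (Ell2 K) (amp K a) z) := rfl

theorem amp_single (a : K →L[ℂ] K) (n : ℕ) (k : K) :
    amp K a (Ell2.single n k) = Ell2.single n (a k) := ampMap_single a n k

/-- An operator that commutes with the amplification of `S` commutes with the amplification of the
double commutant of `S`. -/
theorem commute_amp_of_mem_bicommutant {S : Set (K →L[ℂ] K)} {c : Ell2 K →L[ℂ] Ell2 K}
    (hc : ∀ a ∈ S, Commute c (amp K a)) {x : K →L[ℂ] K}
    (hx : x ∈ Set.centralizer (Set.centralizer S)) : Commute c (amp K x) := by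
  -- The matrix entries of `c` commute with `S`, hence with its double commutant; `c` is recovered
  -- from its columns.
  have key (i j : ℕ) : (lp.evalCLM ℂ (fun _ : ℕ => K) 2 i ∘L c ∘L Ell2.single j) * x =
      x * (lp.evalCLM ℂ (fun _ : ℕ => K) 2 i ∘L c ∘L Ell2.single j) := by
    refine hx _ fun a ha => ?_
    ext k
    have h := congrArg (fun T : Ell2 K →L[ℂ] Ell2 K => T (Ell2.single j k) i) (hc a ha).eq
    change (c (amp K a (Ell2.single j k))) i = a (c (Ell2.single j k) i) at h
    rw [amp_single] at h
    exact h.symm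
  refine lp.ext_continuousLinearMap (by norm_num) fun j => ?_
  ext k i
  have h := congrArg (fun T : K →L[ℂ] K => T k) (key i j)
  change c (Ell2.single j (x k)) i = x (c (Ell2.single j k) i) at h
  change c (amp K x (Ell2.single j k)) i = x (c (Ell2.single j k) i)
  rw [amp_single, h]

end Amplification

/-! ### Intertwiners and domination of vectors -/

section StarRep

variable {A K L : Type*} [Ring A] [StarRing A] [Algebra ℂ A]
  [NormedAddCommGroup K] [InnerProductSpace ℂ K] [CompleteSpace K]
  [NormedAddCommGroup L] [InnerProductSpace ℂ L] [CompleteSpace L]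

theorem inner_star_apply (a : K →L[ℂ] K) (x y : K) :
    inner ℂ ((star a) x) y = inner ℂ x (a y) := by
  rw [ContinuousLinearMap.star_eq_adjoint, ContinuousLinearMap.adjoint_inner_left]

theorem inner_apply_star (a : K →L[ℂ] K) (x y : K) :
    inner ℂ x ((star a) y) = inner ℂ (a x) y := by
  rw [ContinuousLinearMap.star_eq_adjoint, ContinuousLinearMap.adjoint_inner_right]

theorem inner_map_star_mul (σ : A →⋆ₐ[ℂ] (K →L[ℂ] K)) (a b : A) (x y : K) :
    inner ℂ x (σ (star a * b) y) = inner ℂ (σ a x) (σ b y) := by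
  rw [map_mul, map_star, mul_apply_eq_comp, inner_apply_star]

/-- Invariance under `σ (star a)` makes the orthogonal complement invariant too, so `σ a` respects
the decomposition. -/
theorem starProjection_commute_of_invariant (σ : A →⋆ₐ[ℂ] (K →L[ℂ] K)) (U : Submodule ℂ K)
    [U.HasOrthogonalProjection] (hU : ∀ a, ∀ v ∈ U, σ a v ∈ U) (a : A) :
    Commute U.starProjection (σ a) := by
  ext v
  refine Submodule.eq_starProjection_of_mem_of_inner_eq_zero (hU a _ (U.starProjection_apply_mem v))
    fun w hw => ?_
  change inner ℂ (σ a v - σ a (U.starProjection v)) w = 0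
  rw [← map_sub, ← inner_apply_star, ← map_star]
  exact Submodule.starProjection_inner_eq_zero _ _ (hU _ _ hw)

/-- The closed cyclic subspace generated by a vector. -/
noncomputable def cyclicSubspace (σ : A →⋆ₐ[ℂ] (K →L[ℂ] K)) (ζ : K) : Submodule ℂ K :=
  (LinearMap.range ((LinearMap.applyₗ ζ).comp
    ((ContinuousLinearMap.coeLM ℂ).comp σ.toAlgHom.toLinearMap) : A →ₗ[ℂ] K)).topologicalClosure

theorem map_mem_cyclicSubspace (σ : A →⋆ₐ[ℂ] (K →L[ℂ] K)) (ζ : K) (a : A) :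
    σ a ζ ∈ cyclicSubspace σ ζ :=
  Submodule.le_topologicalClosure _ ⟨a, rfl⟩

theorem cyclicSubspace_induction (σ : A →⋆ₐ[ℂ] (K →L[ℂ] K)) (ζ : K) {p : K → Prop}
    (hp : IsClosed {v | p v}) (h : ∀ a, p (σ a ζ)) : ∀ v ∈ cyclicSubspace σ ζ, p v := by
  intro v hv
  refine closure_minimal ?_ hp hv
  rintro _ ⟨a, rfl⟩
  exact h a

theorem isClosed_cyclicSubspace (σ : A →⋆ₐ[ℂ] (K →L[ℂ] K)) (ζ : K) :
    IsClosed (cyclicSubspace σ ζ : Set K) :=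
  Submodule.isClosed_topologicalClosure _

instance (σ : A →⋆ₐ[ℂ] (K →L[ℂ] K)) (ζ : K) : CompleteSpace (cyclicSubspace σ ζ) :=
  (isClosed_cyclicSubspace σ ζ).completeSpace_coe

theorem cyclicSubspace_invariant (σ : A →⋆ₐ[ℂ] (K →L[ℂ] K)) (ζ : K) (a : A) :
    ∀ v ∈ cyclicSubspace σ ζ, σ a v ∈ cyclicSubspace σ ζ := by
  refine cyclicSubspace_induction σ ζ
    ((isClosed_cyclicSubspace σ ζ).preimage (σ a).continuous) fun b => ?_
  rw [← mul_apply_eq_comp, ← map_mul]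
  exact map_mem_cyclicSubspace σ ζ _

/-- If `‖τ(a) u‖ ≤ C ‖σ(a) ζ‖` for all `a`, then `u` is the image of `ζ` under an intertwiner. -/
theorem exists_intertwiner (σ : A →⋆ₐ[ℂ] (K →L[ℂ] K)) (τ : A →⋆ₐ[ℂ] (L →L[ℂ] L)) {ζ : K} {u : L}
    {C : ℝ} (hC : 0 ≤ C) (h : ∀ a, ‖τ a u‖ ≤ C * ‖σ a ζ‖) :
    ∃ X : K →L[ℂ] L, X ζ = u ∧ (∀ a v, X (σ a v) = τ a (X v)) ∧ ‖X‖ ≤ C := by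
  let e : A →ₗ[ℂ] cyclicSubspace σ ζ :=
    { toFun := fun a => ⟨σ a ζ, map_mem_cyclicSubspace σ ζ a⟩
      map_add' := fun a b => by ext; simp
      map_smul' := fun c a => by ext; simp }
  let f : A →ₗ[ℂ] L :=
    { toFun := fun a => τ a u
      map_add' := fun a b => by simp
      map_smul' := fun c a => by simp }
  have hd : DenseRange e := by
    rintro ⟨v, hv⟩
    rw [closure_subtype]
    refine cyclicSubspace_induction σ ζ isClosed_closure (fun a => subset_closure ?_) v hv
    exact ⟨_, ⟨a, rfl⟩, rfl⟩
  -- `σ(a) ζ ↦ τ(a) u` is well defined and bounded by the hypothesis; it is extended to the cyclic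
  -- subspace by continuity and by zero to the complement.
  let P := (cyclicSubspace σ ζ).orthogonalProjectionOnto
  let X := f.extendOfNorm e ∘L P
  have hX (a : A) : X (σ a ζ) = τ a u := by
    have : P (σ a ζ) = e a :=
      (cyclicSubspace σ ζ).orthogonalProjectionOnto_mem_subspace_eq_self (e a)
    change f.extendOfNorm e (P (σ a ζ)) = _
    rw [this, LinearMap.extendOfNorm_eq hd ⟨C, h⟩]
    rfl
  have hXP (v : K) : X ((cyclicSubspace σ ζ).starProjection v) = X v := by
    change f.extendOfNorm e (P (P v : K)) = _
    rw [(cyclicSubspace σ ζ).orthogonalProjectionOnto_mem_subspace_eq_self (P v)]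
    rfl
  refine ⟨X, by simpa using hX 1, fun a v => ?_, ?_⟩
  · have h1 : (cyclicSubspace σ ζ).starProjection (σ a v) =
        σ a ((cyclicSubspace σ ζ).starProjection v) :=
      congrArg (fun T : K →L[ℂ] K => T v)
        (starProjection_commute_of_invariant σ _ (cyclicSubspace_invariant σ ζ) a).eq
    rw [← hXP (σ a v), h1, ← hXP v]
    refine cyclicSubspace_induction σ ζ (p := fun w => X (σ a w) = τ a (X w))
      (isClosed_eq (by fun_prop) (by fun_prop)) (fun b => ?_) _
      ((cyclicSubspace σ ζ).starProjection_apply_mem v)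
    rw [hX, ← mul_apply_eq_comp, ← map_mul, hX, map_mul, mul_apply_eq_comp]
  · refine X.opNorm_le_bound hC fun v => ?_
    refine (LinearMap.norm_extendOfNorm_apply_le hd C h (P v)).trans ?_
    gcongr
    exact (cyclicSubspace σ ζ).norm_orthogonalProjectionOnto_apply_le v

/-- A positive operator that commutes with a representation has a square root that does. -/
theorem exists_sqrt_commute (σ : A →⋆ₐ[ℂ] (K →L[ℂ] K)) {T : K →L[ℂ] K} (hT : 0 ≤ T)
    (hc : ∀ a, Commute T (σ a)) :
    ∃ R : K →L[ℂ] K, star R * R = T ∧ ∀ a, Commute R (σ a) := by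
  refine ⟨CFC.sqrt T, ?_, fun a => ?_⟩
  · rw [(CFC.sqrt_nonneg T).isSelfAdjoint.star_eq, CFC.sqrt_mul_sqrt_self T hT]
  · rw [CFC.sqrt_eq_cfc]
    exact (hc a).cfc_nnreal _

theorem norm_eq_of_star_mul_self_eq {M : Type*} [NormedAddCommGroup M] [InnerProductSpace ℂ M]
    [CompleteSpace M] {R : K →L[ℂ] K} {X : K →L[ℂ] M} (h : star R * R = X.adjoint ∘L X) (v : K) :
    ‖R v‖ = ‖X v‖ := by
  have : inner ℂ (R v) (R v) = inner ℂ (X v) (X v) := by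
    rw [← inner_apply_star, ← mul_apply_eq_comp, h, ContinuousLinearMap.comp_apply,
      ContinuousLinearMap.adjoint_inner_right]
  rw [@norm_eq_sqrt_re_inner ℂ, @norm_eq_sqrt_re_inner ℂ, this]

/-- Both representations preserve the star, so `X*` intertwines in the opposite direction. -/
theorem commute_adjoint_comp_of_intertwiner (σ : A →⋆ₐ[ℂ] (K →L[ℂ] K)) (τ : A →⋆ₐ[ℂ] (L →L[ℂ] L))
    {X Y : K →L[ℂ] L} (hX : ∀ a v, X (σ a v) = τ a (X v)) (hY : ∀ a v, Y (σ a v) = τ a (Y v))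
    (a : A) : Commute (X.adjoint ∘L Y) (σ a) := by
  ext v
  refine ext_inner_left ℂ fun w => ?_
  change inner ℂ w (X.adjoint (Y (σ a v))) = inner ℂ w (σ a (X.adjoint (Y v)))
  rw [ContinuousLinearMap.adjoint_inner_right, hY, ← inner_star_apply, ← inner_star_apply,
    ContinuousLinearMap.adjoint_inner_right, ← map_star, ← map_star, hX]

/-- If `‖τ(a) u‖ ≤ C ‖σ(a) ζ‖` for all `a`, then `τ` in the vector `u` is equivalent to `σ` in
some other vector. -/
theorem exists_contractive_intertwiner (σ : A →⋆ₐ[ℂ] (K →L[ℂ] K)) (τ : A →⋆ₐ[ℂ] (L →L[ℂ] L))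
    {ζ : K} {u : L} {C : ℝ} (hC : 0 ≤ C) (h : ∀ a, ‖τ a u‖ ≤ C * ‖σ a ζ‖) :
    ∃ (X : K →L[ℂ] L) (ζ' : K), X ζ' = u ∧ (∀ a v, X (σ a v) = τ a (X v)) ∧ ‖X‖ ≤ 1 ∧
      ∀ a, ‖σ a ζ'‖ = ‖τ a u‖ := by
  obtain ⟨X, hXu, hX, -⟩ := exists_intertwiner σ τ hC h
  -- This is the polar decomposition: with `R = (X* X)^(1/2)`, the vector `R ζ` has the same norms
  -- under `σ` as `u` has under `τ`, so the new intertwiner is a contraction.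
  obtain ⟨R, hR, hRc⟩ := exists_sqrt_commute σ
    ((ContinuousLinearMap.nonneg_iff_isPositive _).2 (X.isPositive_adjoint_comp_self))
    (commute_adjoint_comp_of_intertwiner σ τ hX hX)
  have key (a : A) : ‖σ a (R ζ)‖ = ‖τ a u‖ := by
    have : σ a (R ζ) = R (σ a ζ) :=
      congrArg (fun T : K →L[ℂ] K => T ζ) (hRc a).eq.symm
    rw [this, norm_eq_of_star_mul_self_eq hR, hX, hXu]
  obtain ⟨Y, hYu, hY, hY1⟩ := exists_intertwiner σ τ (ζ := R ζ) (u := u) zero_le_one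
    fun a => by rw [key, one_mul]
  exact ⟨Y, R ζ, hYu, hY, hY1, key⟩

/-- A positive functional of the form `⟨ξ, σ(a) η⟩` has the form `⟨ζ, σ(a) ζ⟩`. -/
theorem exists_vector_of_nonneg (σ : A →⋆ₐ[ℂ] (K →L[ℂ] K)) {ξ η : K}
    (h : ∀ a, 0 ≤ (inner ℂ ξ (σ (star a * a) η)).re)
    (hr : ∀ a, inner ℂ ξ (σ (star a) η) = star (inner ℂ ξ (σ a η))) :
    ∃ ζ : K, ∀ a, inner ℂ ξ (σ a η) = inner ℂ ζ (σ a ζ) := by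
  -- Polarization writes the hermitian functional as a difference of vector functionals at `p` and
  -- `m`. Positivity says that `m` is dominated by `p`, so `m = X p` with a contraction `X`
  -- commuting with `σ`, and `(1 - X* X)^(1/2) p` is the vector sought.
  set p : K := (2⁻¹ : ℂ) • (ξ + η) with hp
  set m : K := (2⁻¹ : ℂ) • (ξ - η) with hm
  have key (a : A) : inner ℂ ξ (σ a η) = inner ℂ p (σ a p) - inner ℂ m (σ a m) := by
    have h2 : inner ℂ η (σ a ξ) = inner ℂ ξ (σ a η) := by
      rw [← star_star (inner ℂ ξ (σ a η)), ← hr, map_star, inner_apply_star]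
      exact (inner_conj_symm _ _).symm
    simp only [hp, hm, map_smul, map_add, map_sub, inner_smul_left, inner_smul_right,
      inner_add_left, inner_add_right, inner_sub_left, inner_sub_right, h2]
    simp only [map_inv₀, map_ofNat]
    ring
  have hle (a : A) : ‖σ a m‖ ≤ 1 * ‖σ a p‖ := by
    have h1 := h a
    rw [key, inner_map_star_mul, inner_map_star_mul, Complex.sub_re] at h1
    have e1 := @inner_self_eq_norm_sq ℂ _ _ _ _ (σ a p)
    have e2 := @inner_self_eq_norm_sq ℂ _ _ _ _ (σ a m)
    simp only [RCLike.re_eq_complex_re] at e1 e2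
    rw [e1, e2] at h1
    rw [one_mul]
    exact abs_le_of_sq_le_sq' (by linarith) (norm_nonneg _) |>.2
  obtain ⟨X, hXm, hX, hX1⟩ := exists_intertwiner σ σ zero_le_one hle
  have hpos : 0 ≤ 1 - X.adjoint ∘L X := by
    rw [ContinuousLinearMap.nonneg_iff_isPositive]
    refine ⟨?_, fun v => ?_⟩
    · exact (IsSelfAdjoint.sub (.one _) X.isPositive_adjoint_comp_self.isSelfAdjoint).isSymmetric
    · rw [ContinuousLinearMap.reApplyInnerSelf_apply]
      change 0 ≤ RCLike.re (inner ℂ (v - X.adjoint (X v)) v)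
      rw [inner_sub_left, ContinuousLinearMap.adjoint_inner_left, map_sub, inner_self_eq_norm_sq,
        inner_self_eq_norm_sq, sub_nonneg]
      gcongr
      simpa using X.le_of_opNorm_le hX1 v
  obtain ⟨R, hR, hRc⟩ := exists_sqrt_commute σ hpos fun a =>
    (Commute.one_left _).sub_left (commute_adjoint_comp_of_intertwiner σ σ hX hX a)
  refine ⟨R p, fun a => ?_⟩
  have : σ a (R p) = R (σ a p) := congrArg (fun T : K →L[ℂ] K => T p) (hRc a).eq.symm
  rw [key, this, ← inner_apply_star, ← mul_apply_eq_comp, hR]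
  change _ = inner ℂ p (σ a p - X.adjoint (X (σ a p)))
  rw [inner_sub_right, ContinuousLinearMap.adjoint_inner_right, hX, hXm]

/-- A normal functional vanishing on a `*`-algebra vanishes on its double commutant. -/
theorem inner_amp_eq_zero_of_mem_bicommutant (σ : A →⋆ₐ[ℂ] (K →L[ℂ] K)) {ξ η : Ell2 K}
    (h : ∀ a, inner ℂ ξ (amp K (σ a) η) = 0) {x : K →L[ℂ] K}
    (hx : x ∈ Set.centralizer (Set.centralizer (Set.range σ))) :
    inner ℂ ξ (amp K x η) = 0 := by
  let σ' : A →⋆ₐ[ℂ] (Ell2 K →L[ℂ] Ell2 K) := (amp K).comp σ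
  -- The projection onto `U` commutes with the amplified algebra, hence with the amplified `x`; so
  -- `x η` stays in `U`, to which `ξ` is orthogonal.
  let U := cyclicSubspace σ' η
  have hc : Commute U.starProjection (amp K x) := by
    refine commute_amp_of_mem_bicommutant ?_ hx
    rintro _ ⟨a, rfl⟩
    exact starProjection_commute_of_invariant σ' U (cyclicSubspace_invariant σ' η) a
  have hη : η ∈ U := by simpa using map_mem_cyclicSubspace σ' η 1
  have h1 : amp K x η ∈ U := by
    have : amp K x (U.starProjection η) = U.starProjection (amp K x η) :=
      congrArg (fun T : Ell2 K →L[ℂ] Ell2 K => T η) hc.eq.symm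
    rw [U.starProjection_eq_self_iff.2 hη] at this
    rw [this]
    exact U.starProjection_apply_mem _
  exact cyclicSubspace_induction σ' η (p := fun v => inner ℂ ξ v = 0)
    (isClosed_eq (by fun_prop) (by fun_prop)) h _ h1

end StarRep

/-! ### Normal functionals through the amplification -/

section NormalFunctional

variable {H K L : Type*} [NormedAddCommGroup H] [InnerProductSpace ℂ H] [CompleteSpace H]
  [NormedAddCommGroup K] [InnerProductSpace ℂ K] [CompleteSpace K]
  [NormedAddCommGroup L] [InnerProductSpace ℂ L] [CompleteSpace L]

/-- Normality becomes a statement about one matrix coefficient of the amplification, so ultraweak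
arguments turn into arguments with vectors. -/
theorem isNormalFunctional_iff {M : VonNeumannAlgebra H} {φ : M.toStarSubalgebra →ₗ[ℂ] ℂ} :
    IsNormalFunctional M φ ↔
      ∃ ξ η : Ell2 H, ∀ x : M.toStarSubalgebra, φ x = inner ℂ ξ (amp H (x : H →L[ℂ] H) η) := by
  constructor
  · rintro ⟨ξ, η, hξ, hη, h⟩
    exact ⟨Ell2.mk ξ hξ, Ell2.mk η hη, fun x => (h x).unique (lp.hasSum_inner (𝕜 := ℂ) _ _)⟩
  · rintro ⟨ξ, η, h⟩
    refine ⟨ξ, η, ξ.summable_norm_sq, η.summable_norm_sq, fun x => ?_⟩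
    rw [h x]
    exact lp.hasSum_inner (𝕜 := ℂ) _ _

/-- An amplification of the amplification is again a countable amplification, by a pairing of `ℕ ×
ℕ` with `ℕ`. -/
theorem isNormalFunctional_of_hasSum {M : VonNeumannAlgebra H} {φ : M.toStarSubalgebra →ₗ[ℂ] ℂ}
    (z w : Ell2 (Ell2 H))
    (h : ∀ x : M.toStarSubalgebra, HasSum (fun n => inner ℂ (z n) (amp H (x : H →L[ℂ] H) (w n)))
      (φ x)) : IsNormalFunctional M φ := by
  refine isNormalFunctional_iff.2 ⟨flat z, flat w, fun x => ?_⟩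
  rw [amp_flat, inner_flat]
  exact (h x).unique (lp.hasSum_inner (𝕜 := ℂ) _ _)

/-- The functional `x ↦ ⟨ξ, x η⟩`. -/
noncomputable def vectorFunctional (M : VonNeumannAlgebra H) (ξ η : H) :
    M.toStarSubalgebra →ₗ[ℂ] ℂ where
  toFun x := inner ℂ ξ ((x : H →L[ℂ] H) η)
  map_add' x y := by simp
  map_smul' c x := by simp

@[simp]
theorem vectorFunctional_apply (M : VonNeumannAlgebra H) (ξ η : H) (x : M.toStarSubalgebra) :
    vectorFunctional M ξ η x = inner ℂ ξ ((x : H →L[ℂ] H) η) := rfl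

theorem isNormalFunctional_vectorFunctional (M : VonNeumannAlgebra H) (ξ η : H) :
    IsNormalFunctional M (vectorFunctional M ξ η) := by
  refine isNormalFunctional_iff.2 ⟨Ell2.single 0 ξ, Ell2.single 0 η, fun x => ?_⟩
  rw [amp_single]
  simp only [lp.singleContinuousLinearMap_apply, lp.inner_single_left]
  simp

variable {M : VonNeumannAlgebra H} {φ ψ : M.toStarSubalgebra →ₗ[ℂ] ℂ}

theorem IsNormalFunctional.add (hφ : IsNormalFunctional M φ) (hψ : IsNormalFunctional M ψ) :
    IsNormalFunctional M (φ + ψ) := by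
  obtain ⟨ξ, η, h⟩ := isNormalFunctional_iff.1 hφ
  obtain ⟨ξ', η', h'⟩ := isNormalFunctional_iff.1 hψ
  -- The two pairs of vectors sit in orthogonal slots, so no cross terms arise.
  refine isNormalFunctional_iff.2 ⟨flat (Ell2.single 0 ξ + Ell2.single 1 ξ'),
    flat (Ell2.single 0 η + Ell2.single 1 η'), fun x => ?_⟩
  rw [amp_flat, inner_flat, map_add, amp_single, amp_single, LinearMap.add_apply, h, h']
  simp only [inner_add_left, lp.singleContinuousLinearMap_apply, lp.inner_single_left]
  simp

theorem IsNormalFunctional.smul (hφ : IsNormalFunctional M φ) (c : ℂ) :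
    IsNormalFunctional M (c • φ) := by
  obtain ⟨ξ, η, h⟩ := isNormalFunctional_iff.1 hφ
  refine isNormalFunctional_iff.2 ⟨ξ, c • η, fun x => ?_⟩
  rw [map_smul, inner_smul_right, LinearMap.smul_apply, h, smul_eq_mul]

theorem IsNormalFunctional.sub (hφ : IsNormalFunctional M φ) (hψ : IsNormalFunctional M ψ) :
    IsNormalFunctional M (φ - ψ) := by
  have := hφ.add (hψ.smul (-1))
  rwa [neg_one_smul, ← sub_eq_add_neg] at this

/-- Multiplying the argument by fixed elements keeps a functional normal. -/
theorem IsNormalFunctional.mul_mul (hφ : IsNormalFunctional M φ) (a b : M.toStarSubalgebra) :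
    IsNormalFunctional M (φ ∘ₗ LinearMap.mulLeftRight ℂ (a, b)) := by
  obtain ⟨ξ, η, h⟩ := isNormalFunctional_iff.1 hφ
  refine isNormalFunctional_iff.2 ⟨amp H (star (a : H →L[ℂ] H)) ξ, amp H b η, fun x => ?_⟩
  rw [LinearMap.comp_apply, LinearMap.mulLeftRight_apply, h, map_star, inner_star_apply]
  simp [mul_assoc]

/-- Normal functionals restrict to normal functionals. -/
theorem IsNormalFunctional.restrict (hφ : IsNormalFunctional M φ) {N : VonNeumannAlgebra H}
    (f : N.toStarSubalgebra →ₗ[ℂ] M.toStarSubalgebra)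
    (hf : ∀ x, (f x : H →L[ℂ] H) = x) : IsNormalFunctional N (φ ∘ₗ f) := by
  obtain ⟨ξ, η, h⟩ := isNormalFunctional_iff.1 hφ
  exact isNormalFunctional_iff.2 ⟨ξ, η, fun x => by rw [LinearMap.comp_apply, h, hf]⟩

variable {A : Type*} [Ring A] [StarRing A] [Algebra ℂ A]

/-- Normal functionals are determined by their values on a generating `*`-algebra. -/
theorem IsNormalFunctional.eq_of_forall_range (hφ : IsNormalFunctional M φ)
    (hψ : IsNormalFunctional M ψ) (σ : A →⋆ₐ[ℂ] (H →L[ℂ] H))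
    (hσ : (M : Set (H →L[ℂ] H)) ⊆ Set.centralizer (Set.centralizer (Set.range σ)))
    (hM : ∀ a, σ a ∈ M) (h : ∀ a, φ ⟨σ a, hM a⟩ = ψ ⟨σ a, hM a⟩) : φ = ψ := by
  obtain ⟨ξ, η, h'⟩ := isNormalFunctional_iff.1 (hφ.sub hψ)
  refine sub_eq_zero.1 (LinearMap.ext fun x => ?_)
  rw [h']
  refine inner_amp_eq_zero_of_mem_bicommutant σ (fun a => ?_) (hσ x.2)
  rw [← h' ⟨σ a, hM a⟩, LinearMap.sub_apply, h, sub_self]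

theorem vectorFunctional_ext {x y : M.toStarSubalgebra}
    (h : ∀ ξ η, vectorFunctional M ξ η x = vectorFunctional M ξ η y) : x = y :=
  Subtype.ext <| ContinuousLinearMap.ext fun η => ext_inner_left ℂ fun ξ => h ξ η

end NormalFunctional

/-! ### Domination of representations and W*-isomorphisms -/

section Domination

variable {A K L : Type*} [Ring A] [StarRing A] [Algebra ℂ A]
  [NormedAddCommGroup K] [InnerProductSpace ℂ K] [CompleteSpace K]
  [NormedAddCommGroup L] [InnerProductSpace ℂ L] [CompleteSpace L]

/-- The representation `τ` in the vector `u` is dominated by the amplification of `σ` in some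
vector. -/
def Dominated (σ : A →⋆ₐ[ℂ] (K →L[ℂ] K)) (τ : A →⋆ₐ[ℂ] (L →L[ℂ] L)) (u : L) : Prop :=
  ∃ (ζ : Ell2 K) (C : ℝ), 0 ≤ C ∧ ∀ a, ‖τ a u‖ ≤ C * ‖amp K (σ a) ζ‖

/-- `X` intertwines the amplification of `σ` with `τ`. -/
def Intertwines (σ : A →⋆ₐ[ℂ] (K →L[ℂ] K)) (τ : A →⋆ₐ[ℂ] (L →L[ℂ] L)) (X : Ell2 K →L[ℂ] L) : Prop :=
  ∀ a v, X (amp K (σ a) v) = τ a (X v)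

variable {σ : A →⋆ₐ[ℂ] (K →L[ℂ] K)} {τ : A →⋆ₐ[ℂ] (L →L[ℂ] L)}

/-- The last clause at `a = 1` gives `‖ζ‖ = ‖u‖`. This keeps the transferred operators bounded and
the chosen sequences square-summable. -/
theorem Dominated.exists_intertwiner {u : L} (hu : Dominated σ τ u) :
    ∃ (X : Ell2 K →L[ℂ] L) (ζ : Ell2 K), X ζ = u ∧ Intertwines σ τ X ∧ ‖X‖ ≤ 1 ∧
      ∀ a, ‖amp K (σ a) ζ‖ = ‖τ a u‖ := by
  obtain ⟨ζ, C, hC, h⟩ := hu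
  exact exists_contractive_intertwiner ((amp K).comp σ) τ hC h

theorem norm_amp_le_norm_amp_flat (x : K →L[ℂ] K) (z : Ell2 (Ell2 K)) (n : ℕ) :
    ‖amp K x (z n)‖ ≤ ‖amp K x (flat z)‖ := by
  rw [amp_flat, norm_flat]
  exact lp.norm_apply_le_norm (by norm_num) (amp (Ell2 K) (amp K x) z) n

theorem Dominated.add {u v : L} (hu : Dominated σ τ u) (hv : Dominated σ τ v) :
    Dominated σ τ (u + v) := by
  obtain ⟨ζ, C, hC, h⟩ := hu
  obtain ⟨η, D, hD, h'⟩ := hv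
  let z : Ell2 (Ell2 K) := Ell2.single 0 ζ + Ell2.single 1 η
  have h0 : z 0 = ζ := by simp [z]
  have h1 : z 1 = η := by simp [z]
  refine ⟨flat z, C + D, by positivity, fun a => ?_⟩
  rw [map_add, add_mul]
  refine (norm_add_le _ _).trans (add_le_add ((h a).trans ?_) ((h' a).trans ?_))
  · gcongr
    simpa only [h0] using norm_amp_le_norm_amp_flat (σ a) z 0
  · gcongr
    simpa only [h1] using norm_amp_le_norm_amp_flat (σ a) z 1

theorem Dominated.smul {u : L} (hu : Dominated σ τ u) (c : ℂ) : Dominated σ τ (c • u) := by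
  obtain ⟨ζ, C, hC, h⟩ := hu
  refine ⟨ζ, ‖c‖ * C, by positivity, fun a => ?_⟩
  rw [map_smul, norm_smul, mul_assoc]
  gcongr
  exact h a

/-- The dominated vectors. -/
def dominatedSubmodule (σ : A →⋆ₐ[ℂ] (K →L[ℂ] K)) (τ : A →⋆ₐ[ℂ] (L →L[ℂ] L)) : Submodule ℂ L where
  carrier := {u | Dominated σ τ u}
  add_mem' := Dominated.add
  zero_mem' := ⟨0, 0, le_rfl, fun a => by simp⟩
  smul_mem' c _ hu := hu.smul c

/-- A limit of dominated vectors is a rapidly convergent series of dominated vectors `vₙ`. Their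
dominating vectors, rescaled, fit into a single square-summable family that dominates the sum. -/
theorem isClosed_dominatedSubmodule : IsClosed (dominatedSubmodule σ τ : Set L) := by
  refine isClosed_of_closure_subset fun u hu => ?_
  obtain ⟨v, hv, hmem, -, hlt⟩ := controlled_sum_of_mem_closure
    (s := (dominatedSubmodule σ τ).toAddSubgroup) hu (b := fun n => (1 / 4 : ℝ) ^ n)
    fun n => by positivity
  choose X ζ hX _ _ hζ using fun n => Dominated.exists_intertwiner (hmem n)
  have hnorm (n : ℕ) : ‖ζ n‖ = ‖v n‖ := by simpa using hζ n 1
  -- The weight `2 ^ n` still leaves norms at most `2⁻ⁿ` against `‖vₙ‖ < 4⁻ⁿ`, and it gains the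
  -- factor `2⁻ⁿ` that makes the bounds below summable, with sum at most 2. The zeroth term is not
  -- controlled, hence the index shift.
  let z : Ell2 (Ell2 K) := Ell2.mk (fun n => ((2 : ℂ) ^ n) • ζ n) <| by
    refine (summable_nat_add_iff 1).1 ?_
    refine Summable.of_nonneg_of_le (fun n => by positivity) (fun n => ?_)
      ((summable_nat_add_iff 1).2 (summable_geometric_of_lt_one (r := (1 / 4 : ℝ)) (by norm_num)
        (by norm_num)))
    have h1 : ‖((2 : ℂ) ^ (n + 1)) • ζ (n + 1)‖ ≤ (1 / 2) ^ (n + 1) := by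
      rw [norm_smul, hnorm, norm_pow, Complex.norm_ofNat]
      calc (2 : ℝ) ^ (n + 1) * ‖v (n + 1)‖ ≤ 2 ^ (n + 1) * (1 / 4) ^ (n + 1) := by
            gcongr
            exact (hlt _ n.succ_pos).le
        _ = (1 / 2) ^ (n + 1) := by rw [← mul_pow]; norm_num
    calc ‖((2 : ℂ) ^ (n + 1)) • ζ (n + 1)‖ ^ 2 ≤ ((1 / 2) ^ (n + 1)) ^ 2 := by gcongr
      _ = (1 / 4) ^ (n + 1) := by rw [← pow_mul, mul_comm, pow_mul]; norm_num
  refine ⟨flat z, 2, by norm_num, fun a => ?_⟩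
  have hle (n : ℕ) : ‖τ a (v n)‖ ≤ (1 / 2) ^ n * ‖amp K (σ a) (flat z)‖ := by
    have h1 := norm_amp_le_norm_amp_flat (σ a) z n
    have h2 : z n = ((2 : ℂ) ^ n) • ζ n := rfl
    rw [h2, map_smul, norm_smul, hζ, norm_pow, Complex.norm_ofNat] at h1
    calc ‖τ a (v n)‖ = (1 / 2) ^ n * (2 ^ n * ‖τ a (v n)‖) := by
          rw [← mul_assoc, ← mul_pow]; norm_num
      _ ≤ _ := by gcongr
  refine le_of_tendsto ((τ a).continuous.norm.continuousAt.tendsto.comp hv)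
    (Filter.Eventually.of_forall fun n => ?_)
  simp only [Function.comp_apply, map_sum]
  refine (norm_sum_le _ _).trans ((Finset.sum_le_sum fun i _ => hle i).trans ?_)
  rw [← Finset.sum_mul]
  gcongr
  exact sum_geometric_two_le _

theorem dominated_of_dense {s : Set L} (hs : Dense (Submodule.span ℂ s : Set L))
    (h : ∀ u ∈ s, Dominated σ τ u) (u : L) : Dominated σ τ u := by
  have h1 : Submodule.span ℂ s ≤ dominatedSubmodule σ τ := Submodule.span_le.2 h
  exact closure_minimal h1 isClosed_dominatedSubmodule (hs u)

theorem Intertwines.adjoint_comp_commute {X Y : Ell2 K →L[ℂ] L} (hX : Intertwines σ τ X)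
    (hY : Intertwines σ τ Y) {x : K →L[ℂ] K}
    (hx : x ∈ Set.centralizer (Set.centralizer (Set.range σ))) (v : Ell2 K) :
    X.adjoint (Y (amp K x v)) = amp K x (X.adjoint (Y v)) := by
  have : Commute (X.adjoint ∘L Y) (amp K x) := by
    refine commute_amp_of_mem_bicommutant ?_ hx
    rintro _ ⟨a, rfl⟩
    exact commute_adjoint_comp_of_intertwiner ((amp K).comp σ) τ hX hY a
  exact congrArg (fun T : Ell2 K →L[ℂ] Ell2 K => T v) this.eq

/-- Since `Xᵢ* Xⱼ` commutes with the amplified `x`, the operator moves outside the sum in `⟨Xᵢ x ζᵢ,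
∑ Xⱼ x ζⱼ⟩` and meets `∑ Xⱼ ζⱼ = 0`. This is the well-definedness behind the transfer of operators.
-/
theorem sum_intertwiner_eq_zero {ι : Type*} [Fintype ι] {X : ι → Ell2 K →L[ℂ] L}
    (hX : ∀ i, Intertwines σ τ (X i)) {ζ : ι → Ell2 K} (h : ∑ i, X i (ζ i) = 0) {x : K →L[ℂ] K}
    (hx : x ∈ Set.centralizer (Set.centralizer (Set.range σ))) :
    ∑ i, X i (amp K x (ζ i)) = 0 := by
  rw [← inner_self_eq_zero (𝕜 := ℂ), sum_inner]
  refine Finset.sum_eq_zero fun i _ => ?_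
  rw [← ContinuousLinearMap.adjoint_inner_right, map_sum,
    Finset.sum_congr rfl fun j _ => (hX i).adjoint_comp_commute (hX j) hx (ζ j),
    ← map_sum, ← map_sum, h]
  simp

/-- An operator in the double commutant of `σ` has a counterpart for a dominated `τ`. -/
theorem exists_transfer (h : ∀ u, Dominated σ τ u) {x : K →L[ℂ] K}
    (hx : x ∈ Set.centralizer (Set.centralizer (Set.range σ))) :
    ∃ y : L →L[ℂ] L, ∀ X : Ell2 K →L[ℂ] L, Intertwines σ τ X → ∀ ζ, y (X ζ) = X (amp K x ζ) := by
  choose X ζ hXu hX hX1 hζ using fun u => (h u).exists_intertwiner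
  -- The value does not depend on how a vector is written as the image of an intertwiner; linearity
  -- below uses the same cancellation.
  have wd (Y : Ell2 K →L[ℂ] L) (hY : Intertwines σ τ Y) (η : Ell2 K) :
      X (Y η) (amp K x (ζ (Y η))) = Y (amp K x η) := by
    have := sum_intertwiner_eq_zero (σ := σ) (τ := τ) (X := ![X (Y η), Y]) (ζ := ![ζ (Y η), -η])
      (by simp [Fin.forall_fin_two, hX, hY]) (by simp [hXu]) hx
    simpa [← sub_eq_add_neg, sub_eq_zero] using this
  refine ⟨LinearMap.mkContinuous
    { toFun := fun u => X u (amp K x (ζ u))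
      map_add' := fun u v => ?_
      map_smul' := fun c u => ?_ } ‖amp K x‖ fun u => ?_, fun Y hY η => wd Y hY η⟩
  · have := sum_intertwiner_eq_zero (σ := σ) (τ := τ) (X := ![X (u + v), X u, X v])
      (ζ := ![ζ (u + v), -ζ u, -ζ v])
      (by simp [Fin.forall_fin_succ, hX]) (by simp [hXu, Fin.sum_univ_three]) hx
    simp only [Fin.sum_univ_three, Matrix.cons_val_zero, Matrix.cons_val_one, Matrix.cons_val,
      map_neg] at this
    rw [← sub_eq_zero, ← this]
    abel
  · have := wd (X u) (hX u) (c • ζ u)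
    simpa [hXu] using this
  · change ‖X u (amp K x (ζ u))‖ ≤ _
    have h1 : ‖ζ u‖ = ‖u‖ := by simpa using hζ u 1
    rw [← h1]
    exact ((X u).le_of_opNorm_le (hX1 u) _).trans (by rw [one_mul]; exact (amp K x).le_opNorm _)

/-- A representation dominated by `σ` extends to a normal homomorphism on the von Neumann algebra
generated by `σ`. -/
theorem exists_normal_extension (h : ∀ u, Dominated σ τ u) (M : VonNeumannAlgebra K)
    (N : VonNeumannAlgebra L)
    (hM : (M : Set (K →L[ℂ] K)) ⊆ Set.centralizer (Set.centralizer (Set.range σ)))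
    (hN : ∀ a, τ a ∈ N) :
    ∃ Φ : M.toStarSubalgebra →⋆ₐ[ℂ] N.toStarSubalgebra,
      IsNormalMap M N Φ.toAlgHom.toLinearMap ∧
      ∀ a (ha : σ a ∈ M), (Φ ⟨σ a, ha⟩ : L →L[ℂ] L) = τ a := by
  choose y hy using fun x : M.toStarSubalgebra => exists_transfer h (hM x.2)
  choose X ζ hXu hX hX1 hζ using fun u => (h u).exists_intertwiner
  have hyu (x : M.toStarSubalgebra) (u : L) : y x u = X u (amp K x (ζ u)) := by
    conv_lhs => rw [← hXu u]
    exact hy x (X u) (hX u) (ζ u)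
  have hyN (x : M.toStarSubalgebra) : y x ∈ N := by
    rw [← SetLike.mem_coe, ← N.centralizer_centralizer]
    intro c hc
    ext u
    -- For `c` in the commutant of `N`, `c X` is again an intertwiner, so independence of the
    -- intertwiner says that `y x` commutes with `c`.
    have hcX : Intertwines σ τ (c ∘L X u) := fun a v => by
      have h1 := congrArg (fun T : L →L[ℂ] L => T (X u v)) (hc (τ a) (hN a))
      change c (X u _) = τ a (c (X u v))
      rw [hX u a v]
      exact h1.symm
    have h2 := hy x _ hcX (ζ u)
    change y x (c (X u (ζ u))) = c (X u (amp K x (ζ u))) at h2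
    change c (y x u) = y x (c u)
    rw [hyu x u, ← h2, hXu]
  let Φ : M.toStarSubalgebra →⋆ₐ[ℂ] N.toStarSubalgebra :=
    { toFun := fun x => ⟨y x, hyN x⟩
      map_one' := by
        ext u
        simp [hyu, hXu]
      map_mul' := fun a b => by
        ext u
        change y (a * b) u = y a (y b u)
        rw [hyu b u, hy a (X u) (hX u), hyu (a * b) u]
        simp
      map_zero' := by
        ext u
        simp [hyu]
      map_add' := fun a b => by
        ext u
        change y (a + b) u = y a u + y b u
        simp [hyu]
      commutes' := fun c => by
        ext u
        change y _ u = c • u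
        rw [hyu]
        have : amp K ((algebraMap ℂ M.toStarSubalgebra c : M.toStarSubalgebra) : K →L[ℂ] K) (ζ u) =
          c • ζ u := by ext n; rfl
        rw [this, map_smul, hXu]
      map_star' := fun a => by
        ext u
        refine ext_inner_left ℂ fun v => ?_
        change inner ℂ v (y (star a) u) = inner ℂ v ((star (y a)) u)
        rw [inner_apply_star, hyu, hyu a v]
        conv_lhs => rw [← hXu v]
        conv_rhs => rw [← hXu u]
        rw [← ContinuousLinearMap.adjoint_inner_right,
          ← ContinuousLinearMap.adjoint_inner_right (X v) _ (X u (ζ u)),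
          (hX v).adjoint_comp_commute (hX u) (hM (star a).2)]
        change inner ℂ _ (amp K (star (a : K →L[ℂ] K)) _) = _
        rw [map_star, inner_apply_star] }
  refine ⟨Φ, fun φ hφ => ?_, fun a ha => ?_⟩
  · obtain ⟨ξ, η, hξη⟩ := isNormalFunctional_iff.1 hφ
    have hn (u : L) : ‖ζ u‖ = ‖u‖ := by simpa using hζ u 1
    -- The terms are `⟨ξₙ, X x ζ⟩ = ⟨X* ξₙ, x ζ⟩` with `X` and `ζ` chosen for `ηₙ`. Square
    -- summability uses `‖X‖ ≤ 1` and `‖ζ‖ = ‖ηₙ‖`.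
    let z : Ell2 (Ell2 K) := Ell2.mk (fun n => (X (η n)).adjoint (X (ξ n) (ζ (ξ n)))) <| by
      refine Summable.of_nonneg_of_le (fun n => by positivity) (fun n => ?_) ξ.summable_norm_sq
      gcongr
      rw [hXu]
      refine ((X (η n)).adjoint.le_of_opNorm_le (c := 1) ?_ _).trans_eq (one_mul _)
      rw [LinearIsometryEquiv.norm_map]
      exact hX1 _
    let w : Ell2 (Ell2 K) := Ell2.mk (fun n => ζ (η n)) <| by
      simp_rw [hn]
      exact η.summable_norm_sq
    refine isNormalFunctional_of_hasSum z w fun x => ?_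
    change HasSum _ (φ (Φ x))
    rw [hξη]
    refine (funext fun n => ?_ : (fun n => inner ℂ (z n) (amp K (x : K →L[ℂ] K) (w n))) =
      fun n => inner ℂ (ξ n) (amp L (Φ x : L →L[ℂ] L) η n)) ▸ lp.hasSum_inner (𝕜 := ℂ) ξ _
    change inner ℂ ((X (η n)).adjoint (X (ξ n) (ζ (ξ n)))) (amp K (x : K →L[ℂ] K) (ζ (η n))) =
      inner ℂ (ξ n) (y x (η n))
    rw [ContinuousLinearMap.adjoint_inner_left, hXu, hyu]
  · ext u
    change y ⟨σ a, ha⟩ u = τ a u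
    rw [hyu, hX u, hXu]

/-- Representations that dominate each other generate isomorphic von Neumann algebras. -/
theorem exists_wStarIso (h : ∀ u, Dominated σ τ u) (h' : ∀ u, Dominated τ σ u)
    (M : VonNeumannAlgebra K) (N : VonNeumannAlgebra L)
    (hM : (M : Set (K →L[ℂ] K)) = Set.centralizer (Set.centralizer (Set.range σ)))
    (hN : (N : Set (L →L[ℂ] L)) = Set.centralizer (Set.centralizer (Set.range τ))) :
    ∃ Θ : M.toStarSubalgebra ≃⋆ₐ[ℂ] N.toStarSubalgebra, IsWStarIso M N Θ ∧
      ∀ a (ha : σ a ∈ M), (Θ ⟨σ a, ha⟩ : L →L[ℂ] L) = τ a := by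
  have hσ (a : A) : σ a ∈ M := by
    rw [← SetLike.mem_coe, hM]
    exact Set.subset_centralizer_centralizer ⟨a, rfl⟩
  have hτ (a : A) : τ a ∈ N := by
    rw [← SetLike.mem_coe, hN]
    exact Set.subset_centralizer_centralizer ⟨a, rfl⟩
  obtain ⟨Φ, hΦ, hΦσ⟩ := exists_normal_extension h M N hM.subset hτ
  obtain ⟨Ψ, hΨ, hΨτ⟩ := exists_normal_extension h' N M hN.subset hσ
  -- Both sides are normal and agree on the generating `*`-algebra.
  have e1 : (Φ.comp Ψ) = StarAlgHom.id ℂ _ := by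
    ext1 x
    refine vectorFunctional_ext fun ξ η => ?_
    have hn := isNormalFunctional_vectorFunctional N ξ η
    refine LinearMap.congr_fun ((hΨ _ (hΦ _ hn)).eq_of_forall_range hn τ hN.subset hτ fun a => ?_) x
    have h1 : Ψ ⟨τ a, hτ a⟩ = ⟨σ a, hσ a⟩ := Subtype.ext (hΨτ a _)
    have h2 : Φ ⟨σ a, hσ a⟩ = ⟨τ a, hτ a⟩ := Subtype.ext (hΦσ a _)
    change vectorFunctional N ξ η (Φ (Ψ ⟨τ a, hτ a⟩)) = _
    rw [h1, h2]
  have e2 : (Ψ.comp Φ) = StarAlgHom.id ℂ _ := by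
    ext1 x
    refine vectorFunctional_ext fun ξ η => ?_
    have hn := isNormalFunctional_vectorFunctional M ξ η
    refine LinearMap.congr_fun ((hΦ _ (hΨ _ hn)).eq_of_forall_range hn σ hM.subset hσ fun a => ?_) x
    have h1 : Ψ ⟨τ a, hτ a⟩ = ⟨σ a, hσ a⟩ := Subtype.ext (hΨτ a _)
    have h2 : Φ ⟨σ a, hσ a⟩ = ⟨τ a, hτ a⟩ := Subtype.ext (hΦσ a _)
    change vectorFunctional M ξ η (Ψ (Φ ⟨σ a, hσ a⟩)) = _
    rw [h2, h1]
  refine ⟨StarAlgEquiv.ofStarAlgHom Φ Ψ e2 e1, ⟨fun φ hφ => ⟨_, hΦ φ hφ, fun x => rfl⟩,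
    fun ψ hψ => ⟨_, hΨ ψ hψ, fun y => rfl⟩⟩, hΦσ⟩

end Domination

/-! ### Positive normal functionals -/

section PositiveNormal

variable {H K L : Type*} [NormedAddCommGroup H] [InnerProductSpace ℂ H] [CompleteSpace H]
  [NormedAddCommGroup K] [InnerProductSpace ℂ K] [CompleteSpace K]
  [NormedAddCommGroup L] [InnerProductSpace ℂ L] [CompleteSpace L]

open scoped ComplexOrder in
theorem inner_self_complex_nonneg {V : Type*} [NormedAddCommGroup V] [InnerProductSpace ℂ V]
    (v : V) : 0 ≤ inner ℂ v v :=
  Complex.nonneg_iff.2 ⟨inner_self_nonneg (𝕜 := ℂ), (inner_self_im (𝕜 := ℂ) v).symm⟩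

open scoped ComplexOrder in
-- The values at `x`, `1`, `1 + x` and `1 + i x` are real; expanding the last two compares the
-- imaginary and the real parts.
theorem map_star_of_nonneg {A : Type*} [Ring A] [StarRing A] [Algebra ℂ A] [StarModule ℂ A]
    {φ : A →ₗ[ℂ] ℂ} (h : ∀ x, 0 ≤ φ (star x * x)) (x : A) : φ (star x) = star (φ x) := by
  have h0 := (Complex.nonneg_iff.1 (h x)).2
  have h1 := (Complex.nonneg_iff.1 (h 1)).2
  have h2 := (Complex.nonneg_iff.1 (h (1 + x))).2
  have h3 := (Complex.nonneg_iff.1 (h (1 + Complex.I • x))).2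
  simp only [star_add, star_one, star_smul, mul_add, add_mul, one_mul, mul_one, map_add,
    smul_mul_assoc, mul_smul_comm, map_smul, smul_eq_mul, Complex.add_im, Complex.mul_im,
    Complex.I_re, Complex.I_im, RCLike.star_def, Complex.conj_I, Complex.neg_re, Complex.neg_im,
    Complex.mul_re] at h0 h1 h2 h3
  apply Complex.ext
  · simp only [RCLike.star_def, Complex.conj_re]
    linarith
  · simp only [RCLike.star_def, Complex.conj_im]
    linarith

open scoped ComplexOrder in
-- Positivity makes the functional hermitian, so the two vectors in its normal form can be replaced
-- by one.
theorem IsNormalFunctional.exists_vector {M : VonNeumannAlgebra H}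
    {φ : M.toStarSubalgebra →ₗ[ℂ] ℂ} (hφ : IsNormalFunctional M φ)
    (hpos : ∀ x, 0 ≤ φ (star x * x)) :
    ∃ ζ : Ell2 H, ∀ x : M.toStarSubalgebra, φ x = inner ℂ ζ (amp H (x : H →L[ℂ] H) ζ) := by
  obtain ⟨ξ, η, h⟩ := isNormalFunctional_iff.1 hφ
  obtain ⟨ζ, hζ⟩ := exists_vector_of_nonneg ((amp H).comp M.toStarSubalgebra.subtype)
    (ξ := ξ) (η := η) (fun a => (h _ ▸ (Complex.nonneg_iff.1 (hpos a)).1 :)) fun a => by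
      have := map_star_of_nonneg hpos a
      rwa [h, h] at this
  exact ⟨ζ, fun x => (h x).trans (hζ x)⟩

open scoped ComplexOrder in
/-- A normal homomorphism is dominated by the amplified identity representation. -/
theorem IsNormalMap.exists_vector {M : VonNeumannAlgebra H} {N : VonNeumannAlgebra K}
    {π : M.toStarSubalgebra →⋆ₐ[ℂ] N.toStarSubalgebra}
    (hπ : IsNormalMap M N π.toAlgHom.toLinearMap) (u : K) :
    ∃ ζ : Ell2 H, ∀ x : M.toStarSubalgebra,
      inner ℂ u ((π x : K →L[ℂ] K) u) = inner ℂ ζ (amp H (x : H →L[ℂ] H) ζ) := by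
  refine (hπ _ (isNormalFunctional_vectorFunctional N u u)).exists_vector fun x => ?_
  change 0 ≤ inner ℂ u ((π (star x * x) : K →L[ℂ] K) u)
  rw [map_mul, map_star]
  change 0 ≤ inner ℂ u ((star (π x : K →L[ℂ] K)) ((π x : K →L[ℂ] K) u))
  rw [inner_apply_star]
  exact inner_self_complex_nonneg _

/-- Equality of vector functionals gives domination. -/
theorem dominated_of_inner_eq {A : Type*} [Ring A] [StarRing A] [Algebra ℂ A]
    {σ : A →⋆ₐ[ℂ] (K →L[ℂ] K)} {τ : A →⋆ₐ[ℂ] (L →L[ℂ] L)} {u : L} {ζ : Ell2 K}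
    (h : ∀ a, inner ℂ u (τ a u) = inner ℂ ζ (amp K (σ a) ζ)) : Dominated σ τ u := by
  refine ⟨ζ, 1, zero_le_one, fun a => ?_⟩
  have h1 := h (star a * a)
  rw [inner_map_star_mul] at h1
  have h2 := inner_map_star_mul ((amp K).comp σ) a a ζ ζ
  change inner ℂ ζ (amp K (σ (star a * a)) ζ) = inner ℂ (amp K (σ a) ζ) (amp K (σ a) ζ) at h2
  rw [one_mul, @norm_eq_sqrt_re_inner ℂ, h1, h2, ← @norm_eq_sqrt_re_inner ℂ]

end PositiveNormal

/-! ### Operators on Hilbert space tensor products -/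

section TensorOperators

variable {K H F : Type*} [NormedAddCommGroup K] [InnerProductSpace ℂ K]
  [NormedAddCommGroup H] [InnerProductSpace ℂ H]
  [NormedAddCommGroup F] [InnerProductSpace ℂ F]

/-- The elementary tensor `k ⊗ l`, as a continuous linear function of `k`. -/
noncomputable def tensorVec (l : H) : K →L[ℂ] HilbertTensor K H :=
  LinearMap.mkContinuous
    { toFun := fun k => ((k ⊗ₜ[ℂ] l : K ⊗[ℂ] H) : HilbertTensor K H)
      map_add' := fun k k' => by rw [TensorProduct.add_tmul, UniformSpace.Completion.coe_add]
      map_smul' := fun c k => by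
        rw [← TensorProduct.smul_tmul', UniformSpace.Completion.coe_smul, RingHom.id_apply] } ‖l‖
    fun k => by
      change ‖((k ⊗ₜ[ℂ] l : K ⊗[ℂ] H) : HilbertTensor K H)‖ ≤ _
      rw [UniformSpace.Completion.norm_coe, TensorProduct.norm_tmul, mul_comm]

theorem tensorVec_apply (l : H) (k : K) :
    tensorVec l k = ((k ⊗ₜ[ℂ] l : K ⊗[ℂ] H) : HilbertTensor K H) := rfl

theorem norm_tensorVec (l : H) (k : K) : ‖(tensorVec l k : HilbertTensor K H)‖ = ‖k‖ * ‖l‖ := by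
  rw [tensorVec_apply, UniformSpace.Completion.norm_coe, TensorProduct.norm_tmul]

theorem inner_tensorVec (l l' : H) (k k' : K) :
    inner ℂ (tensorVec l k : HilbertTensor K H) (tensorVec l' k') =
      inner ℂ k k' * inner ℂ l l' := by
  rw [tensorVec_apply, tensorVec_apply, UniformSpace.Completion.inner_coe,
    TensorProduct.inner_tmul]

theorem dense_span_tensorVec :
    Dense (Submodule.span ℂ {u : HilbertTensor K H | ∃ k l, u = tensorVec l k} :
      Set (HilbertTensor K H)) := by
  refine UniformSpace.Completion.denseRange_coe.mono ?_
  rintro _ ⟨x, rfl⟩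
  induction x using TensorProduct.induction_on with
  | zero =>
    rw [UniformSpace.Completion.coe_zero]
    exact zero_mem _
  | tmul k l => exact Submodule.subset_span ⟨k, l, rfl⟩
  | add x y hx hy =>
    rw [UniformSpace.Completion.coe_add]
    exact add_mem hx hy

theorem tensor_ext {f g : HilbertTensor K H →L[ℂ] F}
    (h : ∀ k l, f (tensorVec l k) = g (tensorVec l k)) : f = g := by
  refine ContinuousLinearMap.ext_on dense_span_tensorVec ?_
  rintro _ ⟨k, l, rfl⟩
  exact h k l

theorem tensorVec_add (l l' : H) (k : K) :
    (tensorVec (l + l') k : HilbertTensor K H) = tensorVec l k + tensorVec l' k := by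
  simp only [tensorVec_apply, TensorProduct.tmul_add, UniformSpace.Completion.coe_add]

theorem tensorVec_smul (c : ℂ) (l : H) (k : K) :
    (tensorVec (c • l) k : HilbertTensor K H) = c • tensorVec l k := by
  simp only [tensorVec_apply, TensorProduct.tmul_smul, UniformSpace.Completion.coe_smul]

variable [CompleteSpace K] [CompleteSpace H]

@[simp]
theorem tensorOp_tensorVec (a : K →L[ℂ] K) (b : H →L[ℂ] H) (k : K) (l : H) :
    tensorOp a b (tensorVec l k) = tensorVec (b l) (a k) := tensorOp_tmul a b k l

theorem tensorOp_mul (a a' : K →L[ℂ] K) (b b' : H →L[ℂ] H) :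
    tensorOp (a * a') (b * b') = tensorOp a b * tensorOp a' b' :=
  tensor_ext fun k l => by simp [mul_apply_eq_comp]

theorem star_tensorOp (a : K →L[ℂ] K) (b : H →L[ℂ] H) :
    star (tensorOp a b) = tensorOp (star a) (star b) := by
  refine tensor_ext fun k l => ?_
  -- Read as functionals of the second argument, both sides need testing only on elementary tensors.
  have key : innerSL ℂ ((star (tensorOp a b)) (tensorVec l k)) =
      innerSL ℂ (tensorOp (star a) (star b) (tensorVec l k)) := by
    refine tensor_ext fun k' l' => ?_
    rw [innerSL_apply_apply, innerSL_apply_apply, inner_star_apply, tensorOp_tensorVec,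
      tensorOp_tensorVec, inner_tensorVec, inner_tensorVec, inner_star_apply, inner_star_apply]
  refine ext_inner_right ℂ fun v => ?_
  simpa using congrArg (fun T => T v) key

variable (K H) in
/-- The representation `a ↦ a ⊗ 1`. -/
noncomputable def leftTensor : (K →L[ℂ] K) →⋆ₐ[ℂ] (HilbertTensor K H →L[ℂ] HilbertTensor K H) where
  toFun a := tensorOp a 1
  map_one' := tensor_ext fun k l => by simp
  map_mul' a b := by rw [← tensorOp_mul, one_mul]
  map_zero' := tensor_ext fun k l => by simp
  map_add' a b := tensor_ext fun k l => by simp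
  commutes' c := tensor_ext fun k l => by
    simp [Algebra.algebraMap_eq_smul_one]
  map_star' a := by rw [star_tensorOp, star_one]

variable (K H) in
/-- The representation `b ↦ 1 ⊗ b`. -/
noncomputable def rightTensor : (H →L[ℂ] H) →⋆ₐ[ℂ] (HilbertTensor K H →L[ℂ] HilbertTensor K H) where
  toFun b := tensorOp 1 b
  map_one' := tensor_ext fun k l => by simp
  map_mul' a b := by rw [← tensorOp_mul, one_mul]
  map_zero' := tensor_ext fun k l => by simpa using tensorVec_smul (0 : ℂ) (0 : H) k
  map_add' a b := tensor_ext fun k l => by simp [tensorVec_add]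
  commutes' c := tensor_ext fun k l => by
    simp [Algebra.algebraMap_eq_smul_one, tensorVec_smul]
  map_star' a := by rw [star_tensorOp, star_one]

theorem leftTensor_apply (a : K →L[ℂ] K) : leftTensor K H a = tensorOp a 1 := rfl

theorem rightTensor_apply (b : H →L[ℂ] H) : rightTensor K H b = tensorOp 1 b := rfl

theorem leftTensor_mul_rightTensor (a : K →L[ℂ] K) (b : H →L[ℂ] H) :
    leftTensor K H a * rightTensor K H b = tensorOp a b := by
  rw [leftTensor_apply, rightTensor_apply, ← tensorOp_mul, mul_one, one_mul]

theorem commute_leftTensor_rightTensor (a : K →L[ℂ] K) (b : H →L[ℂ] H) :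
    Commute (leftTensor K H a) (rightTensor K H b) := by
  change leftTensor K H a * rightTensor K H b = rightTensor K H b * leftTensor K H a
  rw [leftTensor_mul_rightTensor, leftTensor_apply, rightTensor_apply, ← tensorOp_mul, mul_one,
    one_mul]

end TensorOperators

/-! ### Representations of algebraic tensor products -/

section ProductRep

variable {A B L : Type*} [Ring A] [StarRing A] [Algebra ℂ A] [StarModule ℂ A]
  [Ring B] [StarRing B] [Algebra ℂ B] [StarModule ℂ B]
  [NormedAddCommGroup L] [InnerProductSpace ℂ L] [CompleteSpace L]

/-- The representation of `A ⊗ B` given by commuting representations of `A` and `B`. -/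
noncomputable def productRep (α : A →⋆ₐ[ℂ] (L →L[ℂ] L)) (β : B →⋆ₐ[ℂ] (L →L[ℂ] L))
    (h : ∀ a b, Commute (α a) (β b)) :
    A ⊗[ℂ] B →⋆ₐ[ℂ] (L →L[ℂ] L) :=
  { Algebra.TensorProduct.lift α.toAlgHom β.toAlgHom h with
    map_star' := fun x => by
      change Algebra.TensorProduct.lift α.toAlgHom β.toAlgHom h (star x) =
        star (Algebra.TensorProduct.lift α.toAlgHom β.toAlgHom h x)
      induction x using TensorProduct.induction_on with
      | zero => simp
      | tmul a b =>
        rw [TensorProduct.star_tmul, Algebra.TensorProduct.lift_tmul,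
          Algebra.TensorProduct.lift_tmul, star_mul]
        change α (star a) * β (star b) = star (β b) * star (α a)
        rw [← map_star α, ← map_star β, (h _ _).eq]
      | add x y hx hy => rw [star_add, map_add, hx, hy, map_add, star_add] }

@[simp]
theorem productRep_tmul (α : A →⋆ₐ[ℂ] (L →L[ℂ] L)) (β : B →⋆ₐ[ℂ] (L →L[ℂ] L))
    (h : ∀ a b, Commute (α a) (β b)) (a : A) (b : B) : productRep α β h (a ⊗ₜ b) = α a * β b :=
  Algebra.TensorProduct.lift_tmul _ _ h a b

end ProductRep

/-! ### Generated von Neumann algebras -/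

section Generated

variable {H K L : Type*} [NormedAddCommGroup H] [InnerProductSpace ℂ H] [CompleteSpace H]
  [NormedAddCommGroup K] [InnerProductSpace ℂ K] [CompleteSpace K]
  [NormedAddCommGroup L] [InnerProductSpace ℂ L] [CompleteSpace L]

/-- The commutant of `S ∪ star S` is closed under the star, so the second star-commutant is an
ordinary commutant. -/
theorem coe_vnGenerated (S : Set (H →L[ℂ] H)) :
    (vnGenerated S : Set (H →L[ℂ] H)) = Set.centralizer (Set.centralizer (S ∪ star S)) := by
  have h : star (Set.centralizer (S ∪ star S)) = Set.centralizer (S ∪ star S) := by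
    rw [← StarSubalgebra.coe_centralizer ℂ S]
    ext x
    exact star_mem_iff (s := StarSubalgebra.centralizer ℂ S)
  change ((StarSubalgebra.centralizer ℂ (StarSubalgebra.centralizer ℂ S : Set (H →L[ℂ] H)) :
    StarSubalgebra ℂ (H →L[ℂ] H)) : Set (H →L[ℂ] H)) = _
  rw [StarSubalgebra.coe_centralizer, StarSubalgebra.coe_centralizer, h, Set.union_self]

theorem vnGenerated_le {S : Set (H →L[ℂ] H)} {M : VonNeumannAlgebra H}
    (h : S ⊆ (M : Set (H →L[ℂ] H))) : vnGenerated S ≤ M := by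
  intro x hx
  rw [← SetLike.mem_coe, coe_vnGenerated] at hx
  rw [← SetLike.mem_coe, ← M.centralizer_centralizer]
  refine Set.centralizer_subset (Set.centralizer_subset (Set.union_subset h fun y hy => ?_)) hx
  exact star_mem_iff.1 (h hy)

theorem le_vnJoin_left (M N : VonNeumannAlgebra H) : M ≤ vnJoin M N :=
  fun _ hx => subset_vnGenerated _ (Or.inl hx)

theorem le_vnJoin_right (M N : VonNeumannAlgebra H) : N ≤ vnJoin M N :=
  fun _ hx => subset_vnGenerated _ (Or.inr hx)

theorem vnJoin_le {M N P : VonNeumannAlgebra H} (h : M ≤ P) (h' : N ≤ P) : vnJoin M N ≤ P :=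
  vnGenerated_le (Set.union_subset h h')

theorem tensorOp_mem_vnTensor {M : VonNeumannAlgebra K} {N : VonNeumannAlgebra H}
    {a : K →L[ℂ] K} {b : H →L[ℂ] H} (ha : a ∈ M) (hb : b ∈ N) : tensorOp a b ∈ vnTensor M N :=
  subset_vnGenerated _ ⟨a, ha, b, hb, rfl⟩

/-- The product `a ⊗ b` as an element of `M ⊗̄ N`. -/
noncomputable def tensorElem {M : VonNeumannAlgebra K} {N : VonNeumannAlgebra H}
    (a : M.toStarSubalgebra) (b : N.toStarSubalgebra) : (vnTensor M N).toStarSubalgebra :=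
  ⟨tensorOp a b, tensorOp_mem_vnTensor a.2 b.2⟩

/-- The representation `a ↦ α(a) ⊗ 1`. -/
noncomputable def leftRep {A : Type*} [Ring A] [StarRing A] [Algebra ℂ A] (H : Type*)
    [NormedAddCommGroup H] [InnerProductSpace ℂ H] [CompleteSpace H] (α : A →⋆ₐ[ℂ] (K →L[ℂ] K)) :
    A →⋆ₐ[ℂ] (HilbertTensor K H →L[ℂ] HilbertTensor K H) :=
  StarAlgHom.comp (leftTensor K H) α

/-- The representation `b ↦ 1 ⊗ β(b)`. -/
noncomputable def rightRep {B : Type*} [Ring B] [StarRing B] [Algebra ℂ B] (K : Type*)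
    [NormedAddCommGroup K] [InnerProductSpace ℂ K] [CompleteSpace K] (β : B →⋆ₐ[ℂ] (H →L[ℂ] H)) :
    B →⋆ₐ[ℂ] (HilbertTensor K H →L[ℂ] HilbertTensor K H) :=
  StarAlgHom.comp (rightTensor K H) β

theorem leftRep_mul_rightRep {A B : Type*} [Ring A] [StarRing A] [Algebra ℂ A]
    [Ring B] [StarRing B] [Algebra ℂ B] (α : A →⋆ₐ[ℂ] (K →L[ℂ] K)) (β : B →⋆ₐ[ℂ] (H →L[ℂ] H))
    (a : A) (b : B) : leftRep H α a * rightRep K β b = tensorOp (α a) (β b) :=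
  leftTensor_mul_rightTensor (α a) (β b)

theorem commute_leftRep_rightRep {A B : Type*} [Ring A] [StarRing A] [Algebra ℂ A]
    [Ring B] [StarRing B] [Algebra ℂ B] (α : A →⋆ₐ[ℂ] (K →L[ℂ] K)) (β : B →⋆ₐ[ℂ] (H →L[ℂ] H))
    (a : A) (b : B) : Commute (leftRep H α a) (rightRep K β b) :=
  commute_leftTensor_rightTensor (α a) (β b)

/-- The tensor product of two representations. -/
noncomputable def tensorRepOf {A B : Type*} [Ring A] [StarRing A] [Algebra ℂ A] [StarModule ℂ A]
    [Ring B] [StarRing B] [Algebra ℂ B] [StarModule ℂ B] (α : A →⋆ₐ[ℂ] (K →L[ℂ] K))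
    (β : B →⋆ₐ[ℂ] (H →L[ℂ] H)) : A ⊗[ℂ] B →⋆ₐ[ℂ] (HilbertTensor K H →L[ℂ] HilbertTensor K H) :=
  productRep (leftRep H α) (rightRep K β) (commute_leftRep_rightRep α β)

theorem tensorRepOf_tmul {A B : Type*} [Ring A] [StarRing A] [Algebra ℂ A] [StarModule ℂ A]
    [Ring B] [StarRing B] [Algebra ℂ B] [StarModule ℂ B] (α : A →⋆ₐ[ℂ] (K →L[ℂ] K))
    (β : B →⋆ₐ[ℂ] (H →L[ℂ] H)) (a : A) (b : B) :
    tensorRepOf α β (a ⊗ₜ b) = tensorOp (α a) (β b) := by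
  rw [tensorRepOf, productRep_tmul, leftRep_mul_rightRep]

/-- The representation of `M ⊗ N` by operators on the Hilbert space tensor product. -/
noncomputable def tensorRep (M : VonNeumannAlgebra K) (N : VonNeumannAlgebra H) :
    M.toStarSubalgebra ⊗[ℂ] N.toStarSubalgebra →⋆ₐ[ℂ] (HilbertTensor K H →L[ℂ] HilbertTensor K H) :=
  tensorRepOf M.toStarSubalgebra.subtype N.toStarSubalgebra.subtype

theorem tensorRep_tmul {M : VonNeumannAlgebra K} {N : VonNeumannAlgebra H}
    (a : M.toStarSubalgebra) (b : N.toStarSubalgebra) :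
    tensorRep M N (a ⊗ₜ b) = tensorOp (a : K →L[ℂ] K) (b : H →L[ℂ] H) :=
  tensorRepOf_tmul _ _ _ _

/-- A set of generators can be replaced by a generating `*`-algebra. -/
theorem coe_vnGenerated_eq_bicommutant_range {A : Type*} [Ring A] [StarRing A] [Algebra ℂ A]
    (ρ : A →⋆ₐ[ℂ] (L →L[ℂ] L)) {S : Set (L →L[ℂ] L)} (h : S ⊆ Set.range ρ)
    (h' : ∀ a, ρ a ∈ vnGenerated S) :
    (vnGenerated S : Set (L →L[ℂ] L)) = Set.centralizer (Set.centralizer (Set.range ρ)) := by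
  refine Set.Subset.antisymm ?_ ?_
  · rw [coe_vnGenerated]
    refine Set.centralizer_subset (Set.centralizer_subset (Set.union_subset h fun y hy => ?_))
    obtain ⟨a, ha⟩ := h hy
    exact ⟨star a, by rw [map_star, ha, star_star]⟩
  · rw [← (vnGenerated S).centralizer_centralizer]
    refine Set.centralizer_subset (Set.centralizer_subset ?_)
    rintro _ ⟨a, rfl⟩
    exact h' a

theorem tensorRep_mem (M : VonNeumannAlgebra K) (N : VonNeumannAlgebra H)
    (w : M.toStarSubalgebra ⊗[ℂ] N.toStarSubalgebra) : tensorRep M N w ∈ vnTensor M N := by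
  induction w using TensorProduct.induction_on with
  | zero => rw [map_zero]; exact zero_mem _
  | tmul a b => rw [tensorRep_tmul]; exact tensorOp_mem_vnTensor a.2 b.2
  | add x y hx hy => rw [map_add]; exact add_mem hx hy

/-- The generators `a ⊗ b` are replaced by the range of a `*`-representation, the form required by
the domination and density arguments. -/
theorem coe_vnTensor (M : VonNeumannAlgebra K) (N : VonNeumannAlgebra H) :
    (vnTensor M N : Set (HilbertTensor K H →L[ℂ] HilbertTensor K H)) =
      Set.centralizer (Set.centralizer (Set.range (tensorRep M N))) := by
  refine coe_vnGenerated_eq_bicommutant_range _ ?_ (tensorRep_mem M N)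
  rintro _ ⟨a, ha, b, hb, rfl⟩
  exact ⟨(⟨a, ha⟩ : M.toStarSubalgebra) ⊗ₜ (⟨b, hb⟩ : N.toStarSubalgebra), tensorRep_tmul _ _⟩

/-- Normal functionals on `M ⊗̄ N` are determined by their values on the operators `a ⊗ b`. -/
theorem IsNormalFunctional.eq_of_forall_tensorElem {M : VonNeumannAlgebra K}
    {N : VonNeumannAlgebra H} {φ ψ : (vnTensor M N).toStarSubalgebra →ₗ[ℂ] ℂ}
    (hφ : IsNormalFunctional _ φ) (hψ : IsNormalFunctional _ ψ)
    (h : ∀ a b, φ (tensorElem a b) = ψ (tensorElem a b)) : φ = ψ := by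
  refine hφ.eq_of_forall_range hψ (tensorRep M N) (coe_vnTensor M N).subset (tensorRep_mem M N) ?_
  let f : M.toStarSubalgebra ⊗[ℂ] N.toStarSubalgebra →ₗ[ℂ] (vnTensor M N).toStarSubalgebra :=
    { toFun := fun w => ⟨tensorRep M N w, tensorRep_mem M N w⟩
      map_add' := fun x y => Subtype.ext (map_add _ _ _)
      map_smul' := fun c x => Subtype.ext (map_smul _ _ _) }
  have hf : φ ∘ₗ f = ψ ∘ₗ f := by
    refine TensorProduct.ext' fun a b => ?_
    have : f (a ⊗ₜ b) = tensorElem a b := Subtype.ext (tensorRep_tmul a b)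
    rw [LinearMap.comp_apply, LinearMap.comp_apply, this, h]
  exact fun w => LinearMap.congr_fun hf w

/-- The linear map underlying an isomorphism of von Neumann algebras. -/
noncomputable abbrev isoMap {M : VonNeumannAlgebra H} {N : VonNeumannAlgebra K}
    (Θ : M.toStarSubalgebra ≃⋆ₐ[ℂ] N.toStarSubalgebra) :
    M.toStarSubalgebra →ₗ[ℂ] N.toStarSubalgebra :=
  (Θ : M.toStarSubalgebra →⋆ₐ[ℂ] N.toStarSubalgebra).toAlgHom.toLinearMap

theorem IsWStarIso.normal {M : VonNeumannAlgebra H} {N : VonNeumannAlgebra K}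
    {Θ : M.toStarSubalgebra ≃⋆ₐ[ℂ] N.toStarSubalgebra} (h : IsWStarIso M N Θ) :
    IsNormalMap M N (isoMap Θ) := fun φ hφ => by
  obtain ⟨ψ, hψ, e⟩ := h.1 φ hφ
  have : φ ∘ₗ isoMap Θ = ψ := LinearMap.ext fun x => (e x).symm
  rwa [this]

theorem IsWStarIso.symm {M : VonNeumannAlgebra H} {N : VonNeumannAlgebra K}
    {Θ : M.toStarSubalgebra ≃⋆ₐ[ℂ] N.toStarSubalgebra} (h : IsWStarIso M N Θ) :
    IsWStarIso N M Θ.symm := ⟨h.2, h.1⟩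

theorem isWStarIso_refl (M : VonNeumannAlgebra H) :
    IsWStarIso M M (StarAlgEquiv.refl ℂ _) :=
  ⟨fun φ hφ => ⟨φ, hφ, fun _ => rfl⟩, fun φ hφ => ⟨φ, hφ, fun _ => rfl⟩⟩

theorem IsNormalMap.comp {M : VonNeumannAlgebra H} {N : VonNeumannAlgebra K}
    {P : VonNeumannAlgebra L} {g : N.toStarSubalgebra →ₗ[ℂ] P.toStarSubalgebra}
    {f : M.toStarSubalgebra →ₗ[ℂ] N.toStarSubalgebra} (hg : IsNormalMap N P g)
    (hf : IsNormalMap M N f) : IsNormalMap M P (g ∘ₗ f) := fun φ hφ => hf _ (hg φ hφ)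

/-- The inclusion of a subalgebra. -/
noncomputable def inclMap {M N : VonNeumannAlgebra H} (h : M ≤ N) :
    M.toStarSubalgebra →⋆ₐ[ℂ] N.toStarSubalgebra := StarSubalgebra.inclusion h

@[simp]
theorem coe_inclMap {M N : VonNeumannAlgebra H} (h : M ≤ N) (x : M.toStarSubalgebra) :
    (inclMap h x : H →L[ℂ] H) = x := rfl

theorem isNormalMap_inclMap {M N : VonNeumannAlgebra H} (h : M ≤ N) :
    IsNormalMap M N (inclMap h).toAlgHom.toLinearMap := fun _ hφ => hφ.restrict _ fun _ => rfl

end Generated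

/-! ### Compressions -/

section Compression

variable {G K : Type*} [NormedAddCommGroup G] [InnerProductSpace ℂ G] [CompleteSpace G]
  [NormedAddCommGroup K] [InnerProductSpace ℂ K] [CompleteSpace K]

theorem HasSum.of_forall_eq {ι : Type*} {f g : ι → ℂ} {s : ℂ} (h : HasSum f s)
    (e : ∀ i, g i = f i) : HasSum g s := by
  rwa [funext e]

/-- The compression of an amplified operator. -/
noncomputable def compress (W : K →L[ℂ] Ell2 G) (x : G →L[ℂ] G) : K →L[ℂ] K :=
  W.adjoint ∘L amp G x ∘L W

theorem inner_compress (W : K →L[ℂ] Ell2 G) (x : G →L[ℂ] G) (k k' : K) :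
    inner ℂ k (compress W x k') = inner ℂ (W k) (amp G x (W k')) := by
  rw [compress, ContinuousLinearMap.comp_apply, ContinuousLinearMap.adjoint_inner_right,
    ContinuousLinearMap.comp_apply]

/-- This is the source of the module property: for the slice map, `d = c ⊗ 1` satisfies the
hypothesis. -/
theorem compress_mul (W : K →L[ℂ] Ell2 G) (x d : G →L[ℂ] G) (c : K →L[ℂ] K)
    (h : ∀ k, amp G d (W k) = W (c k)) : compress W (x * d) = compress W x * c := by
  ext k
  refine ext_inner_left ℂ fun l => ?_
  rw [mul_apply_eq_comp, inner_compress, inner_compress, map_mul, mul_apply_eq_comp, h]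

theorem compress_mul' (W : K →L[ℂ] Ell2 G) (x d : G →L[ℂ] G) (c : K →L[ℂ] K)
    (h : ∀ k, amp G (star d) (W k) = W (star c k)) : compress W (d * x) = c * compress W x := by
  ext k
  refine ext_inner_left ℂ fun l => ?_
  rw [mul_apply_eq_comp, inner_compress, map_mul, mul_apply_eq_comp, ← inner_star_apply, ← map_star,
    h, ← inner_compress, inner_star_apply]

/-- Compression as a map between von Neumann algebras. -/
noncomputable def compressMap (Q : VonNeumannAlgebra G) (M : VonNeumannAlgebra K)
    (W : K →L[ℂ] Ell2 G) (h : ∀ x ∈ Q, compress W x ∈ M) :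
    Q.toStarSubalgebra →ₗ[ℂ] M.toStarSubalgebra where
  toFun x := ⟨compress W x, h x x.2⟩
  map_add' x y := by
    ext k
    simp [compress]
  map_smul' c x := by
    ext k
    simp [compress]

variable {Q : VonNeumannAlgebra G} {M : VonNeumannAlgebra K} {W : K →L[ℂ] Ell2 G}
  (h : ∀ x ∈ Q, compress W x ∈ M)

@[simp]
theorem coe_compressMap (x : Q.toStarSubalgebra) :
    (compressMap Q M W h x : K →L[ℂ] K) = compress W x := rfl

theorem isNormalMap_compressMap : IsNormalMap Q M (compressMap Q M W h) := by
  intro φ hφ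
  obtain ⟨ξ, η, e⟩ := isNormalFunctional_iff.1 hφ
  refine isNormalFunctional_of_hasSum (ampMap W ξ) (ampMap W η) fun x => ?_
  rw [LinearMap.comp_apply, e]
  refine (lp.hasSum_inner (𝕜 := ℂ) ξ _).of_forall_eq fun n => ?_
  rw [amp_apply, coe_compressMap, inner_compress]
  rfl

open scoped ComplexOrder in
theorem isCompletelyPositive_compressMap : IsCompletelyPositive Q M (compressMap Q M W h) := by
  intro n x ξ
  have e (i k : Fin n) :
      inner ℂ (ξ i) ((compressMap Q M W h (star (x i) * x k) : K →L[ℂ] K) (ξ k)) =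
      inner ℂ (amp G (x i) (W (ξ i))) (amp G (x k) (W (ξ k))) := by
    rw [coe_compressMap, inner_compress]
    change inner ℂ _ (amp G (star (x i : G →L[ℂ] G) * (x k : G →L[ℂ] G)) _) = _
    rw [map_mul, map_star, mul_apply_eq_comp, inner_apply_star]
  simp_rw [e]
  -- The double sum is the square norm of `∑ xₖ W ξₖ`.
  rw [Finset.sum_congr rfl fun i _ => (inner_sum (𝕜 := ℂ) _ _ _).symm, ← sum_inner]
  exact inner_self_complex_nonneg _

open scoped ComplexOrder in
/-- Completely positive maps send `x* x` to positive operators, on which normal states are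
nonnegative. -/
theorem IsNormalState.nonneg_of_completelyPositive {Φ : Q.toStarSubalgebra →ₗ[ℂ] M.toStarSubalgebra}
    (hΦ : IsCompletelyPositive Q M Φ) {ω : M.toStarSubalgebra →ₗ[ℂ] ℂ} (hω : IsNormalState M ω)
    (x : Q.toStarSubalgebra) : 0 ≤ ω (Φ (star x * x)) := by
  obtain ⟨ζ, hζ⟩ := hω.1.exists_vector hω.2.1
  rw [hζ]
  refine (lp.hasSum_inner (𝕜 := ℂ) ζ _).nonneg fun n => ?_
  simpa using hΦ 1 (fun _ => x) fun _ => ζ n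

end Compression

/-! ### Slice maps -/

section Slice

variable {H K : Type*} [NormedAddCommGroup H] [InnerProductSpace ℂ H] [CompleteSpace H]
  [NormedAddCommGroup K] [InnerProductSpace ℂ K] [CompleteSpace K]

/-- The operator `k ↦ (k ⊗ ζₙ)ₙ`. -/
noncomputable def sliceVec (ζ : Ell2 H) : K →L[ℂ] Ell2 (HilbertTensor K H) :=
  LinearMap.mkContinuous
    { toFun := fun k => Ell2.mk (fun n => tensorVec (ζ n) k) <| by
        simp_rw [norm_tensorVec, mul_pow]
        exact ζ.summable_norm_sq.mul_left _
      map_add' := fun k k' => by ext n; exact map_add _ _ _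
      map_smul' := fun c k => by ext n; exact map_smul _ _ _ } ‖ζ‖ fun k => by
    refine Ell2.norm_le_of_hasSum (by positivity)
      (by rw [mul_pow]; exact ζ.hasSum_norm_sq.mul_right _) fun n => ?_
    change ‖(tensorVec (ζ n) k : HilbertTensor K H)‖ ^ 2 ≤ _
    rw [norm_tensorVec, mul_pow, mul_comm]

theorem sliceVec_apply (ζ : Ell2 H) (k : K) (n : ℕ) :
    sliceVec ζ k n = (tensorVec (ζ n) k : HilbertTensor K H) := rfl

theorem amp_leftTensor_sliceVec (ζ : Ell2 H) (c : K →L[ℂ] K) (k : K) :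
    amp (HilbertTensor K H) (leftTensor K H c) (sliceVec ζ k) = sliceVec ζ (c k) := by
  ext n
  rw [amp_apply, sliceVec_apply, sliceVec_apply, leftTensor_apply, tensorOp_tensorVec]
  rfl

theorem slice_mul_leftTensor (ζ : Ell2 H) (x : HilbertTensor K H →L[ℂ] HilbertTensor K H)
    (c : K →L[ℂ] K) :
    compress (sliceVec ζ) (x * leftTensor K H c) = compress (sliceVec ζ) x * c :=
  compress_mul _ _ _ _ fun k => amp_leftTensor_sliceVec ζ c k

theorem slice_leftTensor_mul (ζ : Ell2 H) (x : HilbertTensor K H →L[ℂ] HilbertTensor K H)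
    (c : K →L[ℂ] K) :
    compress (sliceVec ζ) (leftTensor K H c * x) = c * compress (sliceVec ζ) x :=
  compress_mul' _ _ _ _ fun k => by rw [← map_star, amp_leftTensor_sliceVec]

theorem slice_tensorOp (ζ : Ell2 H) (a : K →L[ℂ] K) (b : H →L[ℂ] H) :
    compress (sliceVec ζ) (tensorOp a b) = inner ℂ ζ (amp H b ζ) • a := by
  ext k
  refine ext_inner_left ℂ fun l => ?_
  rw [inner_compress, smul_apply, inner_smul_right]
  refine (lp.hasSum_inner (𝕜 := ℂ) _ _).unique ?_
  refine ((lp.hasSum_inner (𝕜 := ℂ) ζ (amp H b ζ)).mul_right (inner ℂ l (a k))).of_forall_eq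
    fun n => ?_
  rw [amp_apply, sliceVec_apply, sliceVec_apply, tensorOp_tensorVec, inner_tensorVec, mul_comm,
    amp_apply]

/-- For `c` in the commutant of `M`, the operator `c ⊗ 1` commutes with `M ⊗̄ N`; by the module
property the slice commutes with `c`. -/
theorem slice_mem (ζ : Ell2 H) {M : VonNeumannAlgebra K} {N : VonNeumannAlgebra H} :
    ∀ x ∈ vnTensor M N, compress (sliceVec ζ) x ∈ M := by
  intro x hx
  rw [← SetLike.mem_coe, ← M.centralizer_centralizer]
  intro c hc
  rw [← slice_mul_leftTensor, ← slice_leftTensor_mul]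
  congr 1
  rw [← SetLike.mem_coe, coe_vnTensor] at hx
  refine hx _ ?_
  rintro _ ⟨w, rfl⟩
  induction w using TensorProduct.induction_on with
  | zero => rw [map_zero, zero_mul, mul_zero]
  | tmul a b =>
    rw [tensorRep_tmul, leftTensor_apply, ← tensorOp_mul, ← tensorOp_mul, mul_one, one_mul,
      hc _ a.2]
  | add x y hx hy => rw [map_add, mul_add, add_mul, hx, hy]

end Slice

/-! ### Isomorphisms of tensor products -/

section TensorIso

variable {H K L : Type*} [NormedAddCommGroup H] [InnerProductSpace ℂ H] [CompleteSpace H]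
  [NormedAddCommGroup K] [InnerProductSpace ℂ K] [CompleteSpace K]
  [NormedAddCommGroup L] [InnerProductSpace ℂ L] [CompleteSpace L]

theorem IsWStarIso.trans {M : VonNeumannAlgebra H} {N : VonNeumannAlgebra K}
    {P : VonNeumannAlgebra L} {Θ : M.toStarSubalgebra ≃⋆ₐ[ℂ] N.toStarSubalgebra}
    {Ξ : N.toStarSubalgebra ≃⋆ₐ[ℂ] P.toStarSubalgebra} (h : IsWStarIso M N Θ)
    (h' : IsWStarIso N P Ξ) : IsWStarIso M P (Θ.trans Ξ) := by
  refine ⟨fun φ hφ => ?_, fun ψ hψ => ?_⟩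
  · exact ⟨_, h.normal _ (h'.normal _ hφ), fun x => rfl⟩
  · exact ⟨_, h'.symm.normal _ (h.symm.normal _ hψ), fun x => rfl⟩

/-- If the vector functionals of `α'` are given by the amplification of `α`, then `α' ⊗ β` is
dominated by `α ⊗ β`. -/
theorem dominated_tensorRepOf {A B : Type*} [Ring A] [StarRing A] [Algebra ℂ A] [StarModule ℂ A]
    [Ring B] [StarRing B] [Algebra ℂ B] [StarModule ℂ B] {α : A →⋆ₐ[ℂ] (K →L[ℂ] K)}
    {α' : A →⋆ₐ[ℂ] (L →L[ℂ] L)} (β : B →⋆ₐ[ℂ] (H →L[ℂ] H))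
    (h : ∀ u : L, ∃ ζ : Ell2 K, ∀ a, inner ℂ u (α' a u) = inner ℂ ζ (amp K (α a) ζ))
    (v : HilbertTensor L H) : Dominated (tensorRepOf α β) (tensorRepOf α' β) v := by
  refine dominated_of_dense dense_span_tensorVec ?_ v
  rintro _ ⟨k, l, rfl⟩
  obtain ⟨ζ, hζ⟩ := h k
  -- If `ζ` represents the vector functional of `k`, then `(ζₙ ⊗ l)ₙ` represents that of `k ⊗ l`.
  refine dominated_of_inner_eq (ζ := ampMap (tensorVec l) ζ) fun w => ?_
  induction w using TensorProduct.induction_on with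
  | zero => simp
  | tmul a b =>
    rw [tensorRepOf_tmul, tensorRepOf_tmul, tensorOp_tensorVec, inner_tensorVec, hζ]
    refine (HasSum.of_forall_eq ((lp.hasSum_inner (𝕜 := ℂ) ζ (amp K (α a) ζ)).mul_right _)
      fun n => ?_).unique (lp.hasSum_inner (𝕜 := ℂ) _ _)
    rw [amp_apply, ampMap_apply, tensorOp_tensorVec, inner_tensorVec, amp_apply]
  | add x y hx hy =>
    rw [map_add, map_add, map_add, add_apply, add_apply,
      inner_add_right, inner_add_right, hx, hy]

/-- The vector functionals of an isomorphic algebra are given by the amplification. -/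
theorem IsWStarIso.exists_vector {M : VonNeumannAlgebra K} {M' : VonNeumannAlgebra L}
    {π : M.toStarSubalgebra ≃⋆ₐ[ℂ] M'.toStarSubalgebra} (hπ : IsWStarIso M M' π) (u : L) :
    ∃ ζ : Ell2 K, ∀ x : M.toStarSubalgebra,
      inner ℂ u ((π x : L →L[ℂ] L) u) = inner ℂ ζ (amp K (x : K →L[ℂ] K) ζ) :=
  hπ.normal.exists_vector u

/-- A W*-isomorphism `M → M'` extends to `M ⊗̄ N → M' ⊗̄ N`. -/
theorem exists_tensor_iso {M : VonNeumannAlgebra K} {M' : VonNeumannAlgebra L}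
    {π : M.toStarSubalgebra ≃⋆ₐ[ℂ] M'.toStarSubalgebra} (hπ : IsWStarIso M M' π)
    (N : VonNeumannAlgebra H) :
    ∃ Θ : (vnTensor M N).toStarSubalgebra ≃⋆ₐ[ℂ] (vnTensor M' N).toStarSubalgebra,
      IsWStarIso (vnTensor M N) (vnTensor M' N) Θ ∧
      ∀ a b, Θ (tensorElem a b) = tensorElem (π a) b := by
  let α' : M.toStarSubalgebra →⋆ₐ[ℂ] (L →L[ℂ] L) :=
    StarAlgHom.comp M'.toStarSubalgebra.subtype (π : M.toStarSubalgebra →⋆ₐ[ℂ] M'.toStarSubalgebra)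
  have hα' (a) : α' a = (π a : L →L[ℂ] L) := rfl
  have hmem (w) : tensorRepOf α' N.toStarSubalgebra.subtype w ∈ vnTensor M' N := by
    induction w using TensorProduct.induction_on with
    | zero => rw [map_zero]; exact zero_mem _
    | tmul a b => rw [tensorRepOf_tmul]; exact tensorOp_mem_vnTensor (π a).2 b.2
    | add x y hx hy => rw [map_add]; exact add_mem hx hy
  obtain ⟨Θ, hΘ, h⟩ := exists_wStarIso (σ := tensorRepOf M.toStarSubalgebra.subtype
      N.toStarSubalgebra.subtype) (τ := tensorRepOf α' N.toStarSubalgebra.subtype)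
    (dominated_tensorRepOf _ fun u => hπ.exists_vector u)
    (dominated_tensorRepOf _ fun u => by
      obtain ⟨ζ, hζ⟩ := hπ.symm.exists_vector u
      refine ⟨ζ, fun a => ?_⟩
      have := hζ (π a)
      rwa [π.symm_apply_apply] at this)
    (vnTensor M N) (vnTensor M' N) (coe_vnTensor M N)
    (coe_vnGenerated_eq_bicommutant_range _ (by
      rintro _ ⟨a, ha, b, hb, rfl⟩
      refine ⟨π.symm ⟨a, ha⟩ ⊗ₜ (⟨b, hb⟩ : N.toStarSubalgebra), ?_⟩
      rw [tensorRepOf_tmul, hα', π.apply_symm_apply]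
      rfl) hmem)
  refine ⟨Θ, hΘ, fun a b => Subtype.ext ?_⟩
  have h1 : tensorRepOf M.toStarSubalgebra.subtype N.toStarSubalgebra.subtype (a ⊗ₜ b) =
    tensorOp (a : K →L[ℂ] K) (b : H →L[ℂ] H) := tensorRepOf_tmul _ _ _ _
  have h2 := (h (a ⊗ₜ b) (tensorRep_mem M N _)).trans (tensorRepOf_tmul _ _ _ _)
  have h3 : tensorElem a b = ⟨_, tensorRep_mem M N (a ⊗ₜ b)⟩ := Subtype.ext h1.symm
  rw [h3]
  exact h2

/-- The representation of `M ⊗ N` by products of commuting operators. -/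
noncomputable def joinRep {M N : VonNeumannAlgebra H} (hc : ∀ a ∈ M, ∀ b ∈ N, Commute a b) :
    M.toStarSubalgebra ⊗[ℂ] N.toStarSubalgebra →⋆ₐ[ℂ] (H →L[ℂ] H) :=
  productRep M.toStarSubalgebra.subtype N.toStarSubalgebra.subtype fun a b => hc a a.2 b b.2

theorem joinRep_tmul {M N : VonNeumannAlgebra H} (hc : ∀ a ∈ M, ∀ b ∈ N, Commute a b)
    (a : M.toStarSubalgebra) (b : N.toStarSubalgebra) :
    joinRep hc (a ⊗ₜ b) = (a : H →L[ℂ] H) * b := productRep_tmul _ _ _ _ _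

theorem joinRep_mem {M N : VonNeumannAlgebra H} (hc : ∀ a ∈ M, ∀ b ∈ N, Commute a b)
    (w : M.toStarSubalgebra ⊗[ℂ] N.toStarSubalgebra) : joinRep hc w ∈ vnJoin M N := by
  induction w using TensorProduct.induction_on with
  | zero => rw [map_zero]; exact zero_mem _
  | tmul a b =>
    rw [joinRep_tmul]
    exact mul_mem (le_vnJoin_left M N a.2) (le_vnJoin_right M N b.2)
  | add x y hx hy => rw [map_add]; exact add_mem hx hy

theorem coe_vnJoin {M N : VonNeumannAlgebra H} (hc : ∀ a ∈ M, ∀ b ∈ N, Commute a b) :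
    (vnJoin M N : Set (H →L[ℂ] H)) =
      Set.centralizer (Set.centralizer (Set.range (joinRep hc))) := by
  refine coe_vnGenerated_eq_bicommutant_range (joinRep hc) ?_ (joinRep_mem hc)
  rintro x (hx | hx)
  · refine ⟨(⟨x, hx⟩ : M.toStarSubalgebra) ⊗ₜ (1 : N.toStarSubalgebra), ?_⟩
    rw [joinRep_tmul, OneMemClass.coe_one, mul_one]
  · refine ⟨(1 : M.toStarSubalgebra) ⊗ₜ (⟨x, hx⟩ : N.toStarSubalgebra), ?_⟩
    rw [joinRep_tmul, OneMemClass.coe_one, one_mul]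

/-- On the algebraic tensor product with the smaller factor, the given isomorphism already links the
two representations; this supplies both dominations for the restricted product. -/
theorem exists_eq_tensorRep_and_eq_joinRep {M M₀ N P : VonNeumannAlgebra H} (hM : M₀ ≤ M)
    (hc : ∀ a ∈ M₀, ∀ b ∈ N, Commute a b)
    {Θ : (vnTensor M N).toStarSubalgebra ≃⋆ₐ[ℂ] P.toStarSubalgebra}
    (h : ∀ a b, (Θ (tensorElem a b) : H →L[ℂ] H) = a * b)
    (w : M₀.toStarSubalgebra ⊗[ℂ] N.toStarSubalgebra) :
    ∃ x : (vnTensor M N).toStarSubalgebra,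
      (x : HilbertTensor H H →L[ℂ] HilbertTensor H H) = tensorRep M₀ N w ∧
        (Θ x : H →L[ℂ] H) = joinRep hc w := by
  induction w using TensorProduct.induction_on with
  | zero =>
    refine ⟨0, ?_, ?_⟩
    · rw [map_zero]; rfl
    · rw [map_zero, map_zero]; rfl
  | tmul a b =>
    refine ⟨tensorElem (inclMap hM a) b, ?_, ?_⟩
    · exact (tensorRep_tmul a b).symm
    · rw [h, joinRep_tmul, coe_inclMap]
  | add x y hx hy =>
    obtain ⟨x', hx1, hx2⟩ := hx
    obtain ⟨y', hy1, hy2⟩ := hy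
    refine ⟨x' + y', ?_, ?_⟩
    · rw [map_add, ← hx1, ← hy1]; rfl
    · rw [map_add, map_add, ← hx2, ← hy2]; rfl

/-- A W*-product restricts to a W*-product of a subalgebra of the first factor and the second
factor. -/
theorem exists_join_iso {M M₀ N P : VonNeumannAlgebra H} (hM : M₀ ≤ M)
    (hc : ∀ a ∈ M₀, ∀ b ∈ N, Commute a b)
    {Θ : (vnTensor M N).toStarSubalgebra ≃⋆ₐ[ℂ] P.toStarSubalgebra}
    (hΘ : IsWStarIso (vnTensor M N) P Θ)
    (h : ∀ a b, (Θ (tensorElem a b) : H →L[ℂ] H) = a * b) :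
    ∃ Ξ : (vnTensor M₀ N).toStarSubalgebra ≃⋆ₐ[ℂ] (vnJoin M₀ N).toStarSubalgebra,
      IsWStarIso (vnTensor M₀ N) (vnJoin M₀ N) Ξ ∧
      ∀ a b, (Ξ (tensorElem a b) : H →L[ℂ] H) = a * b := by
  have h1 (u) : Dominated (tensorRep M₀ N) (joinRep hc) u := by
    obtain ⟨ζ, hζ⟩ := hΘ.exists_vector u
    refine dominated_of_inner_eq (ζ := ζ) fun w => ?_
    obtain ⟨x, hx1, hx2⟩ := exists_eq_tensorRep_and_eq_joinRep hM hc h w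
    rw [← hx1, ← hx2, hζ]
  have h2 (u) : Dominated (joinRep hc) (tensorRep M₀ N) u := by
    obtain ⟨ζ, hζ⟩ := hΘ.symm.exists_vector u
    refine dominated_of_inner_eq (ζ := ζ) fun w => ?_
    obtain ⟨x, hx1, hx2⟩ := exists_eq_tensorRep_and_eq_joinRep hM hc h w
    rw [← hx1, ← hx2, ← hζ, Θ.symm_apply_apply]
  obtain ⟨Ξ, hΞ, h'⟩ := exists_wStarIso h1 h2 (vnTensor M₀ N) (vnJoin M₀ N) (coe_vnTensor M₀ N)
    (coe_vnJoin hc)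
  refine ⟨Ξ, hΞ, fun a b => ?_⟩
  have h3 := (h' (a ⊗ₜ b) (tensorRep_mem M₀ N _)).trans (joinRep_tmul hc a b)
  have h4 : tensorElem a b = ⟨_, tensorRep_mem M₀ N (a ⊗ₜ b)⟩ :=
    Subtype.ext (tensorRep_tmul a b).symm
  rw [h4]
  exact h3

end TensorIso

/-! ### Conditional expectations with respect to the noise -/

section NoiseExpectation

variable {H K L : Type*} [NormedAddCommGroup H] [InnerProductSpace ℂ H] [CompleteSpace H]
  [NormedAddCommGroup K] [InnerProductSpace ℂ K] [CompleteSpace K]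
  [NormedAddCommGroup L] [InnerProductSpace ℂ L] [CompleteSpace L]
  {M : VonNeumannAlgebra K} {A N : VonNeumannAlgebra H} {P : VonNeumannAlgebra L}
  {Θ : (vnTensor M N).toStarSubalgebra ≃⋆ₐ[ℂ] P.toStarSubalgebra}

theorem IsNormalFunctional.eq_of_forall_product (hΘ : IsWStarIso (vnTensor M N) P Θ)
    {φ ψ : P.toStarSubalgebra →ₗ[ℂ] ℂ} (hφ : IsNormalFunctional P φ) (hψ : IsNormalFunctional P ψ)
    (h : ∀ a b, φ (Θ (tensorElem a b)) = ψ (Θ (tensorElem a b))) : φ = ψ := by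
  have := (hΘ.normal φ hφ).eq_of_forall_tensorElem (hΘ.normal ψ hψ) h
  refine LinearMap.ext fun x => ?_
  have h1 := LinearMap.congr_fun this (Θ.symm x)
  change φ (Θ (Θ.symm x)) = ψ (Θ (Θ.symm x)) at h1
  rwa [Θ.apply_symm_apply] at h1

theorem IsCompletelyPositive.comp_starHom {Q : VonNeumannAlgebra K} {R : VonNeumannAlgebra L}
    {N : VonNeumannAlgebra H} {Φ : Q.toStarSubalgebra →ₗ[ℂ] N.toStarSubalgebra}
    (hΦ : IsCompletelyPositive Q N Φ) (f : R.toStarSubalgebra →⋆ₐ[ℂ] Q.toStarSubalgebra) :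
    IsCompletelyPositive R N (Φ ∘ₗ f.toAlgHom.toLinearMap) := by
  intro n x ξ
  have h (i k) : f (star (x i) * x k) = star (f (x i)) * f (x k) := by rw [map_mul, map_star]
  have := hΦ n (fun i => f (x i)) ξ
  simp_rw [← h] at this
  exact this

/-- Only unit vectors define states; rescaling and polarization recover the operator. -/
theorem eq_of_forall_inner_self {x y : M.toStarSubalgebra}
    (h : ∀ k : K, ‖k‖ = 1 → inner ℂ k ((x : K →L[ℂ] K) k) = inner ℂ k ((y : K →L[ℂ] K) k)) :
    x = y := by
  refine Subtype.ext (ContinuousLinearMap.coe_injective ((ext_inner_map _ _).1 fun k => ?_))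
  rcases eq_or_ne k 0 with rfl | hk
  · simp
  have h0 : (‖k‖ : ℂ) ≠ 0 := by exact_mod_cast norm_ne_zero_iff.2 hk
  have h1 := h ((‖k‖ : ℂ)⁻¹ • k) (by
    rw [norm_smul, norm_inv, Complex.norm_real, norm_norm, inv_mul_cancel₀ (norm_ne_zero_iff.2 hk)])
  rw [map_smul, map_smul, inner_smul_left, inner_smul_left, inner_smul_right,
    inner_smul_right] at h1
  have h2 : inner ℂ k ((x : K →L[ℂ] K) k) = inner ℂ k ((y : K →L[ℂ] K) k) :=
    mul_left_cancel₀ (inv_ne_zero h0) (mul_left_cancel₀ (by simpa using hk) h1)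
  have h3 := congrArg (starRingEnd ℂ) h2
  rwa [inner_conj_symm, inner_conj_symm] at h3

open scoped ComplexOrder in
theorem isNormalState_vectorFunctional {k : K} (hk : ‖k‖ = 1) :
    IsNormalState M (vectorFunctional M k k) := by
  refine ⟨isNormalFunctional_vectorFunctional M k k, fun x => ?_, ?_⟩
  · change 0 ≤ inner ℂ k ((star (x : K →L[ℂ] K)) ((x : K →L[ℂ] K) k))
    rw [inner_apply_star]
    exact inner_self_complex_nonneg _
  · change inner ℂ k k = 1
    rw [inner_self_eq_norm_sq_to_K, hk]
    simp

variable {ϱ : A.toStarSubalgebra →ₗ[ℂ] ℂ} {μ : (K →L[ℂ] K) → (H →L[ℂ] H) → (L →L[ℂ] L)}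

/-- Vector states separate `M`; composed with either map they give normal functionals with the same
prescribed values on products. -/
theorem IsNoiseExpectation.unique (hΘ : IsWStarIso (vnTensor M N) P Θ) (hNA : N ≤ A)
    (hμ : ∀ a b, (Θ (tensorElem a b) : L →L[ℂ] L) = μ a b)
    {ε ε' : P.toStarSubalgebra →ₗ[ℂ] M.toStarSubalgebra}
    (h : IsNoiseExpectation M A ϱ N P μ ε) (h' : IsNoiseExpectation M A ϱ N P μ ε') : ε = ε' := by
  refine LinearMap.ext fun x => eq_of_forall_inner_self fun k hk => ?_
  have hω := isNormalState_vectorFunctional (M := M) hk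
  refine LinearMap.congr_fun (((h _ hω).1.1).eq_of_forall_product hΘ ((h' _ hω).1.1)
    fun a b => ?_) x
  exact ((h _ hω).2 a (inclMap hNA b) b.2 _ (hμ a b)).trans
    ((h' _ hω).2 a (inclMap hNA b) b.2 _ (hμ a b)).symm

/-- The conditional expectation with respect to a normal state of the second factor. -/
theorem exists_noiseExpectation (hΘ : IsWStarIso (vnTensor M N) P Θ) (hNA : N ≤ A)
    (hμ : ∀ a b, (Θ (tensorElem a b) : L →L[ℂ] L) = μ a b) (hϱ : IsNormalState A ϱ) :
    ∃ ε : P.toStarSubalgebra →ₗ[ℂ] M.toStarSubalgebra, IsNoiseExpectation M A ϱ N P μ ε ∧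
      IsNormalMap P M ε ∧ IsCompletelyPositive P M ε ∧
      (∀ a b, ε (Θ (tensorElem a b)) = ϱ (inclMap hNA b) • a) ∧
      ∀ a b x, ε (Θ (tensorElem a 1) * x * Θ (tensorElem b 1)) = a * ε x * b := by
  have hn : IsNormalFunctional N (ϱ ∘ₗ (inclMap hNA).toAlgHom.toLinearMap) :=
    isNormalMap_inclMap hNA ϱ hϱ.1
  -- The state restricted to `N` is a vector functional at `ζ`; slicing with this `ζ` gives the
  -- expectation.
  obtain ⟨ζ, hζ⟩ := hn.exists_vector fun x => by
    have h1 := hϱ.2.1 (inclMap hNA x)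
    rw [← map_star, ← map_mul] at h1
    exact h1
  let R := compressMap (vnTensor M N) M (sliceVec ζ) (slice_mem ζ)
  let ε := R ∘ₗ isoMap Θ.symm
  have hε (x) : ε (Θ x) = R x := congrArg R (Θ.symm_apply_apply x)
  have hεn : IsNormalMap P M ε := (isNormalMap_compressMap _).comp hΘ.symm.normal
  have hcp : IsCompletelyPositive P M ε := (isCompletelyPositive_compressMap _).comp_starHom _
  have hprod (a b) : ε (Θ (tensorElem a b)) = ϱ (inclMap hNA b) • a := by
    rw [hε]
    refine Subtype.ext ((slice_tensorOp ζ _ _).trans ?_)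
    rw [← hζ]
    rfl
  have h1 : (tensorElem 1 1 : (vnTensor M N).toStarSubalgebra) = 1 :=
    Subtype.ext (map_one (leftTensor K H))
  have hone : ε 1 = 1 := by
    have h2 := hprod 1 1
    have h3 : Θ 1 = 1 := map_one Θ
    have h4 : inclMap hNA 1 = 1 := map_one _
    rwa [h1, h3, h4, hϱ.2.2, one_smul] at h2
  refine ⟨ε, fun ω hω => ⟨⟨hεn ω hω.1, hω.nonneg_of_completelyPositive hcp, ?_⟩,
    fun a b hb x hx => ?_⟩, hεn, hcp, hprod, fun a b x => ?_⟩
  · rw [LinearMap.comp_apply, hone, hω.2.2]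
  · have h2 : x = Θ (tensorElem a (⟨b, hb⟩ : N.toStarSubalgebra)) :=
      Subtype.ext (hx.trans (hμ a ⟨b, hb⟩).symm)
    rw [h2, hprod, map_smul, smul_eq_mul, mul_comm]
    rfl
  · obtain ⟨y, rfl⟩ : ∃ y, Θ y = x := ⟨Θ.symm x, Θ.apply_symm_apply x⟩
    rw [← map_mul, ← map_mul, hε, hε]
    let y' : HilbertTensor K H →L[ℂ] HilbertTensor K H := y
    exact Subtype.ext ((slice_mul_leftTensor ζ (leftTensor K H (a : K →L[ℂ] K) * y') b).trans
      (congrArg (· * (b : K →L[ℂ] K)) (slice_leftTensor_mul ζ y' a)))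

end NoiseExpectation

/-! ### Conditional expectations on W*-products -/

section Products

variable {H : Type*} [NormedAddCommGroup H] [InnerProductSpace ℂ H] [CompleteSpace H]
  {M N P A : VonNeumannAlgebra H} {ϱ : A.toStarSubalgebra →ₗ[ℂ] ℂ}

theorem IsWStarProduct.exists_iso (h : IsWStarProduct M N P) :
    ∃ Θ : (vnTensor M N).toStarSubalgebra ≃⋆ₐ[ℂ] P.toStarSubalgebra,
      IsWStarIso (vnTensor M N) P Θ ∧ ∀ a b, (Θ (tensorElem a b) : H →L[ℂ] H) = a * b := by
  obtain ⟨Θ, hΘ, h⟩ := h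
  exact ⟨Θ, hΘ, fun a b => h a a.2 b b.2 (tensorElem a b) rfl⟩

theorem IsWStarProduct.mul_mem (h : IsWStarProduct M N P) {a b : H →L[ℂ] H} (ha : a ∈ M)
    (hb : b ∈ N) : a * b ∈ P := by
  obtain ⟨Θ, -, hm⟩ := h.exists_iso
  rw [← hm ⟨a, ha⟩ ⟨b, hb⟩]
  exact (Θ _).2

theorem IsWStarProduct.left_le (h : IsWStarProduct M N P) : M ≤ P := fun a ha => by
  simpa using h.mul_mem ha (one_mem N)

theorem IsWStarProduct.right_le (h : IsWStarProduct M N P) : N ≤ P := fun b hb => by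
  simpa using h.mul_mem (one_mem M) hb

theorem IsWStarProduct.normal_ext (h : IsWStarProduct M N P) {φ ψ : P.toStarSubalgebra →ₗ[ℂ] ℂ}
    (hφ : IsNormalFunctional P φ) (hψ : IsNormalFunctional P ψ)
    (e : ∀ (a : M.toStarSubalgebra) (b : N.toStarSubalgebra) (x : P.toStarSubalgebra),
      (x : H →L[ℂ] H) = a * b → φ x = ψ x) : φ = ψ := by
  obtain ⟨Θ, hΘ, hm⟩ := h.exists_iso
  exact hφ.eq_of_forall_product hΘ hψ fun a b => e a b _ (hm a b)

theorem IsWStarProduct.noiseExpectation_unique (h : IsWStarProduct M N P) (hNA : N ≤ A)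
    {ε ε' : P.toStarSubalgebra →ₗ[ℂ] M.toStarSubalgebra}
    (hε : IsNoiseExpectation M A ϱ N P (fun b a => b * a) ε)
    (hε' : IsNoiseExpectation M A ϱ N P (fun b a => b * a) ε') : ε = ε' := by
  obtain ⟨Θ, hΘ, hm⟩ := h.exists_iso
  exact hε.unique hΘ hNA hm hε'

theorem IsWStarProduct.exists_condExpectation (h : IsWStarProduct M N P) (hNA : N ≤ A)
    (hϱ : IsNormalState A ϱ) :
    ∃ ε, IsNoiseExpectation M A ϱ N P (fun b a => b * a) ε ∧ IsCondExpectation P M ε ∧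
      ∀ (a : M.toStarSubalgebra) (b : N.toStarSubalgebra) (x : P.toStarSubalgebra),
        (x : H →L[ℂ] H) = a * b → ε x = ϱ (inclMap hNA b) • a := by
  obtain ⟨Θ, hΘ, hm⟩ := h.exists_iso
  obtain ⟨ε, h1, h2, h3, h4, h5⟩ := exists_noiseExpectation (μ := fun b a => b * a) hΘ hNA hm hϱ
  have h6 (a : M.toStarSubalgebra) (b : N.toStarSubalgebra) (x : P.toStarSubalgebra)
      (hx : (x : H →L[ℂ] H) = a * b) : ε x = ϱ (inclMap hNA b) • a := by
    rw [← h4]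
    exact congrArg ε (Subtype.ext (hx.trans (hm a b).symm))
  have h7 (a : M.toStarSubalgebra) : (Θ (tensorElem a 1) : H →L[ℂ] H) = a := by
    rw [hm]
    exact mul_one _
  refine ⟨ε, h1, ⟨h.left_le, h2, h3, fun x hx => ?_, fun a b x ha hb => ?_⟩, h6⟩
  · have h8 : inclMap hNA 1 = 1 := map_one _
    have h9 := h6 ⟨x, hx⟩ 1 x (mul_one _).symm
    rw [h8, hϱ.2.2, one_smul] at h9
    rw [h9]
  · have ea : a = Θ (tensorElem ⟨a, ha⟩ 1) := Subtype.ext (h7 ⟨a, ha⟩).symm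
    have eb : b = Θ (tensorElem ⟨b, hb⟩ 1) := Subtype.ext (h7 ⟨b, hb⟩).symm
    have h8 := congrArg (fun y : M.toStarSubalgebra => (y : H →L[ℂ] H)) (h5 ⟨a, ha⟩ ⟨b, hb⟩ x)
    rw [← ea, ← eb] at h8
    exact h8

/-- The conditional expectation with respect to the noise multiplies out the second factor. -/
theorem IsNoiseExpectation.condExpectation (h : IsWStarProduct M N P) (hNA : N ≤ A)
    (hϱ : IsNormalState A ϱ) {ε : P.toStarSubalgebra →ₗ[ℂ] M.toStarSubalgebra}
    (hε : IsNoiseExpectation M A ϱ N P (fun b a => b * a) ε) :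
    IsCondExpectation P M ε ∧
      ∀ (a : M.toStarSubalgebra) (b : N.toStarSubalgebra) (x : P.toStarSubalgebra),
        (x : H →L[ℂ] H) = a * b → ε x = ϱ (inclMap hNA b) • a := by
  obtain ⟨ε', h1, h2⟩ := h.exists_condExpectation hNA hϱ
  rwa [h.noiseExpectation_unique hNA hε h1]

/-- A normal map that sends products into a von Neumann algebra sends the algebra they generate
into it. -/
theorem map_mem_of_mem_vnJoin {M₀ : VonNeumannAlgebra H}
    (hc : ∀ a ∈ M₀, ∀ b ∈ N, Commute a b) (hJ : vnJoin M₀ N ≤ P)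
    {ε : P.toStarSubalgebra →ₗ[ℂ] M.toStarSubalgebra} (hε : IsNormalMap P M ε)
    (h : ∀ a ∈ M₀, ∀ b ∈ N, ∀ x : P.toStarSubalgebra, (x : H →L[ℂ] H) = a * b →
      (ε x : H →L[ℂ] H) ∈ M₀) (x : P.toStarSubalgebra) (hx : (x : H →L[ℂ] H) ∈ vnJoin M₀ N) :
    (ε x : H →L[ℂ] H) ∈ M₀ := by
  have hrange (w) : (ε ⟨joinRep hc w, hJ (joinRep_mem hc w)⟩ : H →L[ℂ] H) ∈ M₀ := by
    induction w using TensorProduct.induction_on with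
    | zero =>
      have : (⟨joinRep hc 0, hJ (joinRep_mem hc 0)⟩ : P.toStarSubalgebra) = 0 :=
        Subtype.ext (map_zero _)
      rw [this, map_zero]
      exact zero_mem M₀
    | tmul a b => exact h a a.2 b b.2 _ (joinRep_tmul hc a b)
    | add v w hv hw =>
      have : (⟨joinRep hc (v + w), hJ (joinRep_mem hc _)⟩ : P.toStarSubalgebra) =
          ⟨joinRep hc v, hJ (joinRep_mem hc v)⟩ + ⟨joinRep hc w, hJ (joinRep_mem hc w)⟩ :=
        Subtype.ext (map_add _ _ _)
      rw [this, map_add]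
      exact add_mem hv hw
  rw [← SetLike.mem_coe, ← M₀.centralizer_centralizer]
  intro c hcM
  ext η
  refine ext_inner_left ℂ fun ξ => ?_
  -- For `c` in the commutant of `M₀`, the functionals at `(c* ξ, η)` and `(ξ, c η)` agree on finite
  -- sums of products, hence by normality on the generated algebra.
  have hn (ξ η : H) := isNormalMap_inclMap hJ _ (hε _ (isNormalFunctional_vectorFunctional M ξ η))
  have key := (hn ((star c) ξ) η).eq_of_forall_range (hn ξ (c η)) (joinRep hc) (coe_vnJoin hc).subset
    (joinRep_mem hc) fun w => by
      have h1 := congrArg (fun T : H →L[ℂ] H => inner ℂ ξ (T η)) (hcM _ (hrange w))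
      change inner ℂ ((star c) ξ) ((ε ⟨joinRep hc w, hJ (joinRep_mem hc w)⟩ : H →L[ℂ] H) η) =
        inner ℂ ξ ((ε ⟨joinRep hc w, hJ (joinRep_mem hc w)⟩ : H →L[ℂ] H) (c η))
      rw [inner_star_apply]
      exact h1.symm
  have h2 := LinearMap.congr_fun key ⟨x, hx⟩
  change inner ℂ ((star c) ξ) ((ε x : H →L[ℂ] H) η) = inner ℂ ξ ((ε x : H →L[ℂ] H) (c η)) at h2
  rw [inner_star_apply] at h2
  exact h2

end Products

/-! ### Countable additivity -/

section Additivity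

variable {H Ω : Type*} [NormedAddCommGroup H] [InnerProductSpace ℂ H] [CompleteSpace H]
  [MeasurableSpace Ω]

/-- Cauchy–Schwarz for `e ξ` and `e θ`, followed by the arithmetic–geometric mean inequality. The
bound splits into diagonal terms, which are summable. -/
theorem norm_inner_projection_le {e : H →L[ℂ] H} (he : IsStarProjection e) (ξ θ : H) :
    ‖inner ℂ ξ (e θ)‖ ≤ (inner ℂ ξ (e ξ)).re + (inner ℂ θ (e θ)).re := by
  have h (ξ θ : H) : inner ℂ ξ (e θ) = inner ℂ (e ξ) (e θ) := by
    conv_lhs => rw [← he.isIdempotentElem.eq, mul_apply_eq_comp, ← inner_star_apply,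
      he.isSelfAdjoint.star_eq]
  rw [h ξ θ, h ξ ξ, h θ θ]
  have e1 := @inner_self_eq_norm_sq ℂ _ _ _ _ (e ξ)
  have e2 := @inner_self_eq_norm_sq ℂ _ _ _ _ (e θ)
  simp only [RCLike.re_eq_complex_re] at e1 e2
  rw [e1, e2]
  have := norm_inner_le_norm (𝕜 := ℂ) (e ξ) (e θ)
  nlinarith [sq_nonneg (‖e ξ‖ - ‖e θ‖), sq_nonneg (‖e ξ‖), sq_nonneg (‖e θ‖)]

theorem IsSpectralMeasure.hasSum_inner {E : Set Ω → H →L[ℂ] H} (hE : IsSpectralMeasure E)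
    {Δ : ℕ → Set Ω} (hΔ : ∀ n, MeasurableSet (Δ n)) (hd : Pairwise (Function.onFun Disjoint Δ))
    (ξ θ : H) : HasSum (fun n => inner ℂ ξ (E (Δ n) θ)) (inner ℂ ξ (E (⋃ n, Δ n) θ)) :=
  (innerSL ℂ ξ).hasSum (hE.iUnion Δ hΔ hd θ)

theorem IsSpectralMeasure.hasSum_re_inner {E : Set Ω → H →L[ℂ] H} (hE : IsSpectralMeasure E)
    {Δ : ℕ → Set Ω} (hΔ : ∀ n, MeasurableSet (Δ n)) (hd : Pairwise (Function.onFun Disjoint Δ))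
    (ξ : H) : HasSum (fun n => (inner ℂ ξ (E (Δ n) ξ)).re) (inner ℂ ξ (E (⋃ n, Δ n) ξ)).re :=
  Complex.hasSum_re (hE.hasSum_inner hΔ hd ξ ξ)

theorem IsSpectralMeasure.summable_prod {E : Set Ω → H →L[ℂ] H} (hE : IsSpectralMeasure E)
    {Δ : ℕ → Set Ω} (hΔ : ∀ n, MeasurableSet (Δ n)) (hd : Pairwise (Function.onFun Disjoint Δ))
    (ξ : Ell2 H) : Summable fun p : ℕ × ℕ => (inner ℂ (ξ p.1) (E (Δ p.2) (ξ p.1))).re := by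
  have h0 (e : H →L[ℂ] H) (he : IsStarProjection e) (ξ : H) : 0 ≤ (inner ℂ ξ (e ξ)).re := by
    have := (norm_nonneg _).trans (norm_inner_projection_le he ξ ξ)
    linarith
  refine (summable_prod_of_nonneg fun p => h0 _ (hE.proj _ (hΔ _)) _).2
    ⟨fun m => (hE.hasSum_re_inner hΔ hd (ξ m)).summable, ?_⟩
  simp_rw [fun m => (hE.hasSum_re_inner hΔ hd (ξ m)).tsum_eq]
  exact (Complex.hasSum_re (lp.hasSum_inner (𝕜 := ℂ) ξ (amp H (E (⋃ n, Δ n)) ξ))).summable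

/-- A spectral measure is countably additive in normal functionals. -/
theorem IsSpectralMeasure.hasSum_inner_amp {E : Set Ω → H →L[ℂ] H} (hE : IsSpectralMeasure E)
    {Δ : ℕ → Set Ω} (hΔ : ∀ n, MeasurableSet (Δ n)) (hd : Pairwise (Function.onFun Disjoint Δ))
    (ξ θ : Ell2 H) : HasSum (fun n => inner ℂ ξ (amp H (E (Δ n)) θ))
      (inner ℂ ξ (amp H (E (⋃ n, Δ n)) θ)) := by
  -- Absolute summability over coordinates and sets permits the two sums to be interchanged.
  have hs : Summable fun p : ℕ × ℕ => inner ℂ (ξ p.1) (E (Δ p.2) (θ p.1)) :=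
    Summable.of_norm_bounded ((hE.summable_prod hΔ hd ξ).add (hE.summable_prod hΔ hd θ))
      fun p => norm_inner_projection_le (hE.proj _ (hΔ _)) _ _
  have h1 := (hs.hasSum.prod_fiberwise fun m => hE.hasSum_inner hΔ hd (ξ m) (θ m)).unique
    (lp.hasSum_inner (𝕜 := ℂ) ξ (amp H (E (⋃ n, Δ n)) θ))
  have h2 := ((Equiv.prodComm ℕ ℕ).hasSum_iff.2 hs.hasSum).prod_fiberwise
    fun n => lp.hasSum_inner (𝕜 := ℂ) ξ (amp H (E (Δ n)) θ)
  rwa [h1] at h2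

end Additivity

/-! ### The reduced dynamics of a quantum stochastic object -/

theorem exists_starAlgHom_lift {H K L : Type*} [NormedAddCommGroup H] [InnerProductSpace ℂ H]
    [CompleteSpace H] [NormedAddCommGroup K] [InnerProductSpace ℂ K] [CompleteSpace K]
    [NormedAddCommGroup L] [InnerProductSpace ℂ L] [CompleteSpace L] {M : VonNeumannAlgebra K}
    {N N' : VonNeumannAlgebra H} {P : VonNeumannAlgebra L}
    (p : P.toStarSubalgebra ≃⋆ₐ[ℂ] N.toStarSubalgebra) (hN : N' ≤ N)
    (r : M.toStarSubalgebra ≃⋆ₐ[ℂ] N'.toStarSubalgebra) :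
    ∃ γ : M.toStarSubalgebra →⋆ₐ[ℂ] P.toStarSubalgebra,
      ∀ q, (p (γ q) : H →L[ℂ] H) = (r q : H →L[ℂ] H) := by
  refine ⟨(p.symm : N.toStarSubalgebra →⋆ₐ[ℂ] P.toStarSubalgebra).comp
    ((inclMap hN).comp (r : M.toStarSubalgebra →⋆ₐ[ℂ] N'.toStarSubalgebra)), fun q => ?_⟩
  exact congrArg Subtype.val (p.apply_symm_apply (inclMap hN (r q)))

namespace QSObject

variable {H Ω : Type*} [NormedAddCommGroup H] [InnerProductSpace ℂ H] [CompleteSpace H]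
  [MeasurableSpace Ω] {h : ℝ≥0 → Type*} [∀ t, NormedAddCommGroup (h t)]
  [∀ t, InnerProductSpace ℂ (h t)] [∀ t, CompleteSpace (h t)] (S : QSObject H Ω h)

theorem noiseSeg_le_noise (s t : ℝ≥0) : S.noiseSeg s t ≤ S.noise s := fun _ hx => hx.1

theorem noiseSeg_le_past (s t : ℝ≥0) : S.noiseSeg s t ≤ S.past t := fun _ hx => hx.2

theorem product_noiseSeg {s t : ℝ≥0} (hst : s < t) :
    IsWStarProduct (S.past s) (S.noiseSeg s t) (S.past t) := S.product s t hst

theorem commute_past_noise {s : ℝ≥0} {a b : H →L[ℂ] H} (ha : a ∈ S.past s) (hb : b ∈ S.noise s) :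
    Commute a b :=
  (VonNeumannAlgebra.mem_commutant_iff.1 (S.past_commute_noise s ha) b hb).symm

theorem commute_boundary_noiseSeg (s t : ℝ≥0) :
    ∀ a ∈ S.boundary s, ∀ b ∈ S.noiseSeg s t, Commute a b := fun _ ha _ hb =>
  S.commute_past_noise (S.boundary_le_past s ha) hb.1

theorem join_le {s : ℝ≥0} {M N P : VonNeumannAlgebra H} (hMN : M ≤ N)
    (hP : IsWStarProduct (S.past s) N P) : vnJoin (S.boundary s) M ≤ P :=
  vnJoin_le ((S.boundary_le_past s).trans hP.left_le) (hMN.trans hP.right_le)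

theorem event_mem_join {s t : ℝ≥0} (hst : s < t) {Δ : Set Ω}
    (hΔ : MeasurableSet[S.eventSeg s t] Δ) :
    S.event Δ ∈ vnJoin (S.boundary s) (S.noiseSeg s t) := by
  obtain ⟨h1, h2⟩ := MeasurableSpace.measurableSet_inf.1 hΔ
  exact S.dynamical s t hst (le_vnJoin_left _ _
    ⟨subset_vnGenerated _ ⟨Δ, h1, rfl⟩, subset_vnGenerated _ ⟨Δ, h2, rfl⟩⟩)

theorem boundary_le_join {s t : ℝ≥0} (hst : s < t) :
    S.boundary t ≤ vnJoin (S.boundary s) (S.noiseSeg s t) :=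
  (le_vnJoin_right _ _).trans (S.dynamical s t hst)

theorem measurableSet_of_eventSeg {s t : ℝ≥0} {Δ : Set Ω}
    (hΔ : MeasurableSet[S.eventSeg s t] Δ) : MeasurableSet Δ :=
  S.future_le s _ (MeasurableSpace.measurableSet_inf.1 hΔ).1

/-- Causality: the event belongs to the history up to `t`, while `𝔟_t` lies in the present and
future. -/
theorem commute_event_boundary {s t : ℝ≥0} {Δ : Set Ω} (hΔ : MeasurableSet[S.eventSeg s t] Δ)
    {b : H →L[ℂ] H} (hb : b ∈ S.boundary t) : Commute (S.event Δ) b :=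
  (VonNeumannAlgebra.mem_commutant_iff.1
    (S.causal t Δ (MeasurableSpace.measurableSet_inf.1 hΔ).2) b
    (S.boundary_le_presentFuture t hb)).symm

/-- `π_s` extends to `𝔟(s) ⊗̄ 𝒜_s^t`. -/
theorem exists_isExtendedRep {s t : ℝ≥0} (hst : s < t) : ∃ p, S.IsExtendedRep s t p := by
  obtain ⟨Θ, hΘ, hm⟩ := (S.product_noiseSeg hst).exists_iso
  -- The extension is the composite `𝔟(s) ⊗̄ 𝒜_s^t → 𝔟_s ⊗̄ 𝒜_s^t → 𝔟_s ∨ 𝒜_s^t`.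
  obtain ⟨Ξ, hΞ, hm'⟩ := exists_join_iso (S.boundary_le_past s) (S.commute_boundary_noiseSeg s t)
    hΘ hm
  obtain ⟨Λ, hΛ, hm''⟩ := exists_tensor_iso (S.rep_normal s) (S.noiseSeg s t)
  refine ⟨Λ.trans Ξ, hΛ.trans hΞ, fun q a ha x hx => ?_⟩
  have h1 : x = tensorElem q (⟨a, ha⟩ : (S.noiseSeg s t).toStarSubalgebra) := Subtype.ext hx
  have h2 := hm' (S.rep s q) ⟨a, ha⟩
  rw [← hm'', ← h1] at h2
  exact h2

theorem exists_isTransitionalMeasure {s t : ℝ≥0} (hst : s < t) :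
    ∃ Υ, S.IsTransitionalMeasure s t Υ := by
  classical
  obtain ⟨p, hp⟩ := S.exists_isExtendedRep hst
  -- Outside the segment's events the value is immaterial; zero is taken. On them dynamicity puts
  -- `E(Δ)` in the range of `p`.
  let Es : Set Ω → (S.objectNoise s t).toStarSubalgebra := fun Δ =>
    if hΔ : MeasurableSet[S.eventSeg s t] Δ then p.symm ⟨S.event Δ, S.event_mem_join hst hΔ⟩ else 0
  obtain ⟨γ, hγ⟩ := exists_starAlgHom_lift p (S.boundary_le_join hst) (S.rep t)
  refine ⟨fun Δ => (LinearMap.mulLeft ℂ (Es Δ)) ∘ₗ γ.toAlgHom.toLinearMap, p, hp, Es, γ,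
    fun Δ hΔ => ?_, hγ, fun Δ hΔ q => rfl⟩
  simp only [Es, dif_pos hΔ, p.apply_symm_apply]

variable {S}

theorem IsExtendedRep.apply_tensorElem {s t : ℝ≥0}
    {p : (S.objectNoise s t).toStarSubalgebra ≃⋆ₐ[ℂ]
      (vnJoin (S.boundary s) (S.noiseSeg s t)).toStarSubalgebra} (hp : S.IsExtendedRep s t p)
    (q : (S.object s).toStarSubalgebra) (a : (S.noiseSeg s t).toStarSubalgebra) :
    (p (tensorElem q a) : H →L[ℂ] H) = (S.rep s q : H →L[ℂ] H) * a :=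
  hp.2 q a a.2 (tensorElem q a) rfl

variable {ϱ : ∀ t, (S.noise t).toStarSubalgebra →ₗ[ℂ] ℂ}

/-- The conditional expectation `𝔟(s) ⊗̄ 𝒜_s^t → 𝔟(s)`. -/
theorem exists_objectExpectation (hϱ : ∀ t, IsNormalState (S.noise t) (ϱ t)) (s t : ℝ≥0) :
    ∃ R, IsNoiseExpectation (S.object s) (S.noise s) (ϱ s) (S.noiseSeg s t) (S.objectNoise s t)
        tensorOp R ∧ IsNormalMap (S.objectNoise s t) (S.object s) R ∧
      IsCompletelyPositive (S.objectNoise s t) (S.object s) R ∧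
      ∀ q a, R (tensorElem q a) = ϱ s (inclMap (S.noiseSeg_le_noise s t) a) • q := by
  obtain ⟨R, h1, h2, h3, h4, -⟩ := exists_noiseExpectation (μ := tensorOp)
    (isWStarIso_refl (vnTensor (S.object s) (S.noiseSeg s t))) (S.noiseSeg_le_noise s t)
    (fun _ _ => rfl) (hϱ s)
  exact ⟨R, h1, h2, h3, h4⟩

theorem objectExpectation_unique {s t : ℝ≥0}
    {R R' : (S.objectNoise s t).toStarSubalgebra →ₗ[ℂ] (S.object s).toStarSubalgebra}
    (hR : IsNoiseExpectation (S.object s) (S.noise s) (ϱ s) (S.noiseSeg s t) (S.objectNoise s t)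
      tensorOp R)
    (hR' : IsNoiseExpectation (S.object s) (S.noise s) (ϱ s) (S.noiseSeg s t) (S.objectNoise s t)
      tensorOp R') : R = R' :=
  IsNoiseExpectation.unique (isWStarIso_refl (vnTensor (S.object s) (S.noiseSeg s t)))
    (S.noiseSeg_le_noise s t) (fun _ _ => rfl) hR hR'

theorem objectExpectation_one (hϱ : ∀ t, IsNormalState (S.noise t) (ϱ t)) {s t : ℝ≥0}
    {R : (S.objectNoise s t).toStarSubalgebra →ₗ[ℂ] (S.object s).toStarSubalgebra}
    (hR : ∀ q a, R (tensorElem q a) = ϱ s (inclMap (S.noiseSeg_le_noise s t) a) • q) : R 1 = 1 := by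
  have h1 : (tensorElem 1 1 : (vnTensor (S.object s) (S.noiseSeg s t)).toStarSubalgebra) = 1 :=
    Subtype.ext (map_one (leftTensor (h s) H))
  have h2 : inclMap (S.noiseSeg_le_noise s t) 1 = 1 := map_one _
  have h3 := hR 1 1
  rw [h2, (hϱ s).2.2, one_smul] at h3
  exact (congrArg R h1).symm.trans h3

/-- The representations intertwine the two conditional expectations with respect to the noise. -/
theorem rep_objectExpectation {s t : ℝ≥0}
    {p : (S.objectNoise s t).toStarSubalgebra ≃⋆ₐ[ℂ]
      (vnJoin (S.boundary s) (S.noiseSeg s t)).toStarSubalgebra} (hp : S.IsExtendedRep s t p)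
    {R : (S.objectNoise s t).toStarSubalgebra →ₗ[ℂ] (S.object s).toStarSubalgebra}
    (hRn : IsNormalMap (S.objectNoise s t) (S.object s) R)
    (hR : ∀ q a, R (tensorElem q a) = ϱ s (inclMap (S.noiseSeg_le_noise s t) a) • q)
    {N P : VonNeumannAlgebra H} (hSN : S.noiseSeg s t ≤ N) (hNA : N ≤ S.noise s)
    (hP : IsWStarProduct (S.past s) N P) {ε : P.toStarSubalgebra →ₗ[ℂ] (S.past s).toStarSubalgebra}
    (hεn : IsNormalMap P (S.past s) ε)
    (hε : ∀ (a : (S.past s).toStarSubalgebra) (b : N.toStarSubalgebra) (x : P.toStarSubalgebra),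
      (x : H →L[ℂ] H) = a * b → ε x = ϱ s (inclMap hNA b) • a)
    (y : (S.objectNoise s t).toStarSubalgebra) :
    (S.rep s (R y) : H →L[ℂ] H) = ε (inclMap (S.join_le hSN hP) (p y)) := by
  ext η
  refine ext_inner_left ℂ fun ξ => ?_
  have h1 := hRn _ ((S.rep_normal s).normal _
    (isNormalFunctional_vectorFunctional (S.boundary s) ξ η))
  have h2 := hp.1.normal _ (isNormalMap_inclMap (S.join_le hSN hP) _ (hεn _
    (isNormalFunctional_vectorFunctional (S.past s) ξ η)))
  -- On `q ⊗ a` both sides equal `ϱ_s(a) π_s(q)`, and both are normal.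
  refine LinearMap.congr_fun (IsNormalFunctional.eq_of_forall_tensorElem h1 h2 fun q a => ?_) y
  have h3 := hε (inclMap (S.boundary_le_past s) (S.rep s q)) (inclMap hSN a)
    (inclMap (S.join_le hSN hP) (p (tensorElem q a))) (hp.apply_tensorElem q a)
  change inner ℂ ξ ((S.rep s (R (tensorElem q a)) : H →L[ℂ] H) η) =
    inner ℂ ξ ((ε (inclMap (S.join_le hSN hP) (p (tensorElem q a))) : H →L[ℂ] H) η)
  rw [h3, hR, map_smul]
  rfl

variable {ϖ : S.total.toStarSubalgebra →ₗ[ℂ] ℂ}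

/-- The conditional expectations onto the past preserve the product state. -/
theorem condExpectation_preserves (hϖ : IsNormalState S.total ϖ) (hprod : S.IsProductState ϖ ϱ)
    {s t : ℝ≥0} (hst : s < t)
    {ε : (S.past t).toStarSubalgebra →ₗ[ℂ] (S.past s).toStarSubalgebra}
    (hεn : IsNormalMap (S.past t) (S.past s) ε)
    (hε : ∀ (a : (S.past s).toStarSubalgebra) (b : (S.noiseSeg s t).toStarSubalgebra)
      (x : (S.past t).toStarSubalgebra), (x : H →L[ℂ] H) = a * b →
        ε x = ϱ s (inclMap (S.noiseSeg_le_noise s t) b) • a) (x : (S.past t).toStarSubalgebra) :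
    ϖ (inclMap (S.past_le s) (ε x)) = ϖ (inclMap (S.past_le t) x) := by
  have h1 := hεn _ (isNormalMap_inclMap (S.past_le s) ϖ hϖ.1)
  have h2 := isNormalMap_inclMap (S.past_le t) ϖ hϖ.1
  refine LinearMap.congr_fun ((S.product_noiseSeg hst).normal_ext h1 h2 fun a b y hy => ?_) x
  change ϖ (inclMap (S.past_le s) (ε y)) = ϖ (inclMap (S.past_le t) y)
  have h3 : inclMap (S.past_le t) y = inclMap (S.past_le s) a *
      inclMap ((S.noiseSeg_le_past s t).trans (S.past_le t)) b := Subtype.ext hy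
  -- On products, preservation of `ϖ` is exactly the product formula.
  rw [h3, hprod s t hst _ _ (inclMap (S.noiseSeg_le_noise s t) b) a.2 rfl b.2.2, hε a b y hy,
    map_smul, map_smul, smul_eq_mul, mul_comm]

/-- The expectation sends a product of a boundary element and a noise element to a multiple of the
boundary element; normality extends this to `𝔟_s ∨ 𝒜_s^t`. -/
theorem isMarkovian_of_isProductState (hϖ : IsNormalState S.total ϖ)
    (hϱ : ∀ t, IsNormalState (S.noise t) (ϱ t)) (hprod : S.IsProductState ϖ ϱ) :
    S.IsMarkovian ϖ := by
  intro s t hst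
  obtain ⟨ε, -, h2, h3⟩ := (S.product_noiseSeg hst).exists_condExpectation
    (S.noiseSeg_le_noise s t) (hϱ s)
  refine ⟨ε, h2, fun x y z hy hz => ?_, ?_⟩
  · have h4 := condExpectation_preserves hϖ hprod hst h2.2.1 h3 x
    have ey : y = inclMap (S.past_le t) x := Subtype.ext hy
    have ez : z = inclMap (S.past_le s) (ε x) := Subtype.ext hz
    rw [ey, ez, h4]
  · refine map_mem_of_mem_vnJoin (S.commute_boundary_noiseSeg s t)
      (S.join_le le_rfl (S.product_noiseSeg hst)) h2.2.1 fun a ha b hb x hx => ?_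
    rw [h3 ⟨a, S.boundary_le_past s ha⟩ ⟨b, hb⟩ x hx]
    exact (S.boundary s).toStarSubalgebra.smul_mem ha _

/-- The noise states are consistent: `ϱ_s(a b) = ϱ_s(a) ϱ_t(b)` for noise in adjacent segments. -/
theorem noise_mul (hϖ : IsNormalState S.total ϖ) (hprod : S.IsProductState ϖ ϱ) {s t u : ℝ≥0}
    (hst : s < t) (htu : t < u) (a : (S.noiseSeg s t).toStarSubalgebra)
    (b : (S.noiseSeg t u).toStarSubalgebra) (c : (S.noiseSeg s u).toStarSubalgebra)
    (hc : (c : H →L[ℂ] H) = a * b) :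
    ϱ s (inclMap (S.noiseSeg_le_noise s u) c) = ϱ s (inclMap (S.noiseSeg_le_noise s t) a) *
      ϱ t (inclMap (S.noiseSeg_le_noise t u) b) := by
  let ta : S.total.toStarSubalgebra := inclMap ((S.noiseSeg_le_past s t).trans (S.past_le t)) a
  let tb : S.total.toStarSubalgebra := inclMap ((S.noiseSeg_le_past t u).trans (S.past_le u)) b
  let tc : S.total.toStarSubalgebra := inclMap ((S.noiseSeg_le_past s u).trans (S.past_le u)) c
  -- With past factor 1, `ϖ` restricts to `ϱ_s` on the noise segments from `s`. In the third
  -- instance, `a` itself serves as the past factor at time `t`.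
  have h1 := hprod s u (hst.trans htu) 1 tc (inclMap (S.noiseSeg_le_noise s u) c)
    (one_mem (S.past s)) rfl c.2.2
  have h2 := hprod s t hst 1 ta (inclMap (S.noiseSeg_le_noise s t) a) (one_mem (S.past s)) rfl a.2.2
  have h3 := hprod t u htu ta tb (inclMap (S.noiseSeg_le_noise t u) b) a.2.2 rfl b.2.2
  have h4 : tc = ta * tb := Subtype.ext hc
  rw [one_mul, hϖ.2.2, one_mul] at h1 h2
  rw [← h1, ← h2, h4, h3]

/-- The conditional expectations onto the past form a projective system. -/
theorem condExpectation_comp (hϖ : IsNormalState S.total ϖ) (hprod : S.IsProductState ϖ ϱ)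
    {s t u : ℝ≥0} (hst : s < t) (htu : t < u)
    {ε₁ : (S.past t).toStarSubalgebra →ₗ[ℂ] (S.past s).toStarSubalgebra}
    {ε₂ : (S.past u).toStarSubalgebra →ₗ[ℂ] (S.past t).toStarSubalgebra}
    {ε₃ : (S.past u).toStarSubalgebra →ₗ[ℂ] (S.past s).toStarSubalgebra}
    (hn₁ : IsNormalMap (S.past t) (S.past s) ε₁) (hn₂ : IsNormalMap (S.past u) (S.past t) ε₂)
    (hn₃ : IsNormalMap (S.past u) (S.past s) ε₃)
    (h₁ : ∀ (a : (S.past s).toStarSubalgebra) (b : (S.noiseSeg s t).toStarSubalgebra)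
      (x : (S.past t).toStarSubalgebra), (x : H →L[ℂ] H) = a * b →
        ε₁ x = ϱ s (inclMap (S.noiseSeg_le_noise s t) b) • a)
    (h₂ : ∀ (a : (S.past t).toStarSubalgebra) (b : (S.noiseSeg t u).toStarSubalgebra)
      (x : (S.past u).toStarSubalgebra), (x : H →L[ℂ] H) = a * b →
        ε₂ x = ϱ t (inclMap (S.noiseSeg_le_noise t u) b) • a)
    (h₃ : ∀ (a : (S.past s).toStarSubalgebra) (b : (S.noiseSeg s u).toStarSubalgebra)
      (x : (S.past u).toStarSubalgebra), (x : H →L[ℂ] H) = a * b →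
        ε₃ x = ϱ s (inclMap (S.noiseSeg_le_noise s u) b) • a)
    (x : (S.past u).toStarSubalgebra) : ε₁ (ε₂ x) = ε₃ x := by
  refine vectorFunctional_ext fun ξ η => ?_
  have hv := isNormalFunctional_vectorFunctional (S.past s) ξ η
  -- For fixed `b` this is `ε₃(y b) = ϱ_t(b) ε₁(y)` on `ℬ_{t]}`, tested in a vector functional. It
  -- is checked on `y = a b'`, where multiplicativity of the noise states splits `ϱ_s(b' b)`. The
  -- factor 1 only fits the two-sided multiplication map.
  have hadj (b : (S.noiseSeg t u).toStarSubalgebra) :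
      (ϱ t (inclMap (S.noiseSeg_le_noise t u) b)) • (vectorFunctional (S.past s) ξ η ∘ₗ ε₁) =
        ((vectorFunctional (S.past s) ξ η ∘ₗ ε₃) ∘ₗ
          LinearMap.mulLeftRight ℂ (1, inclMap (S.noiseSeg_le_past t u) b)) ∘ₗ
          (inclMap (S.past_mono htu.le)).toAlgHom.toLinearMap := by
    refine (S.product_noiseSeg hst).normal_ext ((hn₁ _ hv).smul _)
      (isNormalMap_inclMap _ _ ((hn₃ _ hv).mul_mul _ _)) fun a b' y hy => ?_
    let c : (S.noiseSeg s u).toStarSubalgebra := ⟨(b' : H →L[ℂ] H) * b,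
      mul_mem b'.2.1 (S.noise_anti hst.le b.2.1),
      mul_mem (S.past_mono htu.le b'.2.2) b.2.2⟩
    have e1 := h₁ a b' y hy
    have e2 := h₃ a c (1 * inclMap (S.past_mono htu.le) y * inclMap (S.noiseSeg_le_past t u) b) (by
      rw [one_mul]
      change (y : H →L[ℂ] H) * (b : H →L[ℂ] H) = a * ((b' : H →L[ℂ] H) * b)
      rw [hy, mul_assoc])
    rw [noise_mul hϖ hprod hst htu b' b c rfl] at e2
    change _ * vectorFunctional (S.past s) ξ η (ε₁ y) = vectorFunctional (S.past s) ξ η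
      (ε₃ (1 * inclMap (S.past_mono htu.le) y * inclMap (S.noiseSeg_le_past t u) b))
    rw [e1, e2, map_smul, map_smul, smul_eq_mul, smul_eq_mul]
    ring
  refine LinearMap.congr_fun ((S.product_noiseSeg htu).normal_ext
    (φ := (vectorFunctional (S.past s) ξ η ∘ₗ ε₁) ∘ₗ ε₂)
    (ψ := vectorFunctional (S.past s) ξ η ∘ₗ ε₃) (hn₂ _ (hn₁ _ hv)) (hn₃ _ hv)
    fun a b y hy => ?_) x
  have h4 := LinearMap.congr_fun (hadj b) a
  have h5 : y = 1 * inclMap (S.past_mono htu.le) a * inclMap (S.noiseSeg_le_past t u) b :=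
    Subtype.ext (by rw [one_mul]; exact hy)
  change vectorFunctional (S.past s) ξ η (ε₁ (ε₂ y)) = vectorFunctional (S.past s) ξ η (ε₃ y)
  rw [h₂ a b y hy, map_smul, map_smul]
  refine h4.trans ?_
  rw [h5]
  rfl

end QSObject

/-! ### Reduced transitional measures -/

section Reduced

variable {H K L K' Ω : Type*} [NormedAddCommGroup H] [InnerProductSpace ℂ H] [CompleteSpace H]
  [NormedAddCommGroup K] [InnerProductSpace ℂ K] [CompleteSpace K]
  [NormedAddCommGroup L] [InnerProductSpace ℂ L] [CompleteSpace L]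
  [NormedAddCommGroup K'] [InnerProductSpace ℂ K'] [CompleteSpace K']
  {M : VonNeumannAlgebra K} {J : VonNeumannAlgebra H} {P : VonNeumannAlgebra L}
  {N : VonNeumannAlgebra K'} {p : P.toStarSubalgebra ≃⋆ₐ[ℂ] J.toStarSubalgebra}
  {γ : M.toStarSubalgebra →⋆ₐ[ℂ] P.toStarSubalgebra}

theorem eq_of_coe_apply_eq (p : P.toStarSubalgebra ≃⋆ₐ[ℂ] J.toStarSubalgebra)
    {x y : P.toStarSubalgebra} (hxy : (p x : H →L[ℂ] H) = p y) : x = y :=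
  EquivLike.injective p (Subtype.ext hxy)

theorem IsWStarIso.isNormalMap_lift (hp : IsWStarIso P J p) {J' : VonNeumannAlgebra H} (hJ : J' ≤ J)
    {r : M.toStarSubalgebra ≃⋆ₐ[ℂ] J'.toStarSubalgebra} (hr : IsWStarIso M J' r)
    (hγ : ∀ q, (p (γ q) : H →L[ℂ] H) = (r q : H →L[ℂ] H)) :
    IsNormalMap M P γ.toAlgHom.toLinearMap := fun φ hφ => by
  have h1 := hr.normal _ (isNormalMap_inclMap hJ _ (hp.symm.normal _ hφ))
  convert h1 using 1
  refine LinearMap.ext fun q => congrArg φ ?_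
  exact eq_of_coe_apply_eq p ((hγ q).trans
    (congrArg Subtype.val (p.apply_symm_apply (inclMap hJ (r q)))).symm)

/-- Let `p` represent `P` on `H`, and let `E` be a spectral measure in the range of `p` that
commutes with the range of `p ∘ γ`. Then the maps `q ↦ R (p⁻¹(E Δ) γ(q))` form a transfer
measure. -/
theorem IsSpectralMeasure.isTransferMeasure {𝔄 : MeasurableSpace Ω} [mΩ : MeasurableSpace Ω]
    {E : Set Ω → H →L[ℂ] H} (hE : IsSpectralMeasure E) (h𝔄 : 𝔄 ≤ mΩ) (hp : IsWStarIso P J p)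
    {Es : Set Ω → P.toStarSubalgebra}
    (hEs : ∀ Δ, MeasurableSet[𝔄] Δ → (p (Es Δ) : H →L[ℂ] H) = E Δ)
    (hγ : IsNormalMap M P γ.toAlgHom.toLinearMap)
    (hc : ∀ Δ, MeasurableSet[𝔄] Δ → ∀ q, Commute (E Δ) (p (γ q) : H →L[ℂ] H))
    {R : P.toStarSubalgebra →ₗ[ℂ] N.toStarSubalgebra} (hRn : IsNormalMap P N R)
    (hRc : IsCompletelyPositive P N R) (hR1 : R 1 = 1)
    {T : Set Ω → (M.toStarSubalgebra →ₗ[ℂ] N.toStarSubalgebra)}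
    (hT : ∀ Δ, MeasurableSet[𝔄] Δ → ∀ q, T Δ q = R (Es Δ * γ q)) :
    IsTransferMeasure 𝔄 M N T := by
  have hmul (x y : P.toStarSubalgebra) : (p (x * y) : H →L[ℂ] H) = (p x : H →L[ℂ] H) * p y :=
    congrArg Subtype.val (map_mul p x y)
  have hcomm (Δ) (hΔ : MeasurableSet[𝔄] Δ) (q) : Es Δ * γ q = γ q * Es Δ :=
    eq_of_coe_apply_eq p <| by
      rw [hmul, hmul, hEs Δ hΔ]
      exact hc Δ hΔ q
  have hidem (Δ) (hΔ : MeasurableSet[𝔄] Δ) : Es Δ * Es Δ = Es Δ :=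
    eq_of_coe_apply_eq p <| by
      rw [hmul, hEs Δ hΔ]
      exact (hE.proj Δ (h𝔄 _ hΔ)).isIdempotentElem
  have hstar (Δ) (hΔ : MeasurableSet[𝔄] Δ) : star (Es Δ) = Es Δ :=
    eq_of_coe_apply_eq p <| by
      refine (congrArg Subtype.val (map_star p (Es Δ))).trans ?_
      change star (p (Es Δ) : H →L[ℂ] H) = p (Es Δ)
      rw [hEs Δ hΔ]
      exact (hE.proj Δ (h𝔄 _ hΔ)).isSelfAdjoint
  refine ⟨fun Δ hΔ φ hφ => ?_, fun Δ hΔ n x ξ => ?_, fun φ hφ q Δ hΔ hd => ?_, ?_⟩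
  · have h2 := hγ _ ((hRn φ hφ).mul_mul (Es Δ) 1)
    convert h2 using 1
    refine LinearMap.ext fun q => ?_
    change φ (T Δ q) = φ (R (Es Δ * γ q * 1))
    rw [mul_one, hT Δ hΔ]
  · have h2 := hRc n (fun i => Es Δ * γ (x i)) ξ
    -- A projection commuting with the range of `γ` makes `q ↦ E γ(q)` multiplicative and
    -- star-preserving, so complete positivity is inherited from `R`.
    have h3 (i k) : star (Es Δ * γ (x i)) * (Es Δ * γ (x k)) = Es Δ * γ (star (x i) * x k) := by
      rw [star_mul, hstar Δ hΔ, mul_assoc, ← mul_assoc (Es Δ), hidem Δ hΔ, hcomm Δ hΔ,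
        ← mul_assoc, ← map_star, ← map_mul, hcomm Δ hΔ]
    simp only [h3, ← hT Δ hΔ] at h2
    exact h2
  -- The functional `φ ∘ R ∘ p⁻¹` is normal on the range of `p`, where additivity of `E` is
  -- available; `γ(q)` is absorbed into the vector `η`.
  · obtain ⟨ξ, η, e⟩ := isNormalFunctional_iff.1 (hp.symm.normal _ (hRn φ hφ))
    have hφT (Δ) (hΔ : MeasurableSet[𝔄] Δ) : φ (T Δ q) =
        inner ℂ ξ (amp H (E Δ) (amp H (p (γ q) : H →L[ℂ] H) η)) := by
      have h2 := e (p (Es Δ * γ q))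
      have h3 : isoMap p.symm (p (Es Δ * γ q)) = Es Δ * γ q := p.symm_apply_apply _
      rw [LinearMap.comp_apply, h3, LinearMap.comp_apply, ← hT Δ hΔ, hmul, hEs Δ hΔ, map_mul] at h2
      exact h2
    have h2 := hE.hasSum_inner_amp (fun n => h𝔄 _ (hΔ n)) hd ξ (amp H (p (γ q) : H →L[ℂ] H) η)
    rw [← hφT _ (@MeasurableSet.iUnion _ _ 𝔄 _ _ hΔ)] at h2
    convert h2 using 2 with n
    exact hφT _ (hΔ n)
  · have hu : MeasurableSet[𝔄] (Set.univ : Set Ω) := @MeasurableSet.univ _ 𝔄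
    have h2 : Es Set.univ = 1 := eq_of_coe_apply_eq p <| by
      rw [hEs _ hu, hE.univ]
      exact (congrArg Subtype.val (map_one p)).symm
    rw [hT _ hu, h2, map_one, mul_one, hR1]

end Reduced

namespace QSObject

variable {H Ω : Type*} [NormedAddCommGroup H] [InnerProductSpace ℂ H] [CompleteSpace H]
  [MeasurableSpace Ω] {h : ℝ≥0 → Type*} [∀ t, NormedAddCommGroup (h t)]
  [∀ t, InnerProductSpace ℂ (h t)] [∀ t, CompleteSpace (h t)] {S : QSObject H Ω h}
  {ϱ : ∀ t, (S.noise t).toStarSubalgebra →ₗ[ℂ] ℂ}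

theorem measurableSet_inter {s t u : ℝ≥0} (hst : s < t) (htu : t < u) {Δ Δ' : Set Ω}
    (hΔ : MeasurableSet[S.eventSeg s t] Δ) (hΔ' : MeasurableSet[S.eventSeg t u] Δ') :
    MeasurableSet[S.eventSeg s u] (Δ ∩ Δ') := by
  obtain ⟨h1, h2⟩ := MeasurableSpace.measurableSet_inf.1 hΔ
  obtain ⟨h3, h4⟩ := MeasurableSpace.measurableSet_inf.1 hΔ'
  exact MeasurableSpace.measurableSet_inf.2
    ⟨@MeasurableSet.inter _ (S.future s) _ _ h1 (S.future_anti hst.le _ h3),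
      @MeasurableSet.inter _ (S.history u) _ _ (S.history_mono htu.le _ h2) h4⟩

/-- The reduced transitional measures are transfer measures. -/
theorem IsTransitionalMeasure.isTransferMeasure (hϱ : ∀ t, IsNormalState (S.noise t) (ϱ t))
    {s t : ℝ≥0} (hst : s < t)
    {Υ : Set Ω → ((S.object t).toStarSubalgebra →ₗ[ℂ] (S.objectNoise s t).toStarSubalgebra)}
    (hΥ : S.IsTransitionalMeasure s t Υ)
    {R : (S.objectNoise s t).toStarSubalgebra →ₗ[ℂ] (S.object s).toStarSubalgebra}
    (hR : IsNoiseExpectation (S.object s) (S.noise s) (ϱ s) (S.noiseSeg s t) (S.objectNoise s t)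
      tensorOp R)
    {T : Set Ω → ((S.object t).toStarSubalgebra →ₗ[ℂ] (S.object s).toStarSubalgebra)}
    (hT : ∀ Δ q, T Δ q = R (Υ Δ q)) :
    IsTransferMeasure (S.eventSeg s t) (S.object t) (S.object s) T := by
  obtain ⟨p, hp, Es, γ, hEs, hγ, hΥ⟩ := hΥ
  obtain ⟨R', h1, hRn, hRc, hRt⟩ := exists_objectExpectation hϱ s t
  obtain rfl := objectExpectation_unique hR h1
  refine S.event_spectral.isTransferMeasure (inf_le_left.trans (S.future_le s)) hp.1 hEs
    (hp.1.isNormalMap_lift (S.boundary_le_join hst) (S.rep_normal t) hγ) (fun Δ hΔ q => ?_) hRn hRc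
    (objectExpectation_one hϱ hRt) fun Δ hΔ q => by rw [hT, hΥ Δ hΔ]
  rw [hγ]
  exact S.commute_event_boundary hΔ (S.rep t q).2

/-- The reduced transitional measures are given by the conditional expectations onto the past. -/
theorem IsTransitionalMeasure.rep_reduced (hϱ : ∀ t, IsNormalState (S.noise t) (ϱ t))
    {s t : ℝ≥0}
    {Υ : Set Ω → ((S.object t).toStarSubalgebra →ₗ[ℂ] (S.objectNoise s t).toStarSubalgebra)}
    (hΥ : S.IsTransitionalMeasure s t Υ)
    {R : (S.objectNoise s t).toStarSubalgebra →ₗ[ℂ] (S.object s).toStarSubalgebra}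
    (hR : IsNoiseExpectation (S.object s) (S.noise s) (ϱ s) (S.noiseSeg s t) (S.objectNoise s t)
      tensorOp R)
    {N P : VonNeumannAlgebra H} (hSN : S.noiseSeg s t ≤ N) (hNA : N ≤ S.noise s)
    (hP : IsWStarProduct (S.past s) N P) {ε : P.toStarSubalgebra →ₗ[ℂ] (S.past s).toStarSubalgebra}
    (hε : IsNoiseExpectation (S.past s) (S.noise s) (ϱ s) N P (fun b a => b * a) ε) {Δ : Set Ω}
    (hΔ : MeasurableSet[S.eventSeg s t] Δ) (q : (S.object t).toStarSubalgebra)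
    (x : P.toStarSubalgebra) (hx : (x : H →L[ℂ] H) = S.event Δ * (S.rep t q : H →L[ℂ] H)) :
    (S.rep s (R (Υ Δ q)) : H →L[ℂ] H) = ε x := by
  obtain ⟨p, hp, Es, γ, hEs, hγ, hΥ⟩ := hΥ
  obtain ⟨R', h1, hRn, hRc, hRt⟩ := exists_objectExpectation hϱ s t
  obtain rfl := objectExpectation_unique hR h1
  obtain ⟨h2, h3⟩ := IsNoiseExpectation.condExpectation hP hNA (hϱ s) hε
  rw [rep_objectExpectation hp hRn hRt hSN hNA hP h2.2.1 h3, hΥ Δ hΔ]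
  have : inclMap (S.join_le hSN hP) (p (Es Δ * γ q)) = x := Subtype.ext <| by
    rw [hx, ← hEs Δ hΔ, ← hγ]
    exact congrArg Subtype.val (map_mul p (Es Δ) (γ q))
  rw [this]

end QSObject

theorem mainTheorem9 {H Ω : Type*} [NormedAddCommGroup H] [InnerProductSpace ℂ H]
    [CompleteSpace H] [MeasurableSpace Ω] {h : ℝ≥0 → Type*} [∀ t, NormedAddCommGroup (h t)]
    [∀ t, InnerProductSpace ℂ (h t)] [∀ t, CompleteSpace (h t)] (S : QSObject H Ω h)
    (ϖ : S.total.toStarSubalgebra →ₗ[ℂ] ℂ) (hϖ : IsNormalState S.total ϖ)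
    (ϱ : ∀ t, (S.noise t).toStarSubalgebra →ₗ[ℂ] ℂ) (hϱ : ∀ t, IsNormalState (S.noise t) (ϱ t))
    (hprod : S.IsProductState ϖ ϱ) :
    -- the object is Markovian
    S.IsMarkovian ϖ ∧
    -- the conditional expectations `ϱ_s⋆` onto the past exist, uniquely, on every `ℬ_{s]} ⊗̄ 𝒩`
    -- with `𝒩 ⊆ 𝒜_s` realized in `ℬ(H)` (on every `ℬ_{t]}`, and on `ℬ` if it is a W*-product)
    (∀ s (N P : VonNeumannAlgebra H), N ≤ S.noise s → IsWStarProduct (S.past s) N P →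
      (∃! ε, IsNoiseExpectation (S.past s) (S.noise s) (ϱ s) N P (fun b a => b * a) ε) ∧
      ∀ ε, IsNoiseExpectation (S.past s) (S.noise s) (ϱ s) N P (fun b a => b * a) ε →
        IsCondExpectation P (S.past s) ε) ∧
    -- they exist uniquely on `𝔟(s) ⊗̄ 𝒜_s^t` as well, and so do the transitional measures
    (∀ s t, s < t → ∃! R, IsNoiseExpectation (S.object s) (S.noise s) (ϱ s) (S.noiseSeg s t)
      (S.objectNoise s t) tensorOp R) ∧
    (∀ s t, s < t → ∃ Υ, S.IsTransitionalMeasure s t Υ) ∧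
    -- the reduced transitional measures `T_s^t(Δ, q) = ϱ_s⋆ [Υ_s^t(Δ, q)]`
    ∀ (Υ : ∀ s t, Set Ω →
        ((S.object t).toStarSubalgebra →ₗ[ℂ] (S.objectNoise s t).toStarSubalgebra))
      (R : ∀ s t, (S.objectNoise s t).toStarSubalgebra →ₗ[ℂ] (S.object s).toStarSubalgebra)
      (T : ∀ s t, Set Ω → ((S.object t).toStarSubalgebra →ₗ[ℂ] (S.object s).toStarSubalgebra)),
      (∀ s t, s < t → S.IsTransitionalMeasure s t (Υ s t)) →
      (∀ s t, s < t → IsNoiseExpectation (S.object s) (S.noise s) (ϱ s) (S.noiseSeg s t)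
        (S.objectNoise s t) tensorOp (R s t)) →
      (∀ s t Δ q, T s t Δ q = R s t (Υ s t Δ q)) →
      -- are normal completely positive map-valued measures,
      (∀ s t, s < t → IsTransferMeasure (S.eventSeg s t) (S.object t) (S.object s) (T s t)) ∧
      -- satisfy the Chapman-Kolmogorov equation,
      (∀ s t u, s < t → t < u → ∀ Δ Δ', MeasurableSet[S.eventSeg s t] Δ →
        MeasurableSet[S.eventSeg t u] Δ' →
          MeasurableSet[S.eventSeg s u] (Δ ∩ Δ') ∧
          ∀ q, T s t Δ (T t u Δ' q) = T s u (Δ ∩ Δ') q) ∧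
      -- are given by the conditional expectations onto the past,
      (∀ s t, s < t → ∀ N P : VonNeumannAlgebra H, S.noiseSeg s t ≤ N → N ≤ S.noise s →
        IsWStarProduct (S.past s) N P → ∀ ε,
          IsNoiseExpectation (S.past s) (S.noise s) (ϱ s) N P (fun b a => b * a) ε →
          ∀ Δ, MeasurableSet[S.eventSeg s t] Δ → ∀ q, ∀ x : P.toStarSubalgebra,
            (x : H →L[ℂ] H) = S.event Δ * (S.rep t q : H →L[ℂ] H) →
              (S.rep s (T s t Δ q) : H →L[ℂ] H) = ε x) ∧
      -- and describe the object in the state `ϖ`.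
      (∀ s t, s < t → ∀ Δ, MeasurableSet[S.eventSeg s t] Δ → ∀ q,
        ∀ b x y : S.total.toStarSubalgebra, (b : H →L[ℂ] H) ∈ S.past s →
          (x : H →L[ℂ] H) = S.event Δ * (S.rep t q : H →L[ℂ] H) →
          (y : H →L[ℂ] H) = (S.rep s (T s t Δ q) : H →L[ℂ] H) →
            ϖ (b * x) = ϖ (b * y)) := by
  refine ⟨QSObject.isMarkovian_of_isProductState hϖ hϱ hprod, fun s N P hNA hP => ⟨?_, fun ε hε =>
      (IsNoiseExpectation.condExpectation hP hNA (hϱ s) hε).1⟩,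
    fun s t hst => ?_, fun s t hst => S.exists_isTransitionalMeasure hst,
    fun Υ R T hΥ hR hT => ?_⟩
  · obtain ⟨ε, hε, -⟩ := hP.exists_condExpectation hNA (hϱ s)
    exact ⟨ε, hε, fun ε' hε' => hP.noiseExpectation_unique hNA hε' hε⟩
  · obtain ⟨R, hR, -⟩ := QSObject.exists_objectExpectation hϱ s t
    exact ⟨R, hR, fun R' hR' => QSObject.objectExpectation_unique hR' hR⟩
  have hrep (s t) (hst : s < t) (N P : VonNeumannAlgebra H) (hSN : S.noiseSeg s t ≤ N)
      (hNA : N ≤ S.noise s) (hP : IsWStarProduct (S.past s) N P) (ε)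
      (hε : IsNoiseExpectation (S.past s) (S.noise s) (ϱ s) N P (fun b a => b * a) ε) (Δ)
      (hΔ : MeasurableSet[S.eventSeg s t] Δ) (q) (x : P.toStarSubalgebra)
      (hx : (x : H →L[ℂ] H) = S.event Δ * (S.rep t q : H →L[ℂ] H)) :
      (S.rep s (T s t Δ q) : H →L[ℂ] H) = ε x := by
    rw [hT]
    exact (hΥ s t hst).rep_reduced hϱ (hR s t hst) hSN hNA hP hε hΔ q x hx
  have hpast {s t} (hst : s < t) {Δ} (hΔ : MeasurableSet[S.eventSeg s t] Δ) :
      S.event Δ ∈ S.past t :=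
    S.event_mem_past t Δ (MeasurableSpace.measurableSet_inf.1 hΔ).2
  have hmem {s t} (hst : s < t) {Δ} (hΔ : MeasurableSet[S.eventSeg s t] Δ) (q) :
      S.event Δ * (S.rep t q : H →L[ℂ] H) ∈ S.past t :=
    mul_mem (hpast hst hΔ) (S.boundary_le_past t (S.rep t q).2)
  refine ⟨fun s t hst => (hΥ s t hst).isTransferMeasure hϱ hst (hR s t hst) (hT s t),
    fun s t u hst htu Δ Δ' hΔ hΔ' => ?_, hrep, fun s t hst Δ hΔ q b x y hb hx hy => ?_⟩
  · have hΔΔ' := QSObject.measurableSet_inter hst htu hΔ hΔ'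
    refine ⟨hΔΔ', fun q => ?_⟩
    have hsu := hst.trans htu
    obtain ⟨ε₁, k1, c1, m1⟩ := (S.product_noiseSeg hst).exists_condExpectation
      (S.noiseSeg_le_noise s t) (hϱ s)
    obtain ⟨ε₂, k2, c2, m2⟩ := (S.product_noiseSeg htu).exists_condExpectation
      (S.noiseSeg_le_noise t u) (hϱ t)
    obtain ⟨ε₃, k3, c3, m3⟩ := (S.product_noiseSeg hsu).exists_condExpectation
      (S.noiseSeg_le_noise s u) (hϱ s)
    have hcomp := QSObject.condExpectation_comp hϖ hprod hst htu c1.2.1 c2.2.1 c3.2.1 m1 m2 m3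
    -- Here `z = E(Δ') π_u(q)` and `e = E(Δ)`. The product `e * z * 1` carries a trailing 1 to match
    -- the two-sided module property.
    let z : (S.past u).toStarSubalgebra := ⟨_, hmem htu hΔ' q⟩
    let e : (S.past u).toStarSubalgebra := ⟨_, S.past_mono htu.le (hpast hst hΔ)⟩
    have r2 := hrep t u htu _ _ le_rfl (S.noiseSeg_le_noise t u) (S.product_noiseSeg htu) ε₂ k2 Δ'
      hΔ' q z rfl
    have r3 := hrep s u hsu _ _ le_rfl (S.noiseSeg_le_noise s u) (S.product_noiseSeg hsu) ε₃ k3 _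
      hΔΔ' q (e * z * 1) (by
        rw [mul_one, S.event_spectral.inter _ _ (S.measurableSet_of_eventSeg hΔ)
          (S.measurableSet_of_eventSeg hΔ'), mul_assoc]
        rfl)
    -- Since `E(Δ)` lies in the past up to `t`, it passes through `ε₂`, leaving `E(Δ) π_t(T_t^u(Δ',
    -- q))`.
    have r1 := hrep s t hst _ _ le_rfl (S.noiseSeg_le_noise s t) (S.product_noiseSeg hst) ε₁ k1 Δ
      hΔ (T t u Δ' q) (ε₂ (e * z * 1)) (by
        rw [c2.2.2.2.2 e 1 z (hpast hst hΔ) (one_mem (S.past t)), r2]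
        exact mul_one _)
    refine eq_of_coe_apply_eq (S.rep s) ?_
    rw [r1, r3, hcomp]
  · obtain ⟨ε, k, c, m⟩ := (S.product_noiseSeg hst).exists_condExpectation
      (S.noiseSeg_le_noise s t) (hϱ s)
    let x' : (S.past t).toStarSubalgebra := ⟨_, hmem hst hΔ q⟩
    let b' : (S.past t).toStarSubalgebra := ⟨b, S.past_mono hst.le hb⟩
    have r := hrep s t hst _ _ le_rfl (S.noiseSeg_le_noise s t) (S.product_noiseSeg hst) ε k Δ
      hΔ q x' rfl
    -- Preservation of `ϖ` is applied to `b E(Δ) π_t(q)`, with `b` pulled out of the expectation.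
    have h1 := QSObject.condExpectation_preserves hϖ hprod hst c.2.1 m (b' * x' * 1)
    have h2 : inclMap (S.past_le t) (b' * x' * 1) = b * x := Subtype.ext <| by
      rw [mul_one]
      change (b : H →L[ℂ] H) * _ = b * x
      rw [hx]
    have h3 : inclMap (S.past_le s) (ε (b' * x' * 1)) = b * y := Subtype.ext <| by
      rw [coe_inclMap, c.2.2.2.2 b' 1 x' hb (one_mem (S.past s)), ← r, ← hy]
      exact mul_one _
    rw [← h2, ← h3, h1]
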